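/- **Setup.** Let $0\le k\le n$ with $n\ge 1$. A *$(k,n)$-bounded affine permutation* is a bijection $f:\mathbb Z\to\mathbb Z$ with $f(j+n)=f(j)+n$ and $j\le f(j)\le j+n$ for all $j\in\mathbb Z$, and $\sum_{j=1}^n(f(j)-j)=kn$. Let $\mathbf B_{k,n}$ be the set of these, and let $\bar f\in S_n$ be the reduction of $f$ modulo $n$. *Point counts.* For a $k\times n$ matrix $A$ over a field with columns $A_1,\dots,A_n$, extended by $A_{j+n}=A_j$, put $f_A(i)=\min\{j\ge i: A_i\in\operatorname{Span}(A_{i+1},\dots,A_j)\}$. Let $\Pi^\circ_f$ be the set of row spans of full rank $k\times n$ matrices $A$ with $f_A=f$; it is acted on by the torus $T$ of invertible diagonal $n\times n$ matrices modulo scalars. If $\bar f$ is a single $n$-cycle, $\#(\Pi^\circ_f/T)(\mathbb F_q)$ denotes the number of $T(\mathbb F_q)$-orbits on $\Pi^\circ_f(\mathbb F_q)$. *The pair $(v,w)$.* For $f\in\mathbf B_{k,n}$ let $(v,w)$ be the unique pair of permutations in $S_n$ such that $v\le w$ in the Bruhat order, $w$ is $k$-Grassmannian (that is, $w^{-1}(1)<\dots<w^{-1}(k)$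 and $w^{-1}(k+1)<\dots<w^{-1}(n)$), and, for $1\le i\le n$, $f(i)=v^{-1}(w(i))+n$ if $w(i)\le k$ and $f(i)=v^{-1}(w(i))$ if $w(i)>k$. *Deograms.* Let $\lambda$ be a Young diagram in the top-left corner of a $k\times(n-k)$ rectangle, and let $D$ be a filling of its boxes with crossings and elbows. Label by $1,\dots,n$ the steps of the southeast boundary of $\lambda$ (the lattice path from the southwest to the northeast corner of the rectangle) from southwest to northeast, and likewise label by $1,\dots,n$ the steps of the northwest boundary of the rectangle (first the left side from bottom to top, then the top side from left to right). A path starts at each step of the southeast boundary and travels north and west: at a crossing it goes straight (from south to north, or from east to west), and at an elbow the path entering from the south leaves to the west (the bottom-left path) and the path entering from the east leaves to the north (the top-right path). Let $u_D(i)$ be the label of the step of the northwest boundary through which the path started at step $i$ leaves. The filling $D$ is a *Deogram* if, for each elbow of $D$, the label of its bottom-left path is less than the label of its top-right path. Let $\lambda_w$ be the Young diagram whose filling by crossings only has permutation $w$. An *$f$-Deogram* is a Deogram $D$ of shape $\lambda_w$ with $u_D=v$; it is *maximal* if it has the maximal number of crossings among all $f$-Deograms. **Proposition.** Let $f\in\mathbf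 B_{k,n}$ be such that $\bar f$ is a single $n$-cycle. Then there is a unique polynomial $P_f\in\mathbb Z[q]$ such that $P_f(q)=\#(\Pi^\circ_f/T)(\mathbb F_q)$ for every prime power $q$, and the $f$-Catalan number $C_f:=P_f(1)$ equals the number of maximal $f$-Deograms. Moreover, if $f=f_{k,n}$, that is, $f(j)=j+k$ for all $j\in\mathbb Z$ (so that $\gcd(k,n)=1$), then this number equals the number of lattice paths from $(0,0)$ to $(n-k,k)$, with unit steps up and to the right, that stay weakly above the diagonal of the $k\times(n-k)$ rectangle. -/

import Mathlib

namespace PositroidCatalan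

/-! ### Bounded affine permutations -/

/-- A `(k, n)`-bounded affine permutation: a bijection `f : ℤ → ℤ` with `f (j + n) = f j + n`,
`∑_{j = 1}^{n} (f j - j) = k n` and `j ≤ f j ≤ j + n` for all `j`. -/
structure BoundedAffinePerm (k n : ℕ) where
  toPerm : Equiv.Perm ℤ
  map_add_period : ∀ j : ℤ, toPerm (j + n) = toPerm j + n
  sum_sub : ∑ j ∈ Finset.Icc (1 : ℤ) n, (toPerm j - j) = (k : ℤ) * n
  le_map : ∀ j : ℤ, j ≤ toPerm j
  map_le : ∀ j : ℤ, toPerm j ≤ j + n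

theorem map_add_mul {n : ℕ} {g : ℤ → ℤ} (hg : ∀ j, g (j + n) = g j + n) (j m : ℤ) :
    g (j + n * m) = g j + n * m := by
  induction m using Int.induction_on with
  | zero => simp
  | succ m ih =>
    have h := hg (j + n * m)
    rw [ih] at h
    rw [show j + (n : ℤ) * (m + 1) = j + n * m + n by ring, h]
    ring
  | pred m ih =>
    have h := hg (j + n * (-(m : ℤ) - 1))
    rw [show j + (n : ℤ) * (-(m : ℤ) - 1) + n = j + n * -(m : ℤ) by ring, ih] at h
    linarith

theorem cast_map_eq {n : ℕ} {g : ℤ → ℤ} (hg : ∀ j, g (j + n) = g j + n) {i j : ℤ}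
    (h : (i : ZMod n) = (j : ZMod n)) : ((g i : ℤ) : ZMod n) = ((g j : ℤ) : ZMod n) := by
  rw [ZMod.intCast_eq_intCast_iff_dvd_sub] at h
  obtain ⟨m, hm⟩ := h
  have hj : j = i + n * m := by linarith
  rw [hj, map_add_mul hg]
  simp

theorem symm_map_add_period {k n : ℕ} (f : BoundedAffinePerm k n) (j : ℤ) :
    f.toPerm.symm (j + n) = f.toPerm.symm j + n := by
  rw [Equiv.symm_apply_eq, f.map_add_period, Equiv.apply_symm_apply]

/-- The reduction `f̄` of `f` modulo `n`, a permutation of the `n` residue classes modulo `n`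
(`1, …, n` stand for their residue classes, so that this is an element of `S_n`). -/
def BoundedAffinePerm.reduction {k n : ℕ} (f : BoundedAffinePerm k n) :
    Equiv.Perm (ZMod n) where
  toFun x := ((f.toPerm (x.cast : ℤ) : ℤ) : ZMod n)
  invFun x := ((f.toPerm.symm (x.cast : ℤ) : ℤ) : ZMod n)
  left_inv x := by
    have h := cast_map_eq (g := f.toPerm.symm) (symm_map_add_period f)
      (i := ((((f.toPerm (x.cast : ℤ) : ℤ) : ZMod n)).cast : ℤ)) (j := f.toPerm (x.cast : ℤ))
      (by simp)
    simpa using h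
  right_inv x := by
    have h := cast_map_eq (g := f.toPerm) f.map_add_period
      (i := ((((f.toPerm.symm (x.cast : ℤ) : ℤ) : ZMod n)).cast : ℤ))
      (j := f.toPerm.symm (x.cast : ℤ)) (by simp)
    simpa using h

/-- `f̄` is a single `n`-cycle. This includes `n = 1`, where `f̄` is the identity of a one-point
set; it excludes `n = 0`. -/
def BoundedAffinePerm.IsSingleCycle {k n : ℕ} (f : BoundedAffinePerm k n) : Prop :=
  f.reduction.IsCycleOn Set.univ

/-! ### Open positroid varieties and their torus quotients over a field

The columns of a `k × n` matrix are indexed by `ZMod n`, so that the periodic extension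
`A_{j + n} = A_j` of the sequence of columns is `j ↦ A_{j mod n}`. -/

/-- `f_A = f`: for each `i`, the value `f i` is the least `j ≥ i` such that the column `A_i` lies in
the span of `A_{i+1}, …, A_j` (the zero subspace if `j = i`). -/
def HasPositroidPerm {k n : ℕ} {F : Type} [Field F] (f : BoundedAffinePerm k n)
    (A : Matrix (Fin k) (ZMod n) F) : Prop :=
  ∀ i : ℤ, IsLeast {j : ℤ | i ≤ j ∧
    A.col (i : ZMod n) ∈
      Submodule.span F ((fun m : ℤ => A.col (m : ZMod n)) '' Set.Ioc i j)} (f.toPerm i)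

/-- The `F`-points of the open positroid variety `Π°_f`: the row spans of the full rank `k × n`
matrices `A` over `F` with `f_A = f`. -/
def openPositroid {k n : ℕ} (f : BoundedAffinePerm k n) (F : Type) [Field F] :
    Set (Submodule F (ZMod n → F)) :=
  {V | ∃ A : Matrix (Fin k) (ZMod n) F, LinearIndependent F A.row ∧
    HasPositroidPerm f A ∧ Submodule.span F (Set.range A.row) = V}

/-- The action of an invertible diagonal matrix on row vectors: rescaling of the coordinates. -/
def torusMap {n : ℕ} {F : Type} [Field F] (t : ZMod n → Fˣ) :
    (ZMod n → F) →ₗ[F] (ZMod n → F) :=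
  LinearMap.pi fun i => (t i : F) • LinearMap.proj i

/-- Two points of `Π°_f` are equivalent if they lie in the same orbit of the torus `T` of invertible
diagonal matrices modulo scalar matrices. (Scalar matrices fix every subspace, so these are the
orbits of the group of all invertible diagonal matrices.) -/
def torusSetoid {k n : ℕ} (f : BoundedAffinePerm k n) (F : Type) [Field F] :
    Setoid (openPositroid f F) where
  r V W := ∃ t : ZMod n → Fˣ, V.1.map (torusMap (F := F) t) = W.1
  iseqv :=
    { refl := fun V => ⟨1, by
        have h : (torusMap (F := F) (1 : ZMod n → Fˣ)) = LinearMap.id := by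
          apply LinearMap.ext
          intro x
          funext i
          simp [torusMap]
        rw [h, Submodule.map_id]⟩
      symm := by
        rintro V W ⟨t, ht⟩
        refine ⟨t⁻¹, ?_⟩
        have h : (torusMap (F := F) t⁻¹) ∘ₗ (torusMap (F := F) t)
            = LinearMap.id := by
          apply LinearMap.ext
          intro x
          funext i
          simp [torusMap]
        rw [← ht, ← Submodule.map_comp, h, Submodule.map_id]
      trans := by
        rintro U V W ⟨t, ht⟩ ⟨s, hs⟩
        refine ⟨s * t, ?_⟩
        have h : (torusMap (F := F) (s * t))
            = (torusMap (F := F) s) ∘ₗ (torusMap (F := F) t) := by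
          apply LinearMap.ext
          intro x
          funext i
          simp [torusMap, mul_assoc]
        rw [h, Submodule.map_comp, ht, hs] }

/-- The `F`-points of the positroid configuration space `Π°_f / T`, as the set of `T(F)`-orbits on
`Π°_f(F)`. -/
abbrev ConfigurationSpace {k n : ℕ} (f : BoundedAffinePerm k n) (F : Type) [Field F] : Type :=
  Quotient (torusSetoid f F)

/-- `P` is the point count polynomial of `Π°_f / T`: for every finite field with `q` elements, the
number of points of `Π°_f / T` over this field is `P(q)`. -/
def IsPointCount {k n : ℕ} (f : BoundedAffinePerm k n) (P : Polynomial ℤ) : Prop :=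
  ∀ (F : Type) [Field F] [Finite F],
    (Nat.card (ConfigurationSpace f F) : ℤ) = P.eval (Nat.card F : ℤ)

/-! ### The pair of permutations of a bounded affine permutation

Elements of `Fin n` are `0, …, n - 1`; the index `i : Fin n` stands for the integer `i + 1`. -/

/-- The number of inversions of a permutation. -/
def inversionCount {n : ℕ} (u : Equiv.Perm (Fin n)) : ℕ :=
  (Finset.univ.filter fun p : Fin n × Fin n => p.1 < p.2 ∧ u p.2 < u p.1).card

/-- The strong Bruhat order on `S_n`: the reflexive-transitive closure of multiplying by a
transposition when this raises the number of inversions. -/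
def BruhatLE {n : ℕ} : Equiv.Perm (Fin n) → Equiv.Perm (Fin n) → Prop :=
  Relation.ReflTransGen fun u u' =>
    ∃ a b : Fin n, u' = u * Equiv.swap a b ∧ inversionCount u < inversionCount u'

/-- `w` is `k`-Grassmannian: `w⁻¹(1) < ⋯ < w⁻¹(k)` and `w⁻¹(k+1) < ⋯ < w⁻¹(n)`. -/
def IsGrassmannian {n : ℕ} (k : ℕ) (w : Equiv.Perm (Fin n)) : Prop :=
  ∀ a b : Fin n, a < b → ((b : ℕ) < k ∨ k ≤ (a : ℕ)) → w.symm a < w.symm b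

/-- `(v, w)` is the pair corresponding to `f`, that is, `f = f_{v,w}`: one has `v ≤ w` in the Bruhat
order, `w` is `k`-Grassmannian, and `f` maps `i` to `v⁻¹(w(i)) + n` if `w(i) ≤ k` and to
`v⁻¹(w(i))` if `w(i) > k`, for `1 ≤ i ≤ n`. In other words, `f` is obtained by performing first `w`,
then the translation by `n` of the elements `1, …, k`, and then `v⁻¹`, all extended
`n`-periodically to `ℤ`. -/
def IsPairOf {k n : ℕ} (f : BoundedAffinePerm k n) (v w : Equiv.Perm (Fin n)) : Prop :=
  BruhatLE v w ∧ IsGrassmannian k w ∧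
    ∀ i : Fin n, f.toPerm ((i : ℤ) + 1) =
      ((v.symm (w i) : ℕ) : ℤ) + 1 + (if (w i : ℕ) < k then (n : ℤ) else 0)

/-! ### Deograms

Young diagrams are drawn in English notation, left-justified in the top-left corner of a
`k × (n - k)` rectangle: the box `(r, c)` is in row `r` from the top and column `c` from the left
(both starting from `0`). A filling of the boxes of `lam` with crossings and elbows is given by the
set `D` of its elbows; all other boxes of `lam` are crossings.

Grid edges: the vertical edge `(r, c)` is the left side of the box `(r, c)`, and the horizontal edge
`(r, c)` is the top side of the box `(r, c)`. The paths travel north and west. -/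

mutual

/-- The label of the path through the vertical edge `(r, c)`. If the box `(r, c)` lies in the
diagram, then the path leaves this box to the west; it has entered the box from the south if the box
is an elbow and from the east if the box is a crossing. Otherwise the edge belongs to the southeast
boundary, and the label is its position on the lattice path from the southwest corner to the
northeast corner of the rectangle (starting from `0`). -/
def vertLabel (k : ℕ) (lam : YoungDiagram) (D : Finset (ℕ × ℕ)) (r c : ℕ) : ℕ :=
  if _h : (r, c) ∈ lam then
    if (r, c) ∈ D then horLabel k lam D (r + 1) c else vertLabel k lam D r (c + 1)
  else k - 1 - r + c
termination_by (lam.rowLen r - c) + (lam.colLen c - r)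
decreasing_by
  · have h1 := YoungDiagram.mem_iff_lt_colLen.1 _h
    have h2 := lam.rowLen_anti r (r + 1) (Nat.le_succ r)
    omega
  · have h1 := YoungDiagram.mem_iff_lt_rowLen.1 _h
    have h2 := lam.colLen_anti c (c + 1) (Nat.le_succ c)
    omega

/-- The label of the path through the horizontal edge `(r, c)`. If the box `(r, c)` lies in the
diagram, then the path leaves this box to the north; it has entered the box from the east if the box
is an elbow and from the south if the box is a crossing. Otherwise the edge belongs to the southeast
boundary, and the label is its position there. -/
def horLabel (k : ℕ) (lam : YoungDiagram) (D : Finset (ℕ × ℕ)) (r c : ℕ) : ℕ :=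
  if _h : (r, c) ∈ lam then
    if (r, c) ∈ D then vertLabel k lam D r (c + 1) else horLabel k lam D (r + 1) c
  else k - r + c
termination_by (lam.rowLen r - c) + (lam.colLen c - r)
decreasing_by
  · have h1 := YoungDiagram.mem_iff_lt_rowLen.1 _h
    have h2 := lam.colLen_anti c (c + 1) (Nat.le_succ c)
    omega
  · have h1 := YoungDiagram.mem_iff_lt_colLen.1 _h
    have h2 := lam.rowLen_anti r (r + 1) (Nat.le_succ r)
    omega

end

/-- The label of the path leaving through the edge in position `p` of the northwest boundary of the
rectangle: positions `0, …, k - 1` are the rows from bottom to top, and positions `k, …, n - 1` are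
the columns from left to right. -/
def exitLabel (k : ℕ) (lam : YoungDiagram) (D : Finset (ℕ × ℕ)) (p : ℕ) : ℕ :=
  if p < k then vertLabel k lam D (k - 1 - p) 0 else horLabel k lam D 0 (p - k)

/-- `u` is the permutation `u_D` of the filling: for each `i`, the path labeled `i` leaves through
position `u i`. -/
def HasPathPerm {n : ℕ} (k : ℕ) (lam : YoungDiagram) (D : Finset (ℕ × ℕ))
    (u : Equiv.Perm (Fin n)) : Prop :=
  ∀ i : Fin n, exitLabel k lam D (u i) = i

/-- `lam` fits in a rectangle with `k` rows and `m` columns. -/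
def FitsIn (lam : YoungDiagram) (k m : ℕ) : Prop :=
  ∀ r c : ℕ, (r, c) ∈ lam → r < k ∧ c < m

/-- The filling of `lam` with set of elbows `D` is a Deogram: for each elbow, the label of the
bottom-left path (entering from the south) is less than the label of the top-right path (entering
from the east). -/
def IsDeogram (k : ℕ) (lam : YoungDiagram) (D : Finset (ℕ × ℕ)) : Prop :=
  D ⊆ lam.cells ∧
    ∀ r c : ℕ, (r, c) ∈ D → horLabel k lam D (r + 1) c < vertLabel k lam D r (c + 1)

/-- `f`-Deograms: Deograms `(lam, D)` whose shape is the Young diagram `λ_w` corresponding to `w`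
(the filling of `lam` by crossings only has permutation `w`) and whose permutation `u_D` is `v`,
where `f = f_{v,w}`. -/
def deograms {k n : ℕ} (f : BoundedAffinePerm k n) : Set (YoungDiagram × Finset (ℕ × ℕ)) :=
  {x | ∃ v w : Equiv.Perm (Fin n), IsPairOf f v w ∧ FitsIn x.1 k (n - k) ∧
    HasPathPerm k x.1 ∅ w ∧ IsDeogram k x.1 x.2 ∧ HasPathPerm k x.1 x.2 v}

/-- The number of crossings. -/
def crossings (x : YoungDiagram × Finset (ℕ × ℕ)) : ℕ := (x.1.cells \ x.2).card

/-- Maximal `f`-Deograms: those with the maximal number of crossings among all `f`-Deograms. -/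
def maximalDeograms {k n : ℕ} (f : BoundedAffinePerm k n) :
    Set (YoungDiagram × Finset (ℕ × ℕ)) :=
  {x | x ∈ deograms f ∧ ∀ y ∈ deograms f, crossings y ≤ crossings x}

/-! ### Rational Dyck paths -/

/-- Lattice paths from `(0, 0)` to `(b, a)` with unit steps up (`true`) and right (`false`) that stay
(weakly) above the diagonal of the rectangle of height `a` and width `b`. -/
def dyckPaths (a b : ℕ) : Set (List Bool) :=
  {l | l.count true = a ∧ l.count false = b ∧
    ∀ p : List Bool, p <+: l → a * p.count false ≤ b * p.count true}

end PositroidCatalan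

namespace PositroidCatalan

/-! ### Path labels -/

-- All three numbers are read off one polynomial. Let `q` be the size of the field, `M_f` the set
-- `matSet` of full rank matrices with `f_A = f`, and `s` the affine transposition of the positions
-- `p`, `p + 1`. Replacing two adjacent columns `B_p`, `B_{p+1}` by `B_{p+1} + c B_p`, `B_p`
-- produces the matrices of `M_f` from those of `M_{sfs}` and `M_{fs}`. If the outgoing strands at
-- `p`, `p + 1` do not cross, counting the admissible `c` gives `#M_f = q #M_{sfs} + (q - 1)
-- #M_{fs}` or `#M_f = #M_{sfs}`, depending on the order of the incoming strands
-- (`natCard_matSet_of_lt`, `natCard_matSet_of_gt`). Deograms weighted by `(q - 1)^{elbows}` times a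
-- power of `q` satisfy the same recursion when an outer corner is removed
-- (`deogramSum_one_corner`), so `#M_f` is `|GL_k|` times this weighted sum
-- (`natCard_matSet_pairPerm`). In the variable `X = q - 1` the sum is a polynomial `countPoly` with
-- nonnegative coefficients.
--
-- Let `c` be the number of cycles of `f` modulo `n`. Conjugation by `s` preserves `c` and
-- multiplication by `s` changes it by at most one, so `X^(n - c)` divides `countPoly`
-- (`X_pow_dvd_countPoly`). The coefficient of `X^(n - c)` is positive (`countPoly_coeff_pos`): the
-- shortest strand that is not fixed modulo `n` can be shortened until a cycle splits off. If `f` is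
-- a single cycle, then `n - c = n - 1`. Since nothing cancels, `n - 1` is the least number of
-- elbows, and the coefficient of `X^(n - 1)` counts the maximal Deograms. On the other side, `GL_k`
-- times the diagonal torus acts on `M_f` with stabilizers isomorphic to the multiplicative group,
-- so the orbits are counted by `countPoly / X^(n - 1)`, whose value at `q = 1` is the same
-- coefficient.
--
-- For the rotation `j ↦ j + k` this lowest coefficient is computed by a Catalan recursion. It does
-- not change under conjugation by `s` if `p`, `p + 1` lie in different cycles, and it is the sum of
-- those of `sfs` and `fs` if neither pair of strands crosses and multiplication by `s` splits a
-- cycle (`lowCoeff_conj_of_not_rel`, `lowCoeff_eq_add`). Integer functions `heights` over `f`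
-- satisfy the same recursion. A function concave along the cycles (`IsConcaveSystem`) guarantees at
-- each step that the strands are ordered as the recursion requires. For the rotation such a
-- function exists, and the height functions, read along `0, k, 2k, …`, are the Dyck paths.

/-- The box `(r, c)` is an outer corner of the diagram. -/
def IsCorner (lam : YoungDiagram) (r c : ℕ) : Prop :=
  (r, c) ∈ lam ∧ (r + 1, c) ∉ lam ∧ (r, c + 1) ∉ lam

theorem exists_isCorner {lam : YoungDiagram} (h : lam.cells.Nonempty) :
    ∃ r c, IsCorner lam r c := by
  obtain ⟨⟨r, c⟩, hx, hmax⟩ := Finset.exists_max_image lam.cells (fun x => x.1 + x.2) h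
  refine ⟨r, c, hx, fun h1 => ?_, fun h1 => ?_⟩
  · have := hmax (r + 1, c) h1
    simp only at this
    omega
  · have := hmax (r, c + 1) h1
    simp only at this
    omega

/-- The Young diagram obtained by removing an outer corner. -/
def eraseCorner {lam : YoungDiagram} {r c : ℕ} (h : IsCorner lam r c) : YoungDiagram where
  cells := lam.cells.erase (r, c)
  isLowerSet := by
    rintro ⟨a, b⟩ ⟨a', b'⟩ hle hx
    rw [Finset.mem_coe, Finset.mem_erase] at hx ⊢
    have hab : a' ≤ a ∧ b' ≤ b := hle
    refine ⟨fun heq => ?_, lam.isLowerSet hle hx.2⟩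
    rw [Prod.mk.injEq] at heq
    obtain ⟨rfl, rfl⟩ := heq
    have hx1 : (a, b) ∈ lam := hx.2
    rcases Nat.lt_or_ge a' a with h1 | h1
    · exact h.2.1 (lam.up_left_mem h1 hab.2 hx1)
    · rcases Nat.lt_or_ge b' b with h2 | h2
      · exact h.2.2 (lam.up_left_mem hab.1 h2 hx1)
      · exact hx.1 (by rw [Prod.mk.injEq]; omega)

theorem mem_eraseCorner {lam : YoungDiagram} {r c : ℕ} (h : IsCorner lam r c) {x : ℕ × ℕ} :
    x ∈ eraseCorner h ↔ x ≠ (r, c) ∧ x ∈ lam :=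
  Finset.mem_erase

theorem cells_eraseCorner {lam : YoungDiagram} {r c : ℕ} (h : IsCorner lam r c) :
    (eraseCorner h).cells = lam.cells.erase (r, c) := rfl

theorem vertLabel_of_notMem {k : ℕ} {lam : YoungDiagram} {D : Finset (ℕ × ℕ)} {r c : ℕ}
    (h : (r, c) ∉ lam) : vertLabel k lam D r c = k - 1 - r + c := by
  rw [vertLabel, dif_neg h]

theorem horLabel_of_notMem {k : ℕ} {lam : YoungDiagram} {D : Finset (ℕ × ℕ)} {r c : ℕ}
    (h : (r, c) ∉ lam) : horLabel k lam D r c = k - r + c := by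
  rw [horLabel, dif_neg h]

theorem vertLabel_elbow {k : ℕ} {lam : YoungDiagram} {D : Finset (ℕ × ℕ)} {r c : ℕ}
    (h : (r, c) ∈ lam) (hD : (r, c) ∈ D) :
    vertLabel k lam D r c = horLabel k lam D (r + 1) c := by
  rw [vertLabel, dif_pos h, if_pos hD]

theorem vertLabel_crossing {k : ℕ} {lam : YoungDiagram} {D : Finset (ℕ × ℕ)} {r c : ℕ}
    (h : (r, c) ∈ lam) (hD : (r, c) ∉ D) :
    vertLabel k lam D r c = vertLabel k lam D r (c + 1) := by
  rw [vertLabel, dif_pos h, if_neg hD]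

theorem horLabel_elbow {k : ℕ} {lam : YoungDiagram} {D : Finset (ℕ × ℕ)} {r c : ℕ}
    (h : (r, c) ∈ lam) (hD : (r, c) ∈ D) :
    horLabel k lam D r c = vertLabel k lam D r (c + 1) := by
  rw [horLabel, dif_pos h, if_pos hD]

theorem horLabel_crossing {k : ℕ} {lam : YoungDiagram} {D : Finset (ℕ × ℕ)} {r c : ℕ}
    (h : (r, c) ∈ lam) (hD : (r, c) ∉ D) :
    horLabel k lam D r c = horLabel k lam D (r + 1) c := by
  rw [horLabel, dif_pos h, if_neg hD]

/-- Induction along the edges of the grid, from the southeast boundary of the diagram. -/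
theorem edge_induction (lam : YoungDiagram) {P Q : ℕ → ℕ → Prop}
    (hP : ∀ r c, ((r, c) ∈ lam → Q (r + 1) c ∧ P r (c + 1)) → P r c)
    (hQ : ∀ r c, ((r, c) ∈ lam → Q (r + 1) c ∧ P r (c + 1)) → Q r c) (r c : ℕ) :
    P r c ∧ Q r c := by
  suffices H : ∀ N r c, (lam.rowLen r - c) + (lam.colLen c - r) ≤ N → P r c ∧ Q r c from
    H _ r c le_rfl
  intro N
  induction N with
  | zero =>
    intro r c hN
    have hnm : (r, c) ∉ lam := fun h => by
      have := YoungDiagram.mem_iff_lt_rowLen.1 h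
      omega
    exact ⟨hP r c fun h => (hnm h).elim, hQ r c fun h => (hnm h).elim⟩
  | succ N ih =>
    intro r c hN
    have key : (r, c) ∈ lam → Q (r + 1) c ∧ P r (c + 1) := fun h => by
      have h1 := YoungDiagram.mem_iff_lt_rowLen.1 h
      have h2 := YoungDiagram.mem_iff_lt_colLen.1 h
      have h3 := lam.rowLen_anti r (r + 1) (Nat.le_succ r)
      have h4 := lam.colLen_anti c (c + 1) (Nat.le_succ c)
      exact ⟨(ih (r + 1) c (by omega)).2, (ih r (c + 1) (by omega)).1⟩
    exact ⟨hP r c key, hQ r c key⟩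

section Corner

variable {k : ℕ} {lam : YoungDiagram} {r c : ℕ}

/-- Boundary edges away from the corner lie strictly northeast or southwest of it, so their labels
differ from the two labels meeting at the corner. -/
theorem vert_boundary_cases (h : IsCorner lam r c) {r' c' : ℕ}
    (hle : c' ≤ (eraseCorner h).rowLen r') (hn : (r', c') ∉ lam) :
    (r' < r ∧ c < c') ∨ (r < r' ∧ c' ≤ c) := by
  rcases lt_trichotomy r' r with h1 | rfl | h1
  · refine Or.inl ⟨h1, ?_⟩
    by_contra h2
    exact hn (lam.up_left_mem h1.le (not_lt.1 h2) h.1)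
  · rcases Nat.lt_or_ge c c' with h2 | h2
    · have := (mem_eraseCorner h).1 (YoungDiagram.mem_iff_lt_rowLen.2 (lt_of_lt_of_le h2 hle))
      exact (this.1 rfl).elim
    · exact (hn (lam.up_left_mem le_rfl h2 h.1)).elim
  · refine Or.inr ⟨h1, ?_⟩
    by_contra h2
    have := (mem_eraseCorner h).1
      (YoungDiagram.mem_iff_lt_rowLen.2 (lt_of_lt_of_le (not_le.1 h2) hle))
    exact h.2.1 (lam.up_left_mem h1 le_rfl this.2)

theorem hor_boundary_cases (h : IsCorner lam r c) {r' c' : ℕ}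
    (hle : r' ≤ (eraseCorner h).colLen c') (hn : (r', c') ∉ lam) :
    (c' < c ∧ r < r') ∨ (c < c' ∧ r' ≤ r) := by
  rcases lt_trichotomy c' c with h1 | rfl | h1
  · refine Or.inl ⟨h1, ?_⟩
    by_contra h2
    exact hn (lam.up_left_mem (not_lt.1 h2) h1.le h.1)
  · rcases Nat.lt_or_ge r r' with h2 | h2
    · have := (mem_eraseCorner h).1 (YoungDiagram.mem_iff_lt_colLen.2 (lt_of_lt_of_le h2 hle))
      exact (this.1 rfl).elim
    · exact (hn (lam.up_left_mem h2 le_rfl h.1)).elim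
  · refine Or.inr ⟨h1, ?_⟩
    by_contra h2
    have := (mem_eraseCorner h).1
      (YoungDiagram.mem_iff_lt_colLen.2 (lt_of_lt_of_le (not_le.1 h2) hle))
    exact h.2.2 (lam.up_left_mem le_rfl h1 this.2)

theorem colLen_le_of_rows (hk : ∀ x ∈ lam, x.1 < k) (c : ℕ) : lam.colLen c ≤ k := by
  by_contra h
  exact lt_irrefl k (hk (k, c) (YoungDiagram.mem_iff_lt_colLen.2 (not_le.1 h)))

/-- Removing a corner that is a crossing exchanges the two labels meeting there. -/
theorem labels_of_crossing_corner (hk : ∀ x ∈ lam, x.1 < k) (h : IsCorner lam r c)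
    {D : Finset (ℕ × ℕ)} (hD : (r, c) ∉ D) (r' c' : ℕ) :
    (r' < k → c' ≤ (eraseCorner h).rowLen r' → vertLabel k lam D r' c' =
      Equiv.swap (k - 1 - r + c) (k - 1 - r + c + 1) (vertLabel k (eraseCorner h) D r' c')) ∧
    (r' ≤ (eraseCorner h).colLen c' → horLabel k lam D r' c' =
      Equiv.swap (k - 1 - r + c) (k - 1 - r + c + 1) (horLabel k (eraseCorner h) D r' c')) := by
  have hrk : r < k := hk _ h.1
  refine edge_induction (eraseCorner h)
    (P := fun r' c' => r' < k → c' ≤ (eraseCorner h).rowLen r' → vertLabel k lam D r' c' =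
      Equiv.swap (k - 1 - r + c) (k - 1 - r + c + 1) (vertLabel k (eraseCorner h) D r' c'))
    (Q := fun r' c' => r' ≤ (eraseCorner h).colLen c' → horLabel k lam D r' c' =
      Equiv.swap (k - 1 - r + c) (k - 1 - r + c + 1) (horLabel k (eraseCorner h) D r' c'))
    (fun r' c' ih hr' hle => ?_) (fun r' c' ih hle => ?_) r' c'
  · by_cases hm : (r', c') ∈ eraseCorner h
    · have hm' := (mem_eraseCorner h).1 hm
      obtain ⟨ih1, ih2⟩ := ih hm
      by_cases hd : (r', c') ∈ D
      · rw [vertLabel_elbow hm'.2 hd, vertLabel_elbow hm hd]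
        exact ih1 (YoungDiagram.mem_iff_lt_colLen.1 hm)
      · rw [vertLabel_crossing hm'.2 hd, vertLabel_crossing hm hd]
        exact ih2 hr' (YoungDiagram.mem_iff_lt_rowLen.1 hm)
    · by_cases hc : (r', c') = (r, c)
      · rw [Prod.mk.injEq] at hc
        obtain ⟨rfl, rfl⟩ := hc
        -- At the corner itself the path leaving west entered from the east, with label `k - 1 - r +
        -- c + 1`; in the smaller diagram this edge is a boundary edge with label one less.
        rw [vertLabel_crossing h.1 hD, vertLabel_of_notMem h.2.2, vertLabel_of_notMem hm,
          Equiv.swap_apply_left]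
        ring
      · have hn : (r', c') ∉ lam := fun h' => hm ((mem_eraseCorner h).2 ⟨hc, h'⟩)
        rw [vertLabel_of_notMem hn, vertLabel_of_notMem hm]
        have := vert_boundary_cases h hle hn
        rw [Equiv.swap_apply_of_ne_of_ne] <;> omega
  · by_cases hm : (r', c') ∈ eraseCorner h
    · have hm' := (mem_eraseCorner h).1 hm
      obtain ⟨ih1, ih2⟩ := ih hm
      by_cases hd : (r', c') ∈ D
      · rw [horLabel_elbow hm'.2 hd, horLabel_elbow hm hd]
        exact ih2 (hk _ hm'.2) (YoungDiagram.mem_iff_lt_rowLen.1 hm)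
      · rw [horLabel_crossing hm'.2 hd, horLabel_crossing hm hd]
        exact ih1 (YoungDiagram.mem_iff_lt_colLen.1 hm)
    · have hrk' : r' ≤ k := hle.trans
        (colLen_le_of_rows (fun x hx => hk x ((mem_eraseCorner h).1 hx).2) c')
      by_cases hc : (r', c') = (r, c)
      · rw [Prod.mk.injEq] at hc
        obtain ⟨rfl, rfl⟩ := hc
        rw [horLabel_crossing h.1 hD, horLabel_of_notMem h.2.1, horLabel_of_notMem hm,
          show k - r' + c' = k - 1 - r' + c' + 1 by omega, Equiv.swap_apply_right]
        omega
      · have hn : (r', c') ∉ lam := fun h' => hm ((mem_eraseCorner h).2 ⟨hc, h'⟩)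
        rw [horLabel_of_notMem hn, horLabel_of_notMem hm]
        have := hor_boundary_cases h hle hn
        rw [Equiv.swap_apply_of_ne_of_ne] <;> omega

/-- Removing a corner that is an elbow does not change the labels. -/
theorem labels_of_elbow_corner (hk : ∀ x ∈ lam, x.1 < k) (h : IsCorner lam r c)
    {D : Finset (ℕ × ℕ)} (r' c' : ℕ) :
    (r' < k → c' ≤ (eraseCorner h).rowLen r' → vertLabel k lam (insert (r, c) D) r' c' =
      vertLabel k (eraseCorner h) D r' c') ∧
    (r' ≤ (eraseCorner h).colLen c' → horLabel k lam (insert (r, c) D) r' c' =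
      horLabel k (eraseCorner h) D r' c') := by
  have hrk : r < k := hk _ h.1
  have hins : ∀ x ∈ eraseCorner h, (x ∈ insert (r, c) D ↔ x ∈ D) := fun x hx => by
    rw [Finset.mem_insert, or_iff_right ((mem_eraseCorner h).1 hx).1]
  refine edge_induction (eraseCorner h)
    (P := fun r' c' => r' < k → c' ≤ (eraseCorner h).rowLen r' → vertLabel k lam (insert (r, c) D) r' c' =
      vertLabel k (eraseCorner h) D r' c')
    (Q := fun r' c' => r' ≤ (eraseCorner h).colLen c' → horLabel k lam (insert (r, c) D) r' c' =
      horLabel k (eraseCorner h) D r' c')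
    (fun r' c' ih hr' hle => ?_) (fun r' c' ih hle => ?_) r' c'
  · by_cases hm : (r', c') ∈ eraseCorner h
    · have hm' := (mem_eraseCorner h).1 hm
      obtain ⟨ih1, ih2⟩ := ih hm
      by_cases hd : (r', c') ∈ D
      · rw [vertLabel_elbow hm'.2 ((hins _ hm).2 hd), vertLabel_elbow hm hd]
        exact ih1 (YoungDiagram.mem_iff_lt_colLen.1 hm)
      · rw [vertLabel_crossing hm'.2 (mt (hins _ hm).1 hd), vertLabel_crossing hm hd]
        exact ih2 hr' (YoungDiagram.mem_iff_lt_rowLen.1 hm)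
    · by_cases hc : (r', c') = (r, c)
      · rw [Prod.mk.injEq] at hc
        obtain ⟨rfl, rfl⟩ := hc
        rw [vertLabel_elbow h.1 (Finset.mem_insert_self _ _), horLabel_of_notMem h.2.1,
          vertLabel_of_notMem hm]
        omega
      · have hn : (r', c') ∉ lam := fun h' => hm ((mem_eraseCorner h).2 ⟨hc, h'⟩)
        rw [vertLabel_of_notMem hn, vertLabel_of_notMem hm]
  · by_cases hm : (r', c') ∈ eraseCorner h
    · have hm' := (mem_eraseCorner h).1 hm
      obtain ⟨ih1, ih2⟩ := ih hm
      by_cases hd : (r', c') ∈ D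
      · rw [horLabel_elbow hm'.2 ((hins _ hm).2 hd), horLabel_elbow hm hd]
        exact ih2 (hk _ hm'.2) (YoungDiagram.mem_iff_lt_rowLen.1 hm)
      · rw [horLabel_crossing hm'.2 (mt (hins _ hm).1 hd), horLabel_crossing hm hd]
        exact ih1 (YoungDiagram.mem_iff_lt_colLen.1 hm)
    · by_cases hc : (r', c') = (r, c)
      · rw [Prod.mk.injEq] at hc
        obtain ⟨rfl, rfl⟩ := hc
        rw [horLabel_elbow h.1 (Finset.mem_insert_self _ _), vertLabel_of_notMem h.2.2,
          horLabel_of_notMem hm]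
        omega
      · have hn : (r', c') ∉ lam := fun h' => hm ((mem_eraseCorner h).2 ⟨hc, h'⟩)
        rw [horLabel_of_notMem hn, horLabel_of_notMem hm]

theorem exitLabel_of_crossing_corner (hk : ∀ x ∈ lam, x.1 < k) (h : IsCorner lam r c)
    {D : Finset (ℕ × ℕ)} (hD : (r, c) ∉ D) (p : ℕ) :
    exitLabel k lam D p =
      Equiv.swap (k - 1 - r + c) (k - 1 - r + c + 1) (exitLabel k (eraseCorner h) D p) := by
  unfold exitLabel
  split_ifs with hp
  · exact (labels_of_crossing_corner hk h hD _ _).1 (by omega) (Nat.zero_le _)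
  · exact (labels_of_crossing_corner hk h hD _ _).2 (Nat.zero_le _)

theorem exitLabel_of_elbow_corner (hk : ∀ x ∈ lam, x.1 < k) (h : IsCorner lam r c)
    {D : Finset (ℕ × ℕ)} (p : ℕ) :
    exitLabel k lam (insert (r, c) D) p = exitLabel k (eraseCorner h) D p := by
  unfold exitLabel
  split_ifs with hp
  · exact (labels_of_elbow_corner hk h _ _).1 (by omega) (Nat.zero_le _)
  · exact (labels_of_elbow_corner hk h _ _).2 (Nat.zero_le _)

end Corner

theorem exitLabel_bot {k : ℕ} {D : Finset (ℕ × ℕ)} (p : ℕ) :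
    exitLabel k ⊥ D p = p := by
  unfold exitLabel
  split_ifs with hp
  · rw [vertLabel_of_notMem (YoungDiagram.notMem_bot _)]
    omega
  · rw [horLabel_of_notMem (YoungDiagram.notMem_bot _)]
    omega

/-- Beyond the rectangle the defining recursion stops at once, so exits agree with a permutation of
all of `ℕ` that fixes large numbers. -/
theorem exitLabel_of_le {k m : ℕ} {lam : YoungDiagram} {D : Finset (ℕ × ℕ)}
    (hlam : FitsIn lam k m) {p : ℕ} (hp : k + m ≤ p) : exitLabel k lam D p = p := by
  unfold exitLabel
  rw [if_neg (by omega), horLabel_of_notMem (fun h => by have := (hlam _ _ h).2; omega)]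
  omega

end PositroidCatalan

namespace PositroidCatalan

/-! ### Generating functions of Deograms with permuted labels -/

section GeneratingFunction

variable {R : Type*} [CommRing R]

/-- The number of crossings at which, after relabeling by `sig`, the path entering from the east has
a smaller label than the path entering from the south. -/
def descentCrossings (k : ℕ) (lam : YoungDiagram) (sig : Equiv.Perm ℕ) (D : Finset (ℕ × ℕ)) : ℕ :=
  ((lam.cells \ D).filter fun x =>
    sig (vertLabel k lam D x.1 (x.2 + 1)) < sig (horLabel k lam D (x.1 + 1) x.2)).card

/-- The Deogram condition, after relabeling the paths by `sig`, together with the condition that the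
relabeled paths leave in the order `tau`. -/
def IsRelabeledDeogram (k : ℕ) (lam : YoungDiagram) (sig tau : Equiv.Perm ℕ)
    (D : Finset (ℕ × ℕ)) : Prop :=
  (∀ x ∈ D, sig (horLabel k lam D (x.1 + 1) x.2) < sig (vertLabel k lam D x.1 (x.2 + 1))) ∧
    ∀ p, sig (exitLabel k lam D p) = tau p

open Classical in
/-- The weight of a filling: `(q - 1)^{elbows} q^{descending crossings}` if it is a Deogram with the
prescribed exits, and `0` otherwise. -/
noncomputable def deogramTerm (q : R) (k : ℕ) (lam : YoungDiagram) (sig tau : Equiv.Perm ℕ)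
    (D : Finset (ℕ × ℕ)) : R :=
  if IsRelabeledDeogram k lam sig tau D then
    (q - 1) ^ D.card * q ^ descentCrossings k lam sig D else 0

/-- The generating function of relabeled Deograms of a given shape. -/
noncomputable def deogramSum (q : R) (k : ℕ) (lam : YoungDiagram) (sig tau : Equiv.Perm ℕ) : R :=
  ∑ D ∈ lam.cells.powerset, deogramTerm q k lam sig tau D

variable {k : ℕ} {lam : YoungDiagram} {r c : ℕ}

/-- A crossing in the corner exchanges two entrance labels, which is absorbed into `sig`; it costs a
factor `q` exactly when it is a descent. -/
theorem deogramTerm_crossing_corner (q : R) (hk : ∀ x ∈ lam, x.1 < k) (h : IsCorner lam r c)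
    (sig tau : Equiv.Perm ℕ) {D : Finset (ℕ × ℕ)} (hD : D ⊆ (eraseCorner h).cells) :
    deogramTerm q k lam sig tau D =
      (if sig (k - 1 - r + c) < sig (k - 1 - r + c + 1) then 1 else q) *
        deogramTerm q k (eraseCorner h)
          (sig * Equiv.swap (k - 1 - r + c) (k - 1 - r + c + 1)) tau D := by
  have hrk : r < k := hk _ h.1
  have hcD : (r, c) ∉ D := fun hx => ((mem_eraseCorner h).1 (hD hx)).1 rfl
  have hv : ∀ x ∈ eraseCorner h, sig (vertLabel k lam D x.1 (x.2 + 1)) =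
      (sig * Equiv.swap (k - 1 - r + c) (k - 1 - r + c + 1))
        (vertLabel k (eraseCorner h) D x.1 (x.2 + 1)) := fun x hx => by
    rw [(labels_of_crossing_corner hk h hcD _ _).1 (hk _ ((mem_eraseCorner h).1 hx).2)
      (YoungDiagram.mem_iff_lt_rowLen.1 hx), Equiv.Perm.mul_apply]
  have hh : ∀ x ∈ eraseCorner h, sig (horLabel k lam D (x.1 + 1) x.2) =
      (sig * Equiv.swap (k - 1 - r + c) (k - 1 - r + c + 1))
        (horLabel k (eraseCorner h) D (x.1 + 1) x.2) := fun x hx => by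
    rw [(labels_of_crossing_corner hk h hcD _ _).2
      (YoungDiagram.mem_iff_lt_colLen.1 hx), Equiv.Perm.mul_apply]
  have hiff : IsRelabeledDeogram k lam sig tau D ↔ IsRelabeledDeogram k (eraseCorner h)
      (sig * Equiv.swap (k - 1 - r + c) (k - 1 - r + c + 1)) tau D := by
    refine and_congr (forall₂_congr fun x hx => ?_) (forall_congr' fun p => ?_)
    · rw [hv x (hD hx), hh x (hD hx)]
    · rw [exitLabel_of_crossing_corner hk h hcD, Equiv.Perm.mul_apply]
  have hcells : lam.cells \ D = insert (r, c) ((eraseCorner h).cells \ D) := by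
    rw [cells_eraseCorner, ← Finset.insert_sdiff_of_notMem _ hcD, Finset.insert_erase h.1]
  have hcr : descentCrossings k lam sig D =
      (if sig (k - 1 - r + c) < sig (k - 1 - r + c + 1) then 0 else 1) +
      descentCrossings k (eraseCorner h)
        (sig * Equiv.swap (k - 1 - r + c) (k - 1 - r + c + 1)) D := by
    unfold descentCrossings
    rw [hcells, Finset.filter_insert]
    have hfil : ((eraseCorner h).cells \ D).filter (fun x =>
        sig (vertLabel k lam D x.1 (x.2 + 1)) < sig (horLabel k lam D (x.1 + 1) x.2)) =
        ((eraseCorner h).cells \ D).filter (fun x =>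
        (sig * Equiv.swap (k - 1 - r + c) (k - 1 - r + c + 1))
          (vertLabel k (eraseCorner h) D x.1 (x.2 + 1)) <
        (sig * Equiv.swap (k - 1 - r + c) (k - 1 - r + c + 1))
          (horLabel k (eraseCorner h) D (x.1 + 1) x.2)) :=
      Finset.filter_congr fun x hx => by
        rw [hv x (Finset.mem_sdiff.1 hx).1, hh x (Finset.mem_sdiff.1 hx).1]
    rw [hfil, vertLabel_of_notMem h.2.2, horLabel_of_notMem h.2.1,
      show k - 1 - r + (c + 1) = k - 1 - r + c + 1 by ring,
      show k - (r + 1) + c = k - 1 - r + c by omega]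
    have hne : sig (k - 1 - r + c) ≠ sig (k - 1 - r + c + 1) := fun h' => by
      have := sig.injective h'
      omega
    by_cases hlt : sig (k - 1 - r + c) < sig (k - 1 - r + c + 1)
    · rw [if_neg (not_lt.2 hlt.le), if_pos hlt, zero_add]
    · rw [if_pos (lt_of_le_of_ne (not_lt.1 hlt) hne.symm), if_neg hlt,
        Finset.card_insert_of_notMem, add_comm]
      intro hx
      exact ((mem_eraseCorner h).1
        (Finset.mem_sdiff.1 (Finset.mem_filter.1 hx).1).1).1 rfl
  unfold deogramTerm
  rw [hcr]
  by_cases hE : IsRelabeledDeogram k lam sig tau D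
  · rw [if_pos hE, if_pos (hiff.1 hE)]
    split_ifs
    · rw [zero_add, one_mul]
    · ring
  · rw [if_neg hE, if_neg (mt hiff.2 hE), mul_zero]

/-- An elbow in the corner leaves all labels alone; its own Deogram condition compares `sig` on the
two labels there, and it contributes one factor `q - 1`. -/
theorem deogramTerm_elbow_corner (q : R) (hk : ∀ x ∈ lam, x.1 < k) (h : IsCorner lam r c)
    (sig tau : Equiv.Perm ℕ) {D : Finset (ℕ × ℕ)} (hD : D ⊆ (eraseCorner h).cells) :
    deogramTerm q k lam sig tau (insert (r, c) D) =
      (if sig (k - 1 - r + c) < sig (k - 1 - r + c + 1) then q - 1 else 0) *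
        deogramTerm q k (eraseCorner h) sig tau D := by
  have hrk : r < k := hk _ h.1
  have hcD : (r, c) ∉ D := fun hx => ((mem_eraseCorner h).1 (hD hx)).1 rfl
  have hv : ∀ x ∈ eraseCorner h, vertLabel k lam (insert (r, c) D) x.1 (x.2 + 1) =
      vertLabel k (eraseCorner h) D x.1 (x.2 + 1) := fun x hx =>
    (labels_of_elbow_corner hk h _ _).1 (hk _ ((mem_eraseCorner h).1 hx).2)
      (YoungDiagram.mem_iff_lt_rowLen.1 hx)
  have hh : ∀ x ∈ eraseCorner h, horLabel k lam (insert (r, c) D) (x.1 + 1) x.2 =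
      horLabel k (eraseCorner h) D (x.1 + 1) x.2 := fun x hx =>
    (labels_of_elbow_corner hk h _ _).2 (YoungDiagram.mem_iff_lt_colLen.1 hx)
  have hiff : IsRelabeledDeogram k lam sig tau (insert (r, c) D) ↔
      sig (k - 1 - r + c) < sig (k - 1 - r + c + 1) ∧
        IsRelabeledDeogram k (eraseCorner h) sig tau D := by
    unfold IsRelabeledDeogram
    rw [Finset.forall_mem_insert, vertLabel_of_notMem h.2.2, horLabel_of_notMem h.2.1,
      show k - 1 - r + (c + 1) = k - 1 - r + c + 1 by ring,
      show k - (r + 1) + c = k - 1 - r + c by omega, and_assoc]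
    refine and_congr Iff.rfl (and_congr (forall₂_congr fun x hx => ?_) (forall_congr' fun p => ?_))
    · rw [hv x (hD hx), hh x (hD hx)]
    · rw [exitLabel_of_elbow_corner hk h]
  have hcells : lam.cells \ insert (r, c) D = (eraseCorner h).cells \ D := by
    ext x
    simp only [Finset.mem_sdiff, Finset.mem_insert, cells_eraseCorner, Finset.mem_erase]
    tauto
  have hcr : descentCrossings k lam sig (insert (r, c) D) =
      descentCrossings k (eraseCorner h) sig D := by
    unfold descentCrossings
    rw [hcells]
    exact congrArg Finset.card (Finset.filter_congr fun x hx => by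
        rw [hv x (Finset.mem_sdiff.1 hx).1, hh x (Finset.mem_sdiff.1 hx).1])
  unfold deogramTerm
  rw [hcr, Finset.card_insert_of_notMem hcD]
  by_cases hE : IsRelabeledDeogram k (eraseCorner h) sig tau D
  · by_cases hlt : sig (k - 1 - r + c) < sig (k - 1 - r + c + 1)
    · rw [if_pos (hiff.2 ⟨hlt, hE⟩), if_pos hlt, if_pos hE]
      ring
    · rw [if_neg fun h' => hlt (hiff.1 h').1, if_neg hlt, zero_mul]
  · rw [if_neg fun h' => hE (hiff.1 h').2, if_neg hE, mul_zero]

/-- The action of a generator of the Hecke algebra on functions on permutations, from the right. -/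
def rightOp (q : R) (i : ℕ) (phi : Equiv.Perm ℕ → R) (sig : Equiv.Perm ℕ) : R :=
  if sig i < sig (i + 1) then phi (sig * Equiv.swap i (i + 1)) + (q - 1) * phi sig
  else q * phi (sig * Equiv.swap i (i + 1))

/-- The action of a generator of the Hecke algebra on functions on permutations, from the left. -/
def leftOp (q : R) (i : ℕ) (phi : Equiv.Perm ℕ → R) (sig : Equiv.Perm ℕ) : R :=
  if sig.symm i < sig.symm (i + 1) then phi (Equiv.swap i (i + 1) * sig) + (q - 1) * phi sig
  else q * phi (Equiv.swap i (i + 1) * sig)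

/-- The transpose of `leftOp`. -/
def leftOpDual (q : R) (i : ℕ) (phi : Equiv.Perm ℕ → R) (tau : Equiv.Perm ℕ) : R :=
  if tau.symm i < tau.symm (i + 1) then q * phi (Equiv.swap i (i + 1) * tau) + (q - 1) * phi tau
  else phi (Equiv.swap i (i + 1) * tau)

/-- Splitting the fillings by the content of the corner box turns its removal into one Hecke
generator acting on the entrance labels. -/
theorem deogramSum_corner (q : R) (hk : ∀ x ∈ lam, x.1 < k) (h : IsCorner lam r c)
    (sig tau : Equiv.Perm ℕ) :
    deogramSum q k lam sig tau =
      rightOp q (k - 1 - r + c) (fun s => deogramSum q k (eraseCorner h) s tau) sig := by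
  have hins : lam.cells = insert (r, c) (eraseCorner h).cells := by
    rw [cells_eraseCorner, Finset.insert_erase h.1]
  have hnot : (r, c) ∉ (eraseCorner h).cells := fun hx => ((mem_eraseCorner h).1 hx).1 rfl
  have h1 : deogramSum q k lam sig tau =
      ∑ D ∈ (eraseCorner h).cells.powerset, deogramTerm q k lam sig tau D +
      ∑ D ∈ (eraseCorner h).cells.powerset, deogramTerm q k lam sig tau (insert (r, c) D) := by
    rw [deogramSum, hins, Finset.sum_powerset_insert hnot]
  rw [h1, Finset.sum_congr rfl fun D hD =>
      deogramTerm_crossing_corner q hk h sig tau (Finset.mem_powerset.1 hD),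
    Finset.sum_congr rfl fun D hD =>
      deogramTerm_elbow_corner q hk h sig tau (Finset.mem_powerset.1 hD),
    ← Finset.mul_sum, ← Finset.mul_sum]
  unfold rightOp
  split_ifs
  · simp only [deogramSum, one_mul]
  · simp only [deogramSum, zero_mul, add_zero]

open Classical in
theorem deogramSum_bot (q : R) (k : ℕ) (sig tau : Equiv.Perm ℕ) :
    deogramSum q k ⊥ sig tau = if sig = tau then 1 else 0 := by
  have hiff : IsRelabeledDeogram k ⊥ sig tau ∅ ↔ sig = tau := by
    simp only [IsRelabeledDeogram, Finset.notMem_empty, false_imp_iff, implies_true, true_and,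
      exitLabel_bot]
    exact ⟨fun h => Equiv.ext h, fun h p => by rw [h]⟩
  simp [deogramSum, deogramTerm, descentCrossings, hiff]

theorem swap_succ_lt_iff {i x y : ℕ} (h1 : ¬(x = i ∧ y = i + 1)) (h2 : ¬(x = i + 1 ∧ y = i)) :
    Equiv.swap i (i + 1) x < Equiv.swap i (i + 1) y ↔ x < y := by
  simp only [Equiv.swap_apply_def]
  split_ifs <;> omega

/-- Left and right multiplication commute, and one swap affects the comparison made by the other
only if `sig` carries `{j, j + 1}` onto `{i, i + 1}`; there the two products coincide and the
identity is checked directly. -/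
theorem leftOp_rightOp_comm (q : R) (i j : ℕ) (phi : Equiv.Perm ℕ → R) (sig : Equiv.Perm ℕ) :
    leftOp q i (rightOp q j phi) sig = rightOp q j (leftOp q i phi) sig := by
  have hs : ∀ x, (sig * Equiv.swap j (j + 1)).symm x = Equiv.swap j (j + 1) (sig.symm x) :=
    fun x => by rw [Equiv.symm_apply_eq]; simp
  by_cases hA : sig j = i ∧ sig (j + 1) = i + 1
  · obtain ⟨h1, h2⟩ := hA
    have h1' : sig.symm i = j := by rw [Equiv.symm_apply_eq, h1]
    have h2' : sig.symm (i + 1) = j + 1 := by rw [Equiv.symm_apply_eq, h2]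
    have hcomm : Equiv.swap i (i + 1) * sig = sig * Equiv.swap j (j + 1) := by
      rw [Equiv.mul_swap_eq_swap_mul, h1, h2]
    have hcomm2 : Equiv.swap i (i + 1) * (sig * Equiv.swap j (j + 1)) = sig := by
      rw [← hcomm, ← mul_assoc, Equiv.swap_mul_self, one_mul]
    have hn : ∀ m : ℕ, ¬ m + 1 < m := fun m => by omega
    simp only [leftOp, rightOp, hcomm, hcomm2, hn, hs, h1', h2', Equiv.Perm.mul_apply, h1, h2,
      Equiv.swap_apply_left, Equiv.swap_apply_right, mul_assoc, Equiv.swap_mul_self,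
      mul_one, lt_add_iff_pos_right, zero_lt_one, if_true, if_false]
  · by_cases hB : sig j = i + 1 ∧ sig (j + 1) = i
    · obtain ⟨h1, h2⟩ := hB
      have h1' : sig.symm (i + 1) = j := by rw [Equiv.symm_apply_eq, h1]
      have h2' : sig.symm i = j + 1 := by rw [Equiv.symm_apply_eq, h2]
      have hcomm : Equiv.swap i (i + 1) * sig = sig * Equiv.swap j (j + 1) := by
          rw [Equiv.mul_swap_eq_swap_mul, h1, h2, Equiv.swap_comm]
      have hcomm2 : Equiv.swap i (i + 1) * (sig * Equiv.swap j (j + 1)) = sig := by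
        rw [← hcomm, ← mul_assoc, Equiv.swap_mul_self, one_mul]
      have hn : ∀ m : ℕ, ¬ m + 1 < m := fun m => by omega
      simp only [leftOp, rightOp, hcomm, hcomm2, hn, hs, h1', h2', Equiv.Perm.mul_apply, h1, h2,
        Equiv.swap_apply_left, Equiv.swap_apply_right, mul_assoc, Equiv.swap_mul_self,
        mul_one, lt_add_iff_pos_right, zero_lt_one, if_true, if_false]
    · have e1 : (Equiv.swap i (i + 1) (sig j) < Equiv.swap i (i + 1) (sig (j + 1))) ↔
          sig j < sig (j + 1) := swap_succ_lt_iff hA hB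
      have e2 : (Equiv.swap j (j + 1) (sig.symm i) < Equiv.swap j (j + 1) (sig.symm (i + 1))) ↔
          sig.symm i < sig.symm (i + 1) := by
        refine swap_succ_lt_iff (fun h => hA ?_) (fun h => hB ?_)
        · exact ⟨by rw [← h.1]; simp, by rw [← h.2]; simp⟩
        · exact ⟨by rw [← h.2]; simp, by rw [← h.1]; simp⟩
      simp only [leftOp, rightOp, hs, Equiv.Perm.mul_apply, e1, e2, mul_assoc]
      split_ifs <;> ring

/-- Moves a Hecke generator from the entrance side to the exit side. It is the transpose relation
for the delta function when the diagram is empty, and corners add right operators, which commute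
with left ones. -/
theorem leftOp_deogramSum (q : R) (i : ℕ) {lam : YoungDiagram} (hk : ∀ x ∈ lam, x.1 < k)
    (sig tau : Equiv.Perm ℕ) :
    leftOp q i (fun s => deogramSum q k lam s tau) sig =
      leftOpDual q i (fun t => deogramSum q k lam sig t) tau := by
  induction hN : lam.cells.card generalizing lam sig with
  | zero =>
    have hlam : lam = ⊥ := YoungDiagram.ext (Finset.card_eq_zero.1 hN)
    subst hlam
    have e1 : Equiv.swap i (i + 1) * sig = tau ↔ sig = Equiv.swap i (i + 1) * tau := by
      constructor
      · rintro rfl; rw [← mul_assoc, Equiv.swap_mul_self, one_mul]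
      · rintro rfl; rw [← mul_assoc, Equiv.swap_mul_self, one_mul]
    have hs : ∀ x, (Equiv.swap i (i + 1) * tau).symm x = tau.symm (Equiv.swap i (i + 1) x) :=
      fun x => by rw [Equiv.symm_apply_eq]; simp
    have hne : tau.symm i ≠ tau.symm (i + 1) := fun h => by
      have := tau.symm.injective h; omega
    have hne2 : tau ≠ Equiv.swap i (i + 1) * tau := fun h => by
      have h3 := congrArg (fun f : Equiv.Perm ℕ => f (tau.symm i)) h
      simp at h3
    unfold leftOp leftOpDual
    simp only [deogramSum_bot]
    by_cases h1 : sig = tau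
    · subst h1
      have h3 : ¬ Equiv.swap i (i + 1) * sig = sig := fun h => hne2 h.symm
      rw [if_neg h3, if_pos rfl, if_neg hne2]
      split_ifs <;> ring
    · by_cases h2 : sig = Equiv.swap i (i + 1) * tau
      · rw [if_pos (e1.2 h2), if_neg h1, if_pos h2, h2, hs, hs, Equiv.swap_apply_left,
          Equiv.swap_apply_right]
        rcases lt_or_gt_of_ne hne with h3 | h3
        · rw [if_neg h3.not_gt, if_pos h3]
          ring
        · rw [if_pos h3, if_neg h3.not_gt]
          ring
      · rw [if_neg (mt e1.1 h2), if_neg h1, if_neg h2]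
        split_ifs <;> ring
  | succ N ih =>
    obtain ⟨r, c, h⟩ := exists_isCorner (lam := lam) (Finset.card_pos.1 (by omega))
    have hcard : (eraseCorner h).cells.card = N := by
      rw [cells_eraseCorner, Finset.card_erase_of_mem h.1]
      omega
    have hk' : ∀ x ∈ eraseCorner h, x.1 < k := fun x hx => hk x ((mem_eraseCorner h).1 hx).2
    have hfun : (fun s => deogramSum q k lam s tau) =
        rightOp q (k - 1 - r + c) (fun s => deogramSum q k (eraseCorner h) s tau) :=
      funext fun s => deogramSum_corner q hk h s tau
    rw [hfun, leftOp_rightOp_comm]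
    have hfun2 : leftOp q i (fun s => deogramSum q k (eraseCorner h) s tau) =
        fun s => leftOpDual q i (fun t => deogramSum q k (eraseCorner h) s t) tau :=
      funext fun s => ih hk' s hcard
    rw [hfun2]
    simp only [deogramSum_corner q hk h]
    unfold rightOp leftOpDual
    split_ifs <;> ring

/-- Recursion for the generating function of Deograms: removal of an outer corner. -/
theorem deogramSum_one_corner (q : R) (hk : ∀ x ∈ lam, x.1 < k) (h : IsCorner lam r c)
    (tau : Equiv.Perm ℕ) :
    deogramSum q k lam 1 tau =
      leftOpDual q (k - 1 - r + c) (fun t => deogramSum q k (eraseCorner h) 1 t) tau := by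
  -- At `sig = 1` left and right multiplication by a transposition agree, so the corner operator may
  -- be taken on the left and then moved to `tau`.
  rw [← leftOp_deogramSum q _ fun x hx => hk x ((mem_eraseCorner h).1 hx).2,
    deogramSum_corner q hk h]
  have h1 : ∀ x : ℕ, (1 : Equiv.Perm ℕ).symm x = x := fun x => rfl
  simp [rightOp, leftOp, h1]

end GeneratingFunction

end PositroidCatalan

namespace PositroidCatalan

/-! ### Affine permutations -/

/-- The group of bijections `f : ℤ → ℤ` with `f (j + n) = f j + n`. -/
def affinePerms (n : ℕ) : Subgroup (Equiv.Perm ℤ) where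
  carrier := {f | ∀ j : ℤ, f (j + n) = f j + n}
  mul_mem' := fun {f g} hf hg j => by
    rw [Equiv.Perm.mul_apply, Equiv.Perm.mul_apply, hg, hf]
  one_mem' := fun j => rfl
  inv_mem' := fun {f} hf j => by
    rw [Equiv.Perm.inv_eq_iff_eq, hf]
    simp

theorem two_le_not_dvd_one {n : ℕ} (hn : 2 ≤ n) : ¬ (n : ℤ) ∣ 1 := fun h => by
  have := Int.le_of_dvd one_pos h
  omega

theorem not_dvd_of_lt {n : ℕ} {x : ℤ} (h1 : 0 < x) (h2 : x < n) : ¬ (n : ℤ) ∣ x := fun h => by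
  have := Int.le_of_dvd h1 h
  omega

/-- The function exchanging `j` and `j + 1` for all `j` congruent to `p` modulo `n`. -/
def affineSwapFun (n : ℕ) (p j : ℤ) : ℤ :=
  if (n : ℤ) ∣ j - p then j + 1 else if (n : ℤ) ∣ j - (p + 1) then j - 1 else j

theorem affineSwapFun_of_dvd {n : ℕ} {p j : ℤ} (h : (n : ℤ) ∣ j - p) :
    affineSwapFun n p j = j + 1 := if_pos h

theorem affineSwapFun_of_dvd_succ {n : ℕ} (hn : 2 ≤ n) {p j : ℤ} (h : (n : ℤ) ∣ j - (p + 1)) :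
    affineSwapFun n p j = j - 1 := by
  have h' : ¬ (n : ℤ) ∣ j - p := fun h' => two_le_not_dvd_one hn (by
    have := dvd_sub h' h
    rwa [show j - p - (j - (p + 1)) = 1 by ring] at this)
  rw [affineSwapFun, if_neg h', if_pos h]

theorem affineSwapFun_of_not {n : ℕ} {p j : ℤ} (h : ¬ (n : ℤ) ∣ j - p)
    (h' : ¬ (n : ℤ) ∣ j - (p + 1)) : affineSwapFun n p j = j := by
  rw [affineSwapFun, if_neg h, if_neg h']

theorem affineSwapFun_involutive {n : ℕ} (hn : 2 ≤ n) (p : ℤ) :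
    Function.Involutive (affineSwapFun n p) := by
  intro j
  by_cases h : (n : ℤ) ∣ j - p
  · rw [affineSwapFun_of_dvd h, affineSwapFun_of_dvd_succ hn (by rwa [add_sub_add_right_eq_sub])]
    ring
  · by_cases h' : (n : ℤ) ∣ j - (p + 1)
    · rw [affineSwapFun_of_dvd_succ hn h', affineSwapFun_of_dvd (by
        rwa [show j - 1 - p = j - (p + 1) by ring])]
      ring
    · rw [affineSwapFun_of_not h h', affineSwapFun_of_not h h']

/-- The affine simple transposition exchanging `j` and `j + 1` for `j ≡ p` modulo `n`. -/
def affineSwap {n : ℕ} (hn : 2 ≤ n) (p : ℤ) : Equiv.Perm ℤ :=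
  (affineSwapFun_involutive hn p).toPerm

theorem affineSwap_apply {n : ℕ} (hn : 2 ≤ n) (p j : ℤ) :
    affineSwap hn p j = affineSwapFun n p j := rfl

theorem affineSwap_self {n : ℕ} (hn : 2 ≤ n) (p : ℤ) : affineSwap hn p p = p + 1 :=
  affineSwapFun_of_dvd (by simp)

theorem affineSwap_succ {n : ℕ} (hn : 2 ≤ n) (p : ℤ) : affineSwap hn p (p + 1) = p := by
  rw [affineSwap_apply, affineSwapFun_of_dvd_succ hn (by simp)]
  ring

theorem affineSwap_affineSwap {n : ℕ} (hn : 2 ≤ n) (p j : ℤ) :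
    affineSwap hn p (affineSwap hn p j) = j := affineSwapFun_involutive hn p j

theorem affineSwap_mul_self {n : ℕ} (hn : 2 ≤ n) (p : ℤ) :
    affineSwap hn p * affineSwap hn p = 1 := Equiv.ext (affineSwap_affineSwap hn p)

theorem affineSwap_inv {n : ℕ} (hn : 2 ≤ n) (p : ℤ) : (affineSwap hn p)⁻¹ = affineSwap hn p :=
  inv_eq_of_mul_eq_one_left (affineSwap_mul_self hn p)

theorem affineSwap_mem {n : ℕ} (hn : 2 ≤ n) (p : ℤ) : affineSwap hn p ∈ affinePerms n := by
  intro j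
  have e : ∀ y : ℤ, ((n : ℤ) ∣ j + n - y ↔ (n : ℤ) ∣ j - y) := fun y => by
    rw [show j + n - y = j - y + n by ring, dvd_add_self_right]
  rw [affineSwap_apply, affineSwap_apply, affineSwapFun, affineSwapFun]
  simp only [e]
  split_ifs <;> ring

theorem affineSwap_cases {n : ℕ} (hn : 2 ≤ n) (p j : ℤ) :
    ((n : ℤ) ∣ j - p ∧ affineSwap hn p j = j + 1) ∨
    ((n : ℤ) ∣ j - (p + 1) ∧ affineSwap hn p j = j - 1) ∨
    (¬ (n : ℤ) ∣ j - p ∧ ¬ (n : ℤ) ∣ j - (p + 1) ∧ affineSwap hn p j = j) := by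
  by_cases h : (n : ℤ) ∣ j - p
  · exact Or.inl ⟨h, affineSwapFun_of_dvd h⟩
  · by_cases h' : (n : ℤ) ∣ j - (p + 1)
    · exact Or.inr (Or.inl ⟨h', affineSwapFun_of_dvd_succ hn h'⟩)
    · exact Or.inr (Or.inr ⟨h, h', affineSwapFun_of_not h h'⟩)

theorem affinePerms_add_mul {n : ℕ} {f : Equiv.Perm ℤ} (hf : f ∈ affinePerms n) (j m : ℤ) :
    f (j + n * m) = f j + n * m := map_add_mul hf j m

/-- The order of two integers changes under an affine simple transposition only if these integers
are exchanged. -/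
theorem affineSwap_lt_iff {n : ℕ} (hn : 2 ≤ n) {p x y : ℤ}
    (h1 : ¬((n : ℤ) ∣ x - p ∧ y = x + 1)) (h2 : ¬((n : ℤ) ∣ y - p ∧ x = y + 1)) :
    affineSwap hn p x < affineSwap hn p y ↔ x < y := by
  have key : ∀ {x y : ℤ}, ¬((n : ℤ) ∣ x - p ∧ y = x + 1) → x < y →
      affineSwap hn p x < affineSwap hn p y := by
    intro x y h hxy
    rcases affineSwap_cases hn p x with ⟨a, b⟩ | ⟨a, b⟩ | ⟨a, a', b⟩ <;>
    rcases affineSwap_cases hn p y with ⟨c, d⟩ | ⟨c, d⟩ | ⟨c, c', d⟩ <;>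
    rw [b, d]
    · omega
    · rcases eq_or_ne y (x + 1) with e | e
      · exact (h ⟨a, e⟩).elim
      · rcases eq_or_ne y (x + 2) with e2 | e2
        · exact (two_le_not_dvd_one hn (by
            have := dvd_sub c a
            rwa [e2, show x + 2 - (p + 1) - (x - p) = 1 by ring] at this)).elim
        · omega
    · rcases eq_or_ne y (x + 1) with e | e
      · exact (h ⟨a, e⟩).elim
      · omega
    · omega
    · omega
    · omega
    · omega
    · rcases eq_or_ne y (x + 1) with e | e
      · exact (a (by rwa [e, add_sub_add_right_eq_sub] at c)).elim
      · omega
    · omega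
  refine ⟨fun h => ?_, key h1⟩
  have h3 := key (x := affineSwap hn p x) (y := affineSwap hn p y) (fun ⟨a, b⟩ => ?_) h
  · rwa [affineSwap_affineSwap, affineSwap_affineSwap] at h3
  · have hx : x = affineSwap hn p x + 1 := by
      conv_lhs => rw [← affineSwap_affineSwap hn p x]
      exact affineSwapFun_of_dvd a
    have hy : y = affineSwap hn p x := by
      conv_lhs => rw [← affineSwap_affineSwap hn p y, b]
      rw [affineSwap_apply, affineSwapFun_of_dvd_succ hn (by rwa [add_sub_add_right_eq_sub])]
      ring
    exact h2 ⟨by rw [hy]; exact a, by rw [hy]; exact hx⟩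

/-! ### The bounded affine permutation of a periodic sequence of vectors -/

section Sequence

variable {F : Type*} [Field F] {W : Type*} [AddCommGroup W] [Module F W]

/-- For each `i`, the value `f i` is the least `j ≥ i` such that `A i` lies in the span of
`A (i + 1), …, A j`. -/
def HasPos (F : Type*) [Field F] {W : Type*} [AddCommGroup W] [Module F W]
    (f : ℤ → ℤ) (A : ℤ → W) : Prop :=
  ∀ i : ℤ, IsLeast {j : ℤ | i ≤ j ∧ A i ∈ Submodule.span F (A '' Set.Ioc i j)} (f i)

theorem span_image_mono {A : ℤ → W} {s t : Set ℤ} (h : s ⊆ t) :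
    Submodule.span F (A '' s) ≤ Submodule.span F (A '' t) :=
  Submodule.span_mono (Set.image_mono h)

theorem mem_span_image {A : ℤ → W} {s : Set ℤ} {x : ℤ} (h : x ∈ s) :
    A x ∈ Submodule.span F (A '' s) :=
  Submodule.subset_span (Set.mem_image_of_mem A h)

theorem span_image_insert (A : ℤ → W) (x : ℤ) (s : Set ℤ) {y : W} :
    y ∈ Submodule.span F (A '' insert x s) ↔
      ∃ c : F, ∃ z ∈ Submodule.span F (A '' s), y = c • A x + z := by
  rw [Set.image_insert_eq, Submodule.mem_span_insert]

variable {f g h : ℤ → ℤ} {A B : ℤ → W}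

theorem HasPos.le (hA : HasPos F f A) (i : ℤ) : i ≤ f i := (hA i).1.1

theorem HasPos.mem_iff (hA : HasPos F f A) {i j : ℤ} (hij : i ≤ j) :
    A i ∈ Submodule.span F (A '' Set.Ioc i j) ↔ f i ≤ j :=
  ⟨fun h => (hA i).2 ⟨hij, h⟩,
    fun h => span_image_mono (Set.Ioc_subset_Ioc_right h) (hA i).1.2⟩

theorem HasPos.eq_self_iff (hA : HasPos F f A) {i : ℤ} : f i = i ↔ A i = 0 := by
  have h1 := hA.mem_iff (le_refl i)
  rw [Set.Ioc_self, Set.image_empty, Submodule.span_empty, Submodule.mem_bot] at h1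
  rw [h1]
  exact ⟨fun h => h.le, fun h => le_antisymm h (hA.le i)⟩

theorem HasPos.ext (hA : HasPos F f A) (hA' : HasPos F g A) : f = g :=
  funext fun i => (hA i).unique (hA' i)

/-- Exchange: in the minimal relation expressing `A i` by `A (i + 1), …, A j` the vector `A j` has a
nonzero coefficient, so it can be solved for. Thus the inverse of `f` describes spans read from
right to left. -/
theorem HasPos.mem_Ico_iff (hA : HasPos F f A) {i j i' : ℤ} (hij : f i = j) (hi' : i' ≤ j) :
    A j ∈ Submodule.span F (A '' Set.Ico i' j) ↔ i' ≤ i := by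
  have hle := hA.le i
  rcases eq_or_lt_of_le hle with h0 | h0
  · have hj : j = i := by rw [← hij, ← h0]
    subst hj
    have h1 : A j = 0 := hA.eq_self_iff.1 hij
    rw [h1]
    exact ⟨fun _ => hi', fun _ => Submodule.zero_mem _⟩
  · rw [hij] at h0
    have hm : A i ∈ Submodule.span F (A '' Set.Ioc i j) := (hA.mem_iff h0.le).2 hij.le
    have hnm : A i ∉ Submodule.span F (A '' Set.Ioc i (j - 1)) := fun h1 => by
      have := (hA.mem_iff (by omega)).1 h1
      omega
    constructor
    · intro h1
      by_contra h2
      apply hnm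
      have h3 : A j ∈ Submodule.span F (A '' Set.Ioc i (j - 1)) :=
        span_image_mono (fun x hx => by
          rw [Set.mem_Ico] at hx
          rw [Set.mem_Ioc]
          omega) h1
      rw [show Set.Ioc i j = insert j (Set.Ioc i (j - 1)) by
        ext x; simp only [Set.mem_Ioc, Set.mem_insert_iff]; omega, span_image_insert] at hm
      obtain ⟨c, z, hz, he⟩ := hm
      rw [he]
      exact Submodule.add_mem _ (Submodule.smul_mem _ _ h3) hz
    · intro h1
      rw [show Set.Ioc i j = insert j (Set.Ioc i (j - 1)) by
        ext x; simp only [Set.mem_Ioc, Set.mem_insert_iff]; omega, span_image_insert] at hm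
      obtain ⟨c, z, hz, he⟩ := hm
      have hc : c ≠ 0 := by
        rintro rfl
        rw [zero_smul, zero_add] at he
        exact hnm (he ▸ hz)
      have hj : A j = c⁻¹ • (A i - z) := by
        rw [he, add_sub_cancel_right, smul_smul, inv_mul_cancel₀ hc, one_smul]
      rw [hj]
      refine Submodule.smul_mem _ _ (Submodule.sub_mem _ (mem_span_image ⟨h1, h0⟩)
        (span_image_mono (fun x hx => ?_) hz))
      rw [Set.mem_Ioc] at hx
      rw [Set.mem_Ico]
      omega

/-- The preimage of `j` is recovered as the largest start `i'` for which `A j` is spanned by the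
vectors from `i'` to `j - 1`. -/
theorem HasPos.injective (hA : HasPos F f A) : Function.Injective f := by
  have key : ∀ i i', f i = f i' → i' ≤ i := fun i i' h =>
    (hA.mem_Ico_iff h (hA.le i')).1 ((hA.mem_Ico_iff rfl (hA.le i')).2 le_rfl)
  exact fun i i' h => le_antisymm (key i' i h.symm) (key i i' h)

theorem HasPos.le_add {n : ℕ} (hn : 0 < n) (hper : ∀ j, A (j + n) = A j) (hA : HasPos F f A)
    (i : ℤ) : f i ≤ i + n := by
  refine (hA.mem_iff (by omega)).1 ?_
  rw [← hper i]
  exact mem_span_image (Set.mem_Ioc.2 (by omega))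

theorem span_image_Ioc_add {n : ℕ} (hper : ∀ j, A (j + n) = A j) (i j : ℤ) :
    Submodule.span F (A '' Set.Ioc (i + n) (j + n)) = Submodule.span F (A '' Set.Ioc i j) := by
  congr 1
  ext y
  constructor
  · rintro ⟨x, hx, rfl⟩
    refine ⟨x - n, Set.mem_Ioc.2 ?_, ?_⟩
    · rw [Set.mem_Ioc] at hx
      omega
    · rw [← hper, sub_add_cancel]
  · rintro ⟨x, hx, rfl⟩
    refine ⟨x + n, Set.mem_Ioc.2 ?_, hper x⟩
    rw [Set.mem_Ioc] at hx
    omega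

theorem HasPos.add_period {n : ℕ} (hper : ∀ j, A (j + n) = A j) (hA : HasPos F f A) (i : ℤ) :
    f (i + n) = f i + n := by
  refine (hA (i + n)).unique ⟨⟨by have := hA.le i; omega, ?_⟩, ?_⟩
  · rw [span_image_Ioc_add hper, hper]
    exact (hA i).1.2
  · rintro j ⟨h1, h2⟩
    rw [show j = j - n + n by ring, span_image_Ioc_add hper, hper] at h2
    have := (hA.mem_iff (by omega)).1 h2
    omega

theorem exists_hasPos (F : Type*) [Field F] {W : Type*} [AddCommGroup W] [Module F W] {A : ℤ → W}
    {n : ℕ} (hn : 0 < n) (hper : ∀ j, A (j + n) = A j) :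
    ∃ f : ℤ → ℤ, HasPos F f A := by
  have key : ∀ i : ℤ, ∃ j, IsLeast
      {j : ℤ | i ≤ j ∧ A i ∈ Submodule.span F (A '' Set.Ioc i j)} j := fun i => by
    have hne : ∃ m : ℕ, A i ∈ Submodule.span F (A '' Set.Ioc i (i + m)) := by
      refine ⟨n, ?_⟩
      rw [← hper i]
      exact mem_span_image (Set.mem_Ioc.2 (by omega))
    classical
    refine ⟨i + (Nat.find hne : ℕ), ⟨by omega, Nat.find_spec hne⟩, ?_⟩
    rintro j ⟨h1, h2⟩
    have h3 : i + ((j - i).toNat : ℕ) = j := by omega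
    have := Nat.find_min' hne (m := (j - i).toNat) (by rw [h3]; exact h2)
    omega
  choose f hf using key
  exact ⟨f, hf⟩

end Sequence

end PositroidCatalan

namespace PositroidCatalan

/-! ### Adding a multiple of a column to its neighbor -/

section Bridge

variable {F : Type*} [Field F] {W : Type*} [AddCommGroup W] [Module F W]

/-- For all `j ≡ p` modulo `n`, the vectors `B j`, `B (j + 1)` are replaced by `B (j + 1) + c B j`,
`B j`. -/
def bridge (n : ℕ) (p : ℤ) (c : F) (B : ℤ → W) (j : ℤ) : W :=
  if (n : ℤ) ∣ j - p then B (j + 1) + c • B j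
  else if (n : ℤ) ∣ j - (p + 1) then B (j - 1) else B j

variable {n : ℕ} {p : ℤ} {c : F} {B : ℤ → W}

theorem bridge_of_dvd {j : ℤ} (h : (n : ℤ) ∣ j - p) :
    bridge n p c B j = B (j + 1) + c • B j := if_pos h

theorem bridge_of_dvd_succ (hn : 2 ≤ n) {j : ℤ} (h : (n : ℤ) ∣ j - (p + 1)) :
    bridge n p c B j = B (j - 1) := by
  have h' : ¬ (n : ℤ) ∣ j - p := fun h' => two_le_not_dvd_one hn (by
    have := dvd_sub h' h
    rwa [show j - p - (j - (p + 1)) = 1 by ring] at this)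
  rw [bridge, if_neg h', if_pos h]

theorem bridge_of_not {j : ℤ} (h : ¬ (n : ℤ) ∣ j - p) (h' : ¬ (n : ℤ) ∣ j - (p + 1)) :
    bridge n p c B j = B j := by
  rw [bridge, if_neg h, if_neg h']

theorem bridge_self : bridge n p c B p = B (p + 1) + c • B p := bridge_of_dvd (by simp)

theorem bridge_succ (hn : 2 ≤ n) : bridge n p c B (p + 1) = B p := by
  rw [bridge_of_dvd_succ hn (by simp), add_sub_cancel_right]

theorem bridge_periodic (hper : ∀ j, B (j + n) = B j) (j : ℤ) :
    bridge n p c B (j + n) = bridge n p c B j := by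
  have e : ∀ y : ℤ, ((n : ℤ) ∣ j + n - y ↔ (n : ℤ) ∣ j - y) := fun y => by
    rw [show j + n - y = j - y + n by ring, dvd_add_self_right]
  unfold bridge
  simp only [e, hper, show j + n + 1 = j + 1 + n by ring, show j + n - 1 = j - 1 + n by ring]

/-- A bridge is an invertible change within each pair of neighboring positions, so it preserves
spans over index sets containing both or neither of each pair. -/
theorem span_bridge_eq (hn : 2 ≤ n) {s : Set ℤ}
    (hs : ∀ j, (n : ℤ) ∣ j - p → (j ∈ s ↔ j + 1 ∈ s)) :
    Submodule.span F (bridge n p c B '' s) = Submodule.span F (B '' s) := by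
  have hsub : ∀ j, (n : ℤ) ∣ j - (p + 1) → (n : ℤ) ∣ j - 1 - p := fun j h => by
    rwa [show j - 1 - p = j - (p + 1) by ring]
  apply le_antisymm
  · rw [Submodule.span_le]
    rintro _ ⟨j, hj, rfl⟩
    by_cases h : (n : ℤ) ∣ j - p
    · rw [bridge_of_dvd h]
      exact Submodule.add_mem _ (mem_span_image ((hs j h).1 hj))
        (Submodule.smul_mem _ _ (mem_span_image hj))
    · by_cases h' : (n : ℤ) ∣ j - (p + 1)
      · rw [bridge_of_dvd_succ hn h']
        exact mem_span_image ((hs (j - 1) (hsub j h')).2 (by rwa [sub_add_cancel]))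
      · rw [bridge_of_not h h']
        exact mem_span_image hj
  · rw [Submodule.span_le]
    rintro _ ⟨j, hj, rfl⟩
    by_cases h : (n : ℤ) ∣ j - p
    · have h1 : B j = bridge n p c B (j + 1) := by
        rw [bridge_of_dvd_succ hn (by rwa [add_sub_add_right_eq_sub]), add_sub_cancel_right]
      rw [h1]
      exact mem_span_image ((hs j h).1 hj)
    · by_cases h' : (n : ℤ) ∣ j - (p + 1)
      · have h1 : B j = bridge n p c B (j - 1) - c • bridge n p c B j := by
          rw [bridge_of_dvd_succ hn h', bridge_of_dvd (hsub j h'), sub_add_cancel,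
            add_sub_cancel_right]
        rw [h1]
        exact Submodule.sub_mem _
          (mem_span_image ((hs (j - 1) (hsub j h')).2 (by rwa [sub_add_cancel])))
          (Submodule.smul_mem _ _ (mem_span_image hj))
      · rw [← bridge_of_not (c := c) (B := B) h h']
        exact mem_span_image hj

theorem span_bridge_Ioc (hn : 2 ≤ n) {i j : ℤ} (hi : ¬ (n : ℤ) ∣ i - p) (hj : ¬ (n : ℤ) ∣ j - p) :
    Submodule.span F (bridge n p c B '' Set.Ioc i j) = Submodule.span F (B '' Set.Ioc i j) := by
  refine span_bridge_eq hn fun x hx => ?_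
  have h1 : x ≠ i := by rintro rfl; exact hi hx
  have h2 : x ≠ j := by rintro rfl; exact hj hx
  rw [Set.mem_Ioc, Set.mem_Ioc]
  omega

/-- Intervals strictly between consecutive copies of the two positions are not affected. -/
theorem span_bridge_of_between (hn : 2 ≤ n) {s : Set ℤ} {q : ℤ} (hq : (n : ℤ) ∣ q - p)
    (hs : ∀ j ∈ s, q + 1 < j ∧ j < q + n) :
    Submodule.span F (bridge n p c B '' s) = Submodule.span F (B '' s) := by
  refine span_bridge_eq hn fun x hx => ⟨fun h => ?_, fun h => ?_⟩
  · have h1 := hs _ h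
    have h2 := dvd_sub hx hq
    exact (not_dvd_of_lt (by omega) (by omega) h2).elim
  · have h1 := hs _ h
    have h2 := dvd_sub hx hq
    exact (not_dvd_of_lt (by omega) (by omega) h2).elim

variable {g h : Equiv.Perm ℤ}

/-- All intervals starting at `j` keep their span unless they end at a position congruent to `p`, so
the value at `j` is determined up to exchanging two neighbors. -/
theorem bridge_hasPos_of_not (hn : 2 ≤ n) {h : ℤ → ℤ}
    (hB : HasPos F g B) (hh : HasPos F h (bridge n p c B)) {j : ℤ} (hj : ¬ (n : ℤ) ∣ j - p)
    (hj' : ¬ (n : ℤ) ∣ j - (p + 1)) :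
    h j = g j ∨ h j = affineSwap hn p (g j) := by
  have key : ∀ m, j ≤ m → ¬ (n : ℤ) ∣ m - p → (h j ≤ m ↔ g j ≤ m) := fun m hm hmp => by
    rw [← hh.mem_iff hm, ← hB.mem_iff hm, span_bridge_Ioc hn hj hmp, bridge_of_not hj hj']
  have h1 := hh.le j
  have h2 := hB.le j
  have hnd := two_le_not_dvd_one hn
  rcases affineSwap_cases hn p (g j) with ⟨a, b⟩ | ⟨a, b⟩ | ⟨a, a', b⟩
  · rw [b]
    have k1 := key (g j + 1) (by omega) (fun h' => hnd (by
      have := dvd_sub h' a; rwa [show g j + 1 - p - (g j - p) = 1 by ring] at this))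
    by_cases h3 : j ≤ g j - 1
    · have k2 := key (g j - 1) h3 (fun h' => hnd (by
        have := dvd_sub a h'; rwa [show g j - p - (g j - 1 - p) = 1 by ring] at this))
      omega
    · omega
  · rw [b]
    have hne : j ≠ g j := by rintro h'; rw [← h'] at a; exact hj' a
    have k1 := key (g j) h2 (fun h' => hnd (by
      have := dvd_sub h' a; rwa [show g j - p - (g j - (p + 1)) = 1 by ring] at this))
    have hne2 : j ≠ g j - 1 := by
      rintro h'; apply hj; rw [h']; rwa [show g j - 1 - p = g j - (p + 1) by ring]
    have k2 := key (g j - 2) (by omega) (fun h' => hnd (by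
      have := dvd_sub a h'; rwa [show g j - (p + 1) - (g j - 2 - p) = 1 by ring] at this))
    omega
  · left
    have k1 := key (g j) h2 a
    by_cases h3 : j ≤ g j - 1
    · have k2 := key (g j - 1) h3 (by rwa [show g j - 1 - p = g j - (p + 1) by ring])
      omega
    · omega

/-- The condition that a vector lies in the span of the following vectors, skipping the next. -/
theorem mem_span_skip_iff (hB : HasPos F g B) (hcross : g (p + 1) < g p) {m : ℤ} (hm : p + 1 ≤ m) :
    B p ∈ Submodule.span F (B '' Set.Ioc (p + 1) m) ↔ g p ≤ m := by
  have hsub : Set.Ioc (p + 1) m ⊆ Set.Ioc p m := Set.Ioc_subset_Ioc_left (by omega)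
  refine ⟨fun h => (hB.mem_iff (by omega)).1 (span_image_mono hsub h), fun h => ?_⟩
  have h1 := (hB.mem_iff (i := p) (j := m) (by omega)).2 h
  have h2 := (hB.mem_iff hm).2 (by omega)
  rw [show Set.Ioc p m = insert (p + 1) (Set.Ioc (p + 1) m) by
    ext x; simp only [Set.mem_Ioc, Set.mem_insert_iff]; omega, span_image_insert] at h1
  obtain ⟨x, z, hz, he⟩ := h1
  rw [he]
  exact Submodule.add_mem _ (Submodule.smul_mem _ _ h2) hz

/-- The new vector at `p + 1` is `B p`. Because of the crossing, `B (p + 1)` is never needed to span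
it, so skipping that position does not matter; only the end point `p + n` leaves a choice. -/
theorem bridge_hasPos_succ (hn : 2 ≤ n) (hper : ∀ j, B (j + n) = B j) {h : ℤ → ℤ}
    (hB : HasPos F g B) (hh : HasPos F h (bridge n p c B)) (hcross : g (p + 1) < g p) :
    h (p + 1) = g p ∨ h (p + 1) = affineSwap hn p (g p) := by
  have hle := hB.le_add (by omega) hper p
  have hle1 := hB.le (p + 1)
  have h1 := hh.le (p + 1)
  have h2 := hh.le_add (by omega) (bridge_periodic hper) (p + 1)
  have key : ∀ m, p + 1 ≤ m → m ≤ p + n - 1 → (h (p + 1) ≤ m ↔ g p ≤ m) := fun m hm hm' => by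
    rw [← hh.mem_iff hm, span_bridge_of_between hn (q := p) (by simp) (fun j hj => by
      rw [Set.mem_Ioc] at hj; omega), bridge_succ hn, mem_span_skip_iff hB hcross hm]
  by_cases h3 : g p ≤ p + n - 1
  · left
    have k1 := key (g p) (by omega) h3
    have k2 := key (g p - 1) (by omega) (by omega)
    omega
  · have k1 := key (p + n - 1) (by omega) le_rfl
    have h4 : g p = p + n := by omega
    have h5 : affineSwap hn p (g p) = g p + 1 := affineSwapFun_of_dvd (by rw [h4]; simp)
    omega

theorem bridge_hasPos_self (hn : 2 ≤ n) (hper : ∀ j, B (j + n) = B j) {h : ℤ → ℤ}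
    (hB : HasPos F g B) (hh : HasPos F h (bridge n p c B)) (hcross : g (p + 1) < g p) :
    h p = g (p + 1) ∨ h p = affineSwap hn p (g (p + 1)) := by
  have hle := hB.le_add (by omega) hper p
  have hle1 := hB.le (p + 1)
  have h1 := hh.le p
  have key : ∀ m, p + 1 ≤ m → m ≤ p + n - 1 → (h p ≤ m ↔ g (p + 1) ≤ m) := fun m hm hm' => by
    have hspan : Submodule.span F (bridge n p c B '' Set.Ioc (p + 1) m) =
        Submodule.span F (B '' Set.Ioc (p + 1) m) :=
      span_bridge_of_between hn (q := p) (by simp) (fun j hj => by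
        rw [Set.mem_Ioc] at hj; omega)
    have hins : Set.Ioc p m = insert (p + 1) (Set.Ioc (p + 1) m) := by
      ext x; simp only [Set.mem_Ioc, Set.mem_insert_iff]; omega
    rw [← hh.mem_iff (by omega : p ≤ m), hins, span_image_insert, hspan, bridge_succ hn, bridge_self]
    constructor
    · rintro ⟨x, z, hz, he⟩
      -- If the coefficient of `B p` is `c`, the relation concerns `B (p + 1)` alone; otherwise it
      -- spans `B p`, and the crossing gives the conclusion anyway.
      by_cases hx : x = c
      · rw [hx, add_comm, add_left_cancel_iff] at he
        exact (hB.mem_iff hm).1 (he ▸ hz)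
      · have h3 : g p ≤ m := by
          refine (hB.mem_iff (by omega)).1 ?_
          have h4 : B p = (x - c)⁻¹ • (B (p + 1) - z) := by
            have h5 : B (p + 1) - z = (x - c) • B p := by
              rw [sub_smul, sub_eq_sub_iff_add_eq_add, he]
            rw [h5, smul_smul, inv_mul_cancel₀ (sub_ne_zero.2 hx), one_smul]
          rw [h4]
          exact Submodule.smul_mem _ _ (Submodule.sub_mem _
            (mem_span_image (Set.mem_Ioc.2 (by omega)))
            (span_image_mono (Set.Ioc_subset_Ioc_left (by omega)) hz))
        omega
    · intro h3
      exact ⟨c, B (p + 1), (hB.mem_iff hm).2 h3, add_comm _ _⟩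
  by_cases h3 : p + 2 ≤ g (p + 1)
  · left
    have k1 := key (g (p + 1)) (by omega) (by omega)
    have k2 := key (g (p + 1) - 1) (by omega) (by omega)
    omega
  · have h4 : g (p + 1) = p + 1 := by omega
    rw [h4, affineSwap_succ]
    have k1 := key (p + 1) le_rfl (by omega)
    omega

theorem bridge_hasPos_or (hn : 2 ≤ n) (hper : ∀ j, B (j + n) = B j) (hg : g ∈ affinePerms n)
    {h : ℤ → ℤ}
    (hB : HasPos F g B) (hh : HasPos F h (bridge n p c B)) (hcross : g (p + 1) < g p) (j : ℤ) :
    h j = (g * affineSwap hn p) j ∨ h j = affineSwap hn p ((g * affineSwap hn p) j) := by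
  have hhper := hh.add_period (bridge_periodic hper)
  have hG : g * affineSwap hn p ∈ affinePerms n :=
    Subgroup.mul_mem _ hg (affineSwap_mem hn p)
  have shift : ∀ i m : ℤ,
      (h i = (g * affineSwap hn p) i ∨ h i = affineSwap hn p ((g * affineSwap hn p) i)) →
      (h (i + n * m) = (g * affineSwap hn p) (i + n * m) ∨
        h (i + n * m) = affineSwap hn p ((g * affineSwap hn p) (i + n * m))) := by
    intro i m hi
    rw [map_add_mul hhper, affinePerms_add_mul hG, affinePerms_add_mul (affineSwap_mem hn p)]
    rcases hi with hi | hi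
    · left; rw [hi]
    · right; rw [hi]
  rcases affineSwap_cases hn p j with ⟨a, b⟩ | ⟨a, b⟩ | ⟨a, a', b⟩
  · obtain ⟨m, hm⟩ := a
    rw [show j = p + n * m by linarith]
    apply shift
    rw [Equiv.Perm.mul_apply, affineSwap_self]
    exact bridge_hasPos_self hn hper hB hh hcross
  · obtain ⟨m, hm⟩ := a
    rw [show j = p + 1 + n * m by linarith]
    apply shift
    rw [Equiv.Perm.mul_apply, affineSwap_succ]
    exact bridge_hasPos_succ hn hper hB hh hcross
  · rw [Equiv.Perm.mul_apply, b]
    exact bridge_hasPos_of_not hn hB hh a a'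

/-- The pointwise alternative is a real choice only at the preimages of the two exchanged classes.
Injectivity forces the same choice at both, and the preimage of `p` tells which one was made. -/
theorem eq_or_eq_swap_mul (hn : 2 ≤ n) {G : Equiv.Perm ℤ} (hG : G ∈ affinePerms n)
    {h : ℤ → ℤ} (hinj : Function.Injective h) (hper : ∀ j, h (j + n) = h j + n)
    (hor : ∀ j, h j = G j ∨ h j = affineSwap hn p (G j)) :
    (h = G ∧ h (G⁻¹ p) = p) ∨
      (h = (affineSwap hn p * G : Equiv.Perm ℤ) ∧ h (G⁻¹ (p + 1)) = p) := by
  have e1 : G (G⁻¹ p) = p := by simp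
  have e2 : G (G⁻¹ (p + 1)) = p + 1 := by simp
  have h1 := hor (G⁻¹ p)
  have h2 := hor (G⁻¹ (p + 1))
  rw [e1, affineSwap_self] at h1
  rw [e2, affineSwap_succ] at h2
  have hne : h (G⁻¹ p) ≠ h (G⁻¹ (p + 1)) := fun h' => by
    have := G⁻¹.injective (hinj h')
    omega
  have hrep : ∀ j a m, G j = a + n * m → j = G⁻¹ a + n * m := fun j a m hj => by
    apply G.injective
    rw [hj, affinePerms_add_mul hG]
    simp
  rcases h1 with h1 | h1
  · have h2' : h (G⁻¹ (p + 1)) = p + 1 := by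
      rcases h2 with h2 | h2
      · exact h2
      · exact (hne (h1.trans h2.symm)).elim
    refine Or.inl ⟨funext fun j => ?_, h1⟩
    rcases affineSwap_cases hn p (G j) with ⟨⟨m, hm⟩, b⟩ | ⟨⟨m, hm⟩, b⟩ | ⟨a, a', b⟩
    · have hj := hrep j p m (by linarith)
      rw [hj, map_add_mul hper, affinePerms_add_mul hG, h1, e1]
    · have hj := hrep j (p + 1) m (by linarith)
      rw [hj, map_add_mul hper, affinePerms_add_mul hG, h2', e2]
    · have := hor j
      rw [b, or_self] at this
      exact this
  · have h2' : h (G⁻¹ (p + 1)) = p := by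
      rcases h2 with h2 | h2
      · exact (hne (h1.trans h2.symm)).elim
      · exact h2
    refine Or.inr ⟨funext fun j => ?_, h2'⟩
    rw [Equiv.Perm.mul_apply]
    rcases affineSwap_cases hn p (G j) with ⟨⟨m, hm⟩, b⟩ | ⟨⟨m, hm⟩, b⟩ | ⟨a, a', b⟩
    · have hj := hrep j p m (by linarith)
      rw [hj, map_add_mul hper, affinePerms_add_mul hG, h1, e1,
        affinePerms_add_mul (affineSwap_mem hn p), affineSwap_self]
    · have hj := hrep j (p + 1) m (by linarith)
      rw [hj, map_add_mul hper, affinePerms_add_mul hG, h2', e2,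
        affinePerms_add_mul (affineSwap_mem hn p), affineSwap_succ]
    · have := hor j
      rw [b, or_self] at this
      rw [b, this]

/-- If both pairs of strands at the two positions cross, then the bridge always removes both
crossings. -/
theorem bridge_hasPos_of_gt (hn : 2 ≤ n) (hper : ∀ j, B (j + n) = B j) (hg : g ∈ affinePerms n)
    (hB : HasPos F g B) (hcross : g (p + 1) < g p) (hinv : g⁻¹ (p + 1) < g⁻¹ p) :
    HasPos F (affineSwap hn p * g * affineSwap hn p : Equiv.Perm ℤ) (bridge n p c B) := by
  obtain ⟨h, hh⟩ := exists_hasPos F (by omega : 0 < n) (bridge_periodic (p := p) (c := c) hper)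
  have hG : g * affineSwap hn p ∈ affinePerms n :=
    Subgroup.mul_mem _ hg (affineSwap_mem hn p)
  rcases eq_or_eq_swap_mul hn hG hh.injective (hh.add_period (bridge_periodic hper))
    (bridge_hasPos_or hn hper hg hB hh hcross) with ⟨h1, h2⟩ | ⟨h1, h2⟩
  · exfalso
    rw [mul_inv_rev, affineSwap_inv, Equiv.Perm.mul_apply] at h2
    set i1 := g⁻¹ p with hi1
    set i2 := g⁻¹ (p + 1) with hi2
    have e1 : g i1 = p := by rw [hi1]; simp
    have e2 : g i2 = p + 1 := by rw [hi2]; simp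
    have l1 := hB.le i1
    have l2 := hB.le_add (by omega) hper i2
    have l3 := hB.le (p + 1)
    have hne : i1 ≠ p := fun h' => by rw [h'] at e1; omega
    have hs : affineSwap hn p i1 = i1 := affineSwapFun_of_not
      (fun h' => by
        rw [← dvd_neg] at h'
        exact not_dvd_of_lt (by omega) (by omega) h') (fun h' => by
        rw [← dvd_neg] at h'
        exact not_dvd_of_lt (by omega) (by omega) h')
    rw [hs] at h2
    have m1 := (hh.mem_Ico_iff h2 (i' := i1) (by omega)).2 le_rfl
    rw [span_bridge_of_between hn (q := p - n) (by simp) (fun j hj => by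
      rw [Set.mem_Ico] at hj
      omega), bridge_self] at m1
    have m2 := (hB.mem_Ico_iff e1 (i' := i1) (by omega)).2 le_rfl
    have m3 : B (p + 1) ∈ Submodule.span F (B '' Set.Ico i1 (p + 1)) := by
      refine span_image_mono (Set.Ico_subset_Ico_right (by omega)) (s := Set.Ico i1 p) ?_
      rw [show B (p + 1) = B (p + 1) + c • B p - c • B p by abel]
      exact Submodule.sub_mem _ m1 (Submodule.smul_mem _ _ m2)
    have := (hB.mem_Ico_iff e2 (by omega)).1 m3
    omega
  · rw [h1] at hh
    rwa [mul_assoc]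

/-- If the incoming strands at the two positions do not cross, then the bridge removes the crossing
of the outgoing strands, and it moves both or none of the incoming strands, according to a linear
condition. -/
theorem bridge_hasPos_of_lt (hn : 2 ≤ n) (hper : ∀ j, B (j + n) = B j) (hg : g ∈ affinePerms n)
    (hB : HasPos F g B) (hcross : g (p + 1) < g p) (hinv : g⁻¹ p < g⁻¹ (p + 1)) :
    (HasPos F (affineSwap hn p * g * affineSwap hn p : Equiv.Perm ℤ) (bridge n p c B) ∧
      B (p + 1) + c • B p ∈ Submodule.span F (B '' Set.Ico (g⁻¹ (p + 1)) p)) ∨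
    (HasPos F (g * affineSwap hn p : Equiv.Perm ℤ) (bridge n p c B) ∧
      B (p + 1) + c • B p ∉ Submodule.span F (B '' Set.Ico (g⁻¹ (p + 1)) p)) := by
  obtain ⟨h, hh⟩ := exists_hasPos F (by omega : 0 < n) (bridge_periodic (p := p) (c := c) hper)
  have hG : g * affineSwap hn p ∈ affinePerms n :=
    Subgroup.mul_mem _ hg (affineSwap_mem hn p)
  have hor := eq_or_eq_swap_mul hn hG hh.injective (hh.add_period (bridge_periodic hper))
    (bridge_hasPos_or hn hper hg hB hh hcross)
  simp only [mul_inv_rev, affineSwap_inv, Equiv.Perm.mul_apply] at hor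
  set i1 := g⁻¹ p with hi1
  set i2 := g⁻¹ (p + 1) with hi2
  have e1 : g i1 = p := by rw [hi1]; simp
  have e2 : g i2 = p + 1 := by rw [hi2]; simp
  have l1 := hB.le_add (by omega) hper i1
  have l2 := hB.le i2
  have l3 := hB.le (p + 1)
  have l4 := hB.le_add (by omega) hper p
  have hne : i2 ≠ p := fun h' => by rw [h'] at e2; omega
  have hne2 : i2 ≠ p + 1 - n := fun h' => by
    have h3 := affinePerms_add_mul hg i2 1
    rw [e2, h'] at h3
    rw [show p + 1 - (n : ℤ) + n * 1 = p + 1 by ring] at h3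
    omega
  have hspan : Submodule.span F (bridge n p c B '' Set.Ico i2 p) =
      Submodule.span F (B '' Set.Ico i2 p) :=
    span_bridge_of_between hn (q := p - n) (by simp) (fun j hj => by
      rw [Set.mem_Ico] at hj
      omega)
  -- The linear condition now speaks of the new sequence alone: it asks whether the vector at `p` is
  -- spanned from `g⁻¹ (p + 1)` on, that is, which strand now ends at `p`.
  rw [← bridge_self (n := n), ← hspan]
  rcases hor with ⟨h1, h2⟩ | ⟨h1, h2⟩
  · refine Or.inr ⟨by rw [h1] at hh; exact hh, fun hm => ?_⟩
    rcases lt_or_ge p i2 with h3 | h3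
    · rw [Set.Ico_eq_empty (by omega), Set.image_empty, Submodule.span_empty,
        Submodule.mem_bot] at hm
      have h4 := hh.eq_self_iff.2 hm
      rw [h1, Equiv.Perm.mul_apply, affineSwap_self] at h4
      omega
    · have h4 := (hh.mem_Ico_iff h2 h3).1 hm
      rcases affineSwap_cases hn p i1 with ⟨a, b⟩ | ⟨a, b⟩ | ⟨a, a', b⟩
      · obtain ⟨m, hm'⟩ := a
        have h5 : (n : ℤ) ∣ i2 - (p + 1) := ⟨m, by omega⟩
        rw [← dvd_neg] at h5
        exact not_dvd_of_lt (by omega) (by omega) h5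
      · omega
      · omega
  · refine Or.inl ⟨by rw [h1] at hh; rwa [mul_assoc], ?_⟩
    rcases lt_or_ge p i2 with h3 | h3
    · have h4 : i2 = p + 1 := by omega
      rw [h4, affineSwap_succ] at h2
      rw [hh.eq_self_iff.1 h2]
      exact Submodule.zero_mem _
    · have hs : affineSwap hn p i2 = i2 := affineSwapFun_of_not
        (fun h' => by
          rw [← dvd_neg] at h'
          exact not_dvd_of_lt (by omega) (by omega) h') (fun h' => by
          rw [← dvd_neg] at h'
          exact not_dvd_of_lt (by omega) (by omega) h')
      rw [hs] at h2
      exact (hh.mem_Ico_iff h2 h3).2 le_rfl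

/-- Exactly one parameter satisfies the linear condition. -/
theorem existsUnique_bridge_param (hB : HasPos F g B) (hcross : g (p + 1) < g p)
    (hinv : g⁻¹ p < g⁻¹ (p + 1)) :
    ∃! c : F, B (p + 1) + c • B p ∈ Submodule.span F (B '' Set.Ico (g⁻¹ (p + 1)) p) := by
  set i1 := g⁻¹ p with hi1
  set i2 := g⁻¹ (p + 1) with hi2
  have e1 : g i1 = p := by rw [hi1]; simp
  have e2 : g i2 = p + 1 := by rw [hi2]; simp
  have l2 := hB.le i2
  have l3 := hB.le (p + 1)
  have hne : i2 ≠ p := fun h' => by rw [h'] at e2; omega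
  apply existsUnique_of_exists_of_unique
  · rcases lt_or_ge p i2 with h3 | h3
    · have h4 : i2 = p + 1 := by omega
      rw [h4] at e2
      refine ⟨0, ?_⟩
      rw [hB.eq_self_iff.1 e2, zero_smul, zero_add]
      exact Submodule.zero_mem _
    · have h5 := (hB.mem_Ico_iff e2 (i' := i2) (by omega)).2 le_rfl
      rw [show Set.Ico i2 (p + 1) = insert p (Set.Ico i2 p) by
        ext x; simp only [Set.mem_Ico, Set.mem_insert_iff]; omega, span_image_insert] at h5
      obtain ⟨x, z, hz, he⟩ := h5
      -- Here `x` is the coefficient of `B p` in the relation for `B (p + 1)`; subtracting this part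
      -- leaves a vector spanned without `B p`.
      refine ⟨-x, ?_⟩
      rw [he, show x • B p + z + -x • B p = z by rw [neg_smul]; abel]
      exact hz
  · intro c c' hc hc'
    by_contra hcc
    -- Two parameters would put `B p` itself into the span starting at `g⁻¹ (p + 1)`, which lies to
    -- the right of `g⁻¹ p`.
    have h5 : B p ∈ Submodule.span F (B '' Set.Ico i2 p) := by
      have h6 := Submodule.sub_mem _ hc hc'
      rw [add_sub_add_left_eq_sub, ← sub_smul] at h6
      have h7 := Submodule.smul_mem _ (c - c')⁻¹ h6
      rwa [smul_smul, inv_mul_cancel₀ (sub_ne_zero.2 hcc), one_smul] at h7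
    rcases lt_or_ge p i2 with h3 | h3
    · rw [Set.Ico_eq_empty (by omega), Set.image_empty, Submodule.span_empty,
        Submodule.mem_bot] at h5
      have := hB.eq_self_iff.2 h5
      omega
    · have := (hB.mem_Ico_iff e1 (by omega)).1 h5
      omega

/-- The crossing recovers the parameter: two different ones would express `B p` by vectors after `p
+ 1` that already suffice for `B (p + 1)` and `B' (p + 1)`, contradicting that the strands from `p`
end later. -/
theorem bridge_injective (hn : 2 ≤ n) {B' : ℤ → W} {g g' : ℤ → ℤ} {c' : F} (hB : HasPos F g B)
    (hB' : HasPos F g' B')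
    (hcross : g (p + 1) < g p) (hcross' : g' (p + 1) < g' p)
    (hper : ∀ j, B (j + n) = B j) (hper' : ∀ j, B' (j + n) = B' j)
    (heq : bridge n p c B = bridge n p c' B') : c = c' ∧ B = B' := by
  have hle := hB.le_add (by omega) hper p
  have hle' := hB'.le_add (by omega) hper' p
  have e1 : B p = B' p := by
    have := congrFun heq (p + 1)
    rwa [bridge_succ hn, bridge_succ hn] at this
  have e2 : B (p + 1) + c • B p = B' (p + 1) + c' • B' p := by
    have := congrFun heq p
    rwa [bridge_self, bridge_self] at this
  have e3 : ∀ j, p + 1 < j → j < p + n → B j = B' j := fun j h1 h2 => by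
    have := congrFun heq j
    have h3 : ¬ (n : ℤ) ∣ j - p := not_dvd_of_lt (by omega) (by omega)
    have h4 : ¬ (n : ℤ) ∣ j - (p + 1) := not_dvd_of_lt (by omega) (by omega)
    rwa [bridge_of_not h3 h4, bridge_of_not h3 h4] at this
  have hc : c = c' := by
    by_contra hcc
    have l1 := hB.le (p + 1)
    have l1' := hB'.le (p + 1)
    set m := max (g (p + 1)) (g' (p + 1)) with hm
    have hm1 : g (p + 1) ≤ m := le_max_left _ _
    have hm2 : g' (p + 1) ≤ m := le_max_right _ _
    have hmn : m < p + n := by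
      rcases max_choice (g (p + 1)) (g' (p + 1)) with h | h <;> rw [hm, h] <;> omega
    have himg : B '' Set.Ioc (p + 1) m = B' '' Set.Ioc (p + 1) m :=
      Set.image_congr fun j hj => by
        rw [Set.mem_Ioc] at hj
        exact e3 j (by omega) (by omega)
    have m1 := (hB.mem_iff (by omega)).2 hm1
    have m2 := (hB'.mem_iff (by omega)).2 hm2
    rw [← himg] at m2
    have m3 : B p ∈ Submodule.span F (B '' Set.Ioc (p + 1) m) := by
      have h5 : B p = (c - c')⁻¹ • (B' (p + 1) - B (p + 1)) := by
        have h6 : B' (p + 1) - B (p + 1) = (c - c') • B p := by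
          rw [sub_smul, sub_eq_sub_iff_add_eq_add, add_comm _ (B (p + 1)), e2, ← e1]
        rw [h6, smul_smul, inv_mul_cancel₀ (sub_ne_zero.2 hcc), one_smul]
      rw [h5]
      exact Submodule.smul_mem _ _ (Submodule.sub_mem _ m2 m1)
    have m4 : g p ≤ m := (hB.mem_iff (by omega)).1
      (span_image_mono (Set.Ioc_subset_Ioc_left (by omega)) m3)
    have m5 : g' p ≤ m := by
      rw [e1, himg] at m3
      exact (hB'.mem_iff (by omega)).1 (span_image_mono (Set.Ioc_subset_Ioc_left (by omega)) m3)
    rcases max_choice (g (p + 1)) (g' (p + 1)) with h | h <;> rw [← hm] at h <;> omega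
  refine ⟨hc, ?_⟩
  subst hc
  have hshift : ∀ {C : ℤ → W}, (∀ j, C (j + n) = C j) → ∀ j m : ℤ, C (j + n * m) = C j := by
    intro C hC j m
    have := (show Function.Periodic C (n : ℤ) from hC).int_mul m j
    rwa [mul_comm, Int.cast_id] at this
  funext j
  by_cases h1 : (n : ℤ) ∣ j - p
  · obtain ⟨m, hm⟩ := h1
    rw [show j = p + n * m by linarith, hshift hper, hshift hper', e1]
  · by_cases h2 : (n : ℤ) ∣ j - (p + 1)
    · obtain ⟨m, hm⟩ := h2
      rw [show j = p + 1 + n * m by linarith, hshift hper, hshift hper']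
      rw [e1] at e2
      exact add_right_cancel e2
    · have := congrFun heq j
      rwa [bridge_of_not h1 h2, bridge_of_not h1 h2] at this

/-- The inverse of `bridge`. -/
def unbridge (n : ℕ) (p : ℤ) (c : F) (A : ℤ → W) (j : ℤ) : W :=
  if (n : ℤ) ∣ j - p then A (j + 1)
  else if (n : ℤ) ∣ j - (p + 1) then A (j - 1) - c • A j else A j

/-- The parameter is the coefficient of `A (p + 1)` in a relation for `A p`. Subtracting it makes
the new vector at `p + 1` dependent on an interval that does not yet span `A (p + 1)`, so the
strands cross afterwards. -/
theorem exists_unbridge_cross (hn : 2 ≤ n) {A : ℤ → W} (hper : ∀ j, A (j + n) = A j)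
    {f : ℤ → ℤ} (hA : HasPos F f A) (hlt : f p < f (p + 1)) (hloop : f (p + 1) ≠ p + 1)
    (hcoloop : f p ≠ p + n) :
    ∃ c : F, ∀ g : ℤ → ℤ, HasPos F g (unbridge n p c A) → g (p + 1) < g p := by
  have l1 := hA.le p
  have l2 := hA.le_add (by omega) hper p
  have l3 := hA.le (p + 1)
  -- The maximum with `p + 1` covers the case `A p = 0`, so that the position `p + 1` can always be
  -- split off.
  set m := max (f p) (p + 1) with hm
  have hm1 : f p ≤ m := le_max_left _ _
  have hm2 : p + 1 ≤ m := le_max_right _ _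
  have hm3 : m < p + n := by
    rcases max_choice (f p) (p + 1) with h | h <;> rw [hm, h] <;> omega
  have hm4 : m < f (p + 1) := by
    rcases max_choice (f p) (p + 1) with h | h <;> rw [hm, h] <;> omega
  have h1 := (hA.mem_iff (i := p) (j := m) (by omega)).2 hm1
  rw [show Set.Ioc p m = insert (p + 1) (Set.Ioc (p + 1) m) by
    ext x; simp only [Set.mem_Ioc, Set.mem_insert_iff]; omega, span_image_insert] at h1
  obtain ⟨c, z, hz, he⟩ := h1
  refine ⟨c, fun g hg => ?_⟩
  have u1 : unbridge n p c A p = A (p + 1) := if_pos (by simp)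
  have u2 : unbridge n p c A (p + 1) = z := by
    rw [unbridge, if_neg (by rw [add_sub_cancel_left]; exact two_le_not_dvd_one hn),
      if_pos (by simp), add_sub_cancel_right, he, add_sub_cancel_left]
  have himg : unbridge n p c A '' Set.Ioc (p + 1) m = A '' Set.Ioc (p + 1) m :=
    Set.image_congr fun j hj => by
      rw [Set.mem_Ioc] at hj
      rw [unbridge, if_neg (not_dvd_of_lt (by omega) (by omega)),
        if_neg (not_dvd_of_lt (by omega) (by omega))]
  have g1 : g (p + 1) ≤ m := (hg.mem_iff hm2).1 (by rw [himg, u2]; exact hz)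
  refine lt_of_le_of_lt g1 (not_le.1 fun h => ?_)
  have h2 := (hg.mem_iff (i := p) (by omega)).2 h
  rw [show Set.Ioc p m = insert (p + 1) (Set.Ioc (p + 1) m) by
    ext x; simp only [Set.mem_Ioc, Set.mem_insert_iff]; omega, span_image_insert, himg, u1, u2] at h2
  obtain ⟨x, y, hy, he2⟩ := h2
  have h3 : A (p + 1) ∈ Submodule.span F (A '' Set.Ioc (p + 1) m) := by
    rw [he2]
    exact Submodule.add_mem _ (Submodule.smul_mem _ _ hz) hy
  have := (hA.mem_iff hm2).1 h3
  omega

theorem bridge_unbridge (hn : 2 ≤ n) (A : ℤ → W) :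
    bridge n p c (unbridge n p c A) = A := by
  have hnd := two_le_not_dvd_one hn
  funext j
  by_cases h : (n : ℤ) ∣ j - p
  · have h1 : (n : ℤ) ∣ j + 1 - (p + 1) := by rwa [add_sub_add_right_eq_sub]
    have h2 : ¬ (n : ℤ) ∣ j + 1 - p := fun h' => hnd (by
      have := dvd_sub h' h; rwa [show j + 1 - p - (j - p) = 1 by ring] at this)
    rw [bridge_of_dvd h, unbridge, unbridge, if_neg h2, if_pos h1, if_pos h, add_sub_cancel_right,
      sub_add_cancel]
  · by_cases h' : (n : ℤ) ∣ j - (p + 1)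
    · rw [bridge_of_dvd_succ hn h', unbridge, if_pos (by
        rwa [show j - 1 - p = j - (p + 1) by ring]), sub_add_cancel]
    · rw [bridge_of_not h h', unbridge, if_neg h, if_neg h']

end Bridge

end PositroidCatalan

namespace PositroidCatalan

/-! ### Counting matrices with a given bounded affine permutation -/

theorem intCast_eq_intCast_iff_dvd {n : ℕ} {i j : ℤ} :
    (i : ZMod n) = (j : ZMod n) ↔ (n : ℤ) ∣ i - j := by
  rw [eq_comm, ZMod.intCast_eq_intCast_iff_dvd_sub]

/-- An injective `n`-periodic map is injective on the finitely many residues, hence surjective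
there. -/
theorem exists_perm_of_injective {n : ℕ} (hn : 0 < n) {g : ℤ → ℤ} (hinj : Function.Injective g)
    (hper : ∀ j, g (j + n) = g j + n) : ∃ G ∈ affinePerms n, (G : ℤ → ℤ) = g := by
  have : NeZero n := ⟨hn.ne'⟩
  have hdvd : ∀ i j : ℤ, (n : ℤ) ∣ g i - g j → (n : ℤ) ∣ i - j := by
    rintro i j ⟨m, hm⟩
    refine ⟨m, ?_⟩
    have h1 : g i = g (j + n * m) := by rw [map_add_mul hper]; linarith
    have := hinj h1
    linarith
  have hsurj : Function.Surjective (fun x : ZMod n => ((g (x.cast : ℤ) : ℤ) : ZMod n)) := by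
    apply Finite.surjective_of_injective
    intro x y hxy
    have h1 := hdvd _ _ (intCast_eq_intCast_iff_dvd.1 hxy)
    have h2 := intCast_eq_intCast_iff_dvd.2 h1
    simpa using h2
  have hbij : Function.Bijective g := by
    refine ⟨hinj, fun y => ?_⟩
    obtain ⟨x, hx⟩ := hsurj (y : ZMod n)
    obtain ⟨m, hm⟩ := intCast_eq_intCast_iff_dvd.1 hx
    refine ⟨(x.cast : ℤ) + n * (-m), ?_⟩
    rw [map_add_mul hper]
    linarith
  exact ⟨Equiv.ofBijective g hbij, hper, rfl⟩

section Matrix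

variable {n k : ℕ} {F : Type} [Field F]

/-- The periodic sequence of columns of a matrix. -/
def colSeq (A : Matrix (Fin k) (ZMod n) F) (j : ℤ) : Fin k → F := A.col (j : ZMod n)

omit [Field F] in
theorem colSeq_periodic (A : Matrix (Fin k) (ZMod n) F) (j : ℤ) :
    colSeq A (j + n) = colSeq A j := by
  simp [colSeq]

omit [Field F] in
theorem colSeq_injective :
    Function.Injective (colSeq : Matrix (Fin k) (ZMod n) F → ℤ → Fin k → F) := by
  intro A B h
  ext r x
  obtain ⟨j, rfl⟩ := ZMod.intCast_surjective x
  exact congrFun (congrFun h j) r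

/-- The matrices of full rank with bounded affine permutation `f`. -/
def matSet (n k : ℕ) (F : Type) [Field F] (f : ℤ → ℤ) : Set (Matrix (Fin k) (ZMod n) F) :=
  {A | LinearIndependent F A.row ∧ HasPos F f (colSeq A)}

/-- The action of `bridge` on row vectors. -/
def bridgeLin (n : ℕ) (p : ℤ) (c : F) : (ZMod n → F) →ₗ[F] (ZMod n → F) :=
  LinearMap.pi fun x =>
    if x = (p : ZMod n) then LinearMap.proj (x + 1) + c • LinearMap.proj x
    else if x = ((p + 1 : ℤ) : ZMod n) then LinearMap.proj (x - 1) else LinearMap.proj x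

theorem bridgeLin_apply (p : ℤ) (c : F) (y : ZMod n → F) (j : ℤ) :
    bridgeLin n p c y (j : ZMod n) = bridge n p c (fun i : ℤ => y (i : ZMod n)) j := by
  unfold bridgeLin bridge
  simp only [LinearMap.pi_apply, intCast_eq_intCast_iff_dvd]
  split_ifs <;> simp

/-- The action of `unbridge` on row vectors. -/
def unbridgeRow (n : ℕ) (p : ℤ) (c : F) (y : ZMod n → F) (x : ZMod n) : F :=
  if x = (p : ZMod n) then y (x + 1)
  else if x = ((p + 1 : ℤ) : ZMod n) then y (x - 1) - c * y x else y x

theorem unbridgeRow_apply (p : ℤ) (c : F) (y : ZMod n → F) (j : ℤ) :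
    unbridgeRow n p c y (j : ZMod n) = unbridge n p c (fun i : ℤ => y (i : ZMod n)) j := by
  unfold unbridgeRow unbridge
  simp only [intCast_eq_intCast_iff_dvd]
  split_ifs <;> simp

theorem bridgeLin_unbridgeRow (hn : 2 ≤ n) (p : ℤ) (c : F) (y : ZMod n → F) :
    bridgeLin n p c (unbridgeRow n p c y) = y := by
  funext x
  obtain ⟨j, rfl⟩ := ZMod.intCast_surjective x
  rw [bridgeLin_apply]
  simp only [unbridgeRow_apply]
  rw [bridge_unbridge hn]

theorem bridgeLin_ker (hn : 2 ≤ n) (p : ℤ) (c : F) : LinearMap.ker (bridgeLin n p c) = ⊥ := by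
  have : NeZero n := ⟨by omega⟩
  rw [LinearMap.ker_eq_bot]
  exact LinearMap.injective_iff_surjective.2 fun y => ⟨_, bridgeLin_unbridgeRow hn p c y⟩

/-- The action of `bridge` on matrices. -/
def bridgeMat (p : ℤ) (c : F) (A : Matrix (Fin k) (ZMod n) F) : Matrix (Fin k) (ZMod n) F :=
  Matrix.of fun r => bridgeLin n p c (A.row r)

theorem colSeq_bridgeMat (p : ℤ) (c : F) (A : Matrix (Fin k) (ZMod n) F) :
    colSeq (bridgeMat p c A) = bridge n p c (colSeq A) := by
  funext j r
  change bridgeLin n p c (A.row r) (j : ZMod n) = _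
  rw [bridgeLin_apply]
  unfold bridge
  split_ifs <;> simp [colSeq, Matrix.row, Matrix.col]

theorem linearIndependent_bridgeMat (hn : 2 ≤ n) (p : ℤ) (c : F)
    (A : Matrix (Fin k) (ZMod n) F) :
    LinearIndependent F (bridgeMat p c A).row ↔ LinearIndependent F A.row :=
  LinearMap.linearIndependent_iff (v := A.row) (bridgeLin n p c) (bridgeLin_ker hn p c)

/-- The action of `unbridge` on matrices. -/
def unbridgeMat (p : ℤ) (c : F) (A : Matrix (Fin k) (ZMod n) F) : Matrix (Fin k) (ZMod n) F :=
  Matrix.of fun r => unbridgeRow n p c (A.row r)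

theorem colSeq_unbridgeMat (p : ℤ) (c : F) (A : Matrix (Fin k) (ZMod n) F) :
    colSeq (unbridgeMat p c A) = unbridge n p c (colSeq A) := by
  funext j r
  change unbridgeRow n p c (A.row r) (j : ZMod n) = _
  rw [unbridgeRow_apply]
  unfold unbridge
  split_ifs <;> simp [colSeq, Matrix.row, Matrix.col]

theorem bridgeMat_unbridgeMat (hn : 2 ≤ n) (p : ℤ) (c : F) (A : Matrix (Fin k) (ZMod n) F) :
    bridgeMat p c (unbridgeMat p c A) = A := by
  ext r x
  exact congrFun (bridgeLin_unbridgeRow hn p c (A.row r)) x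

/-- Every matrix without crossing of the outgoing strands at two adjacent positions comes from a
unique matrix with such a crossing. -/
theorem exists_bridgeMat_eq (hn : 2 ≤ n) {f : Equiv.Perm ℤ} {p : ℤ}
    (hlt : f p < f (p + 1)) (hlt' : affineSwap hn p (f p) < affineSwap hn p (f (p + 1)))
    {A : Matrix (Fin k) (ZMod n) F} (hA : A ∈ matSet n k F f) :
    ∃ B c, bridgeMat p c B = A ∧ (B ∈ matSet n k F (affineSwap hn p * f * affineSwap hn p : Equiv.Perm ℤ) ∨
      B ∈ matSet n k F (f * affineSwap hn p : Equiv.Perm ℤ)) := by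
  have hpos := hA.2
  have hper := colSeq_periodic A
  have l1 := hpos.le p
  have l2 := hpos.le_add (by omega) hper (p + 1)
  -- A zero column at `p + 1`, or the value `p + n` at `p`, would force the neighboring strand to be
  -- fixed modulo `n` as well; `hlt'` excludes exactly this.
  obtain ⟨c, hc⟩ := exists_unbridge_cross hn hper hpos hlt (fun h => by
      have h1 : f p = p := by omega
      rw [h1, h, affineSwap_self, affineSwap_succ] at hlt'
      omega) (fun h => by
      have h1 : f (p + 1) = p + 1 + n := by omega
      rw [h1, h, affineSwap_mem, affineSwap_mem, affineSwap_self, affineSwap_succ] at hlt'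
      omega)
  rw [← colSeq_unbridgeMat] at hc
  have hbr := bridgeMat_unbridgeMat hn p c A
  refine ⟨unbridgeMat p c A, c, hbr, ?_⟩
  set B := unbridgeMat p c A with hB
  obtain ⟨g0, hg0⟩ := exists_hasPos F (by omega : 0 < n) (colSeq_periodic B)
  obtain ⟨g, hg, rfl⟩ := exists_perm_of_injective (by omega) hg0.injective
    (hg0.add_period (colSeq_periodic B))
  have hrow : LinearIndependent F B.row := by
    rw [← linearIndependent_bridgeMat hn p c, hbr]
    exact hA.1
  have hcross := hc g hg0
  have hor := bridge_hasPos_or (c := c) hn (colSeq_periodic B) hg hg0 (h := f)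
    (by rw [← colSeq_bridgeMat, hbr]; exact hpos) hcross
  have hG : g * affineSwap hn p ∈ affinePerms n := Subgroup.mul_mem _ hg (affineSwap_mem hn p)
  rcases eq_or_eq_swap_mul hn hG f.injective (hpos.add_period hper) hor with ⟨h1, -⟩ | ⟨h1, -⟩
  · right
    have h2 : f = g * affineSwap hn p := Equiv.ext (congrFun h1)
    rw [h2, mul_assoc, affineSwap_mul_self, mul_one]
    exact ⟨hrow, hg0⟩
  · left
    have h2 : f = affineSwap hn p * (g * affineSwap hn p) := Equiv.ext (congrFun h1)
    rw [h2, ← mul_assoc, ← mul_assoc, affineSwap_mul_self, one_mul, mul_assoc,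
      affineSwap_mul_self, mul_one]
    exact ⟨hrow, hg0⟩

theorem natCard_pairs {α β : Type} [Finite α] [Finite β] (M : Set α) (Q : α → β → Prop) (m : ℕ)
    (h : ∀ a ∈ M, Nat.card {b // Q a b} = m) :
    Nat.card {x : α × β // x.1 ∈ M ∧ Q x.1 x.2} = Nat.card M * m := by
  have e : {x : α × β // x.1 ∈ M ∧ Q x.1 x.2} ≃ Σ a : M, {b // Q a.1 b} :=
    { toFun := fun x => ⟨⟨x.1.1, x.2.1⟩, ⟨x.1.2, x.2.2⟩⟩
      invFun := fun y => ⟨(y.1.1, y.2.1), y.1.2, y.2.2⟩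
      left_inv := fun _ => rfl
      right_inv := fun _ => rfl }
  have := Fintype.ofFinite M
  rw [Nat.card_congr e, Nat.card_sigma, Finset.sum_congr rfl fun a _ => h a.1 a.2,
    Finset.sum_const, smul_eq_mul, Finset.card_univ, Nat.card_eq_fintype_card]

/-- The bridge is a bijection from pairs of a crossed matrix and a parameter onto `M_f`, and the
crossed matrices are of two disjoint types; only the number of admissible parameters per type
remains to be found. -/
theorem natCard_matSet_eq_add (hn : 2 ≤ n) [Finite F] {f : Equiv.Perm ℤ}
    {p : ℤ} (hlt : f p < f (p + 1))
    (hlt' : affineSwap hn p (f p) < affineSwap hn p (f (p + 1))) {m₁ m₂ : ℕ}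
    (h1 : ∀ B ∈ matSet n k F (affineSwap hn p * f * affineSwap hn p : Equiv.Perm ℤ),
      Nat.card {c : F // bridgeMat p c B ∈ matSet n k F f} = m₁)
    (h2 : ∀ B ∈ matSet n k F (f * affineSwap hn p : Equiv.Perm ℤ),
      Nat.card {c : F // bridgeMat p c B ∈ matSet n k F f} = m₂) :
    Nat.card (matSet n k F f) =
      Nat.card (matSet n k F (affineSwap hn p * f * affineSwap hn p : Equiv.Perm ℤ)) * m₁ +
      Nat.card (matSet n k F (f * affineSwap hn p : Equiv.Perm ℤ)) * m₂ := by
  have : NeZero n := ⟨by omega⟩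
  set M₁ := matSet n k F (affineSwap hn p * f * affineSwap hn p : Equiv.Perm ℤ) with hM₁
  set M₂ := matSet n k F (f * affineSwap hn p : Equiv.Perm ℤ) with hM₂
  rw [← natCard_pairs M₁ (fun B c => bridgeMat p c B ∈ matSet n k F f) m₁ h1,
    ← natCard_pairs M₂ (fun B c => bridgeMat p c B ∈ matSet n k F f) m₂ h2, ← Nat.card_sum]
  have hcross1 : (affineSwap hn p * f * affineSwap hn p) (p + 1) <
      (affineSwap hn p * f * affineSwap hn p) p := by
    simpa [Equiv.Perm.mul_apply, affineSwap_self, affineSwap_succ] using hlt'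
  have hcross2 : (f * affineSwap hn p) (p + 1) < (f * affineSwap hn p) p := by
    simpa [Equiv.Perm.mul_apply, affineSwap_self, affineSwap_succ] using hlt
  have hinj : ∀ {g g' : Equiv.Perm ℤ} {B B' : Matrix (Fin k) (ZMod n) F} {c c' : F},
      g (p + 1) < g p → g' (p + 1) < g' p → B ∈ matSet n k F g → B' ∈ matSet n k F g' →
      bridgeMat p c B = bridgeMat p c' B' → B = B' ∧ c = c' := by
    intro g g' B B' c c' hg hg' hB hB' h
    have h3 := bridge_injective hn hB.2 hB'.2 hg hg' (colSeq_periodic B) (colSeq_periodic B')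
      (by rw [← colSeq_bridgeMat, ← colSeq_bridgeMat, h])
    exact ⟨colSeq_injective h3.2, h3.1⟩
  have hne : ∀ {B}, B ∈ M₁ → B ∈ M₂ → False := fun {B} hB hB' => by
    have h3 := congrFun (hB.2.ext hB'.2) (p + 1)
    rw [Equiv.Perm.mul_apply, Equiv.Perm.mul_apply, Equiv.Perm.mul_apply, affineSwap_succ] at h3
    rcases affineSwap_cases hn p (f p) with ⟨a, b⟩ | ⟨a, b⟩ | ⟨a, a', b⟩
    · omega
    · omega
    · have h4 := congrFun (hB.2.ext hB'.2) p
      rw [Equiv.Perm.mul_apply, Equiv.Perm.mul_apply, Equiv.Perm.mul_apply, affineSwap_self] at h4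
      have h5 : affineSwap hn p * f * affineSwap hn p = f * affineSwap hn p :=
        Equiv.ext (congrFun (hB.2.ext hB'.2))
      rw [mul_assoc, mul_eq_right] at h5
      have h6 := affineSwap_self hn p
      rw [h5] at h6
      simp at h6
  symm
  refine Nat.card_congr (Equiv.ofBijective
    (Sum.elim (fun x => ⟨bridgeMat p x.1.2 x.1.1, x.2.2⟩)
      (fun x => ⟨bridgeMat p x.1.2 x.1.1, x.2.2⟩)) ⟨?_, ?_⟩)
  · rintro (⟨⟨B, c⟩, hB, hc⟩ | ⟨⟨B, c⟩, hB, hc⟩) (⟨⟨B', c'⟩, hB', hc'⟩ | ⟨⟨B', c'⟩, hB', hc'⟩) h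
    · obtain ⟨rfl, rfl⟩ := hinj hcross1 hcross1 hB hB' (Subtype.ext_iff.1 h)
      rfl
    · obtain ⟨rfl, rfl⟩ := hinj hcross1 hcross2 hB hB' (Subtype.ext_iff.1 h)
      exact (hne hB hB').elim
    · obtain ⟨rfl, rfl⟩ := hinj hcross2 hcross1 hB hB' (Subtype.ext_iff.1 h)
      exact (hne hB' hB).elim
    · obtain ⟨rfl, rfl⟩ := hinj hcross2 hcross2 hB hB' (Subtype.ext_iff.1 h)
      rfl
  · rintro ⟨A, hA⟩
    obtain ⟨B, c, rfl, hB | hB⟩ := exists_bridgeMat_eq hn hlt hlt' hA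
    · exact ⟨Sum.inl ⟨(B, c), hB, hA⟩, rfl⟩
    · exact ⟨Sum.inr ⟨(B, c), hB, hA⟩, rfl⟩

theorem affineSwap_mul_ne (hn : 2 ≤ n) (p : ℤ) (f : Equiv.Perm ℤ) : affineSwap hn p * f ≠ f :=
  fun h => by
    rw [mul_eq_right] at h
    have h6 := affineSwap_self hn p
    rw [h] at h6
    simp at h6

theorem bridgeMat_mem_matSet_iff (hn : 2 ≤ n) {f g : Equiv.Perm ℤ} {p : ℤ} {c : F}
    {B : Matrix (Fin k) (ZMod n) F} (hB : B ∈ matSet n k F g)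
    (hpos : HasPos F f (bridge n p c (colSeq B))) (f' : Equiv.Perm ℤ) :
    bridgeMat p c B ∈ matSet n k F f' ↔ f = f' := by
  have hrow := (linearIndependent_bridgeMat hn p c B).2 hB.1
  rw [← colSeq_bridgeMat] at hpos
  constructor
  · rintro ⟨-, h⟩
    exact Equiv.ext (congrFun (hpos.ext h))
  · rintro rfl
    exact ⟨hrow, hpos⟩

/-- The number of matrices when the strands at two adjacent positions do not cross. -/
theorem natCard_matSet_of_lt (hn : 2 ≤ n) [Finite F] {f : Equiv.Perm ℤ} (hf : f ∈ affinePerms n)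
    {p : ℤ} (hlt : f p < f (p + 1))
    (hlt' : affineSwap hn p (f p) < affineSwap hn p (f (p + 1)))
    (hinv : affineSwap hn p (f⁻¹ p) < affineSwap hn p (f⁻¹ (p + 1))) :
    Nat.card (matSet n k F f) =
      Nat.card (matSet n k F (affineSwap hn p * f * affineSwap hn p : Equiv.Perm ℤ)) * Nat.card F +
      Nat.card (matSet n k F (f * affineSwap hn p : Equiv.Perm ℤ)) * (Nat.card F - 1) := by
  have hs := affineSwap_mem hn p
  refine natCard_matSet_eq_add hn hlt hlt' (fun B hB => ?_) (fun B hB => ?_)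
  · have key : ∀ c, bridgeMat p c B ∈ matSet n k F f := fun c => by
      have h1 := bridge_hasPos_of_gt (c := c) (p := p) hn (colSeq_periodic B)
        (Subgroup.mul_mem _ (Subgroup.mul_mem _ hs hf) hs) hB.2
        (by simpa [Equiv.Perm.mul_apply, affineSwap_self, affineSwap_succ] using hlt')
        (by simpa [Equiv.Perm.mul_apply, affineSwap_self, affineSwap_succ, affineSwap_inv,
          mul_inv_rev] using hinv)
      rw [bridgeMat_mem_matSet_iff hn hB h1, mul_assoc, mul_assoc, affineSwap_mul_self, mul_one,
        ← mul_assoc, affineSwap_mul_self, one_mul]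
    exact Nat.card_congr (Equiv.subtypeUnivEquiv key)
  · have hinv' : (f * affineSwap hn p)⁻¹ p < (f * affineSwap hn p)⁻¹ (p + 1) := by
      simpa [Equiv.Perm.mul_apply, affineSwap_inv, mul_inv_rev] using hinv
    have hcr : (f * affineSwap hn p) (p + 1) < (f * affineSwap hn p) p := by
      simpa [Equiv.Perm.mul_apply, affineSwap_self, affineSwap_succ] using hlt
    obtain ⟨c₀, hc₀, huniq⟩ := existsUnique_bridge_param hB.2 hcr hinv'
    -- The exceptional parameter moves the incoming strands too and yields `s f` instead of `f`; all
    -- others yield `f`.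
    have key : ∀ c, bridgeMat p c B ∈ matSet n k F f ↔ c ≠ c₀ := fun c => by
      rcases bridge_hasPos_of_lt (c := c) hn (colSeq_periodic B) (Subgroup.mul_mem _ hf hs) hB.2
        hcr hinv' with ⟨h1, h2⟩ | ⟨h1, h2⟩
      · rw [bridgeMat_mem_matSet_iff hn hB h1, mul_assoc, mul_assoc, affineSwap_mul_self, mul_one]
        exact ⟨fun h => (affineSwap_mul_ne hn p f h).elim, fun h => (h (huniq c h2)).elim⟩
      · rw [bridgeMat_mem_matSet_iff hn hB h1, mul_assoc, affineSwap_mul_self, mul_one]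
        exact ⟨fun _ h => h2 (h ▸ hc₀), fun _ => rfl⟩
    classical
    have := Fintype.ofFinite F
    rw [Nat.card_congr (Equiv.subtypeEquivRight key), Nat.card_eq_fintype_card,
      Nat.card_eq_fintype_card, Fintype.card_subtype_compl, Fintype.card_subtype_eq]

/-- The number of matrices when only the incoming strands at two adjacent positions cross. -/
theorem natCard_matSet_of_gt (hn : 2 ≤ n) [Finite F] {f : Equiv.Perm ℤ} (hf : f ∈ affinePerms n)
    {p : ℤ} (hlt : f p < f (p + 1))
    (hlt' : affineSwap hn p (f p) < affineSwap hn p (f (p + 1)))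
    (hinv : affineSwap hn p (f⁻¹ (p + 1)) < affineSwap hn p (f⁻¹ p)) :
    Nat.card (matSet n k F f) =
      Nat.card (matSet n k F (affineSwap hn p * f * affineSwap hn p : Equiv.Perm ℤ)) := by
  have hs := affineSwap_mem hn p
  have main := natCard_matSet_eq_add (k := k) (F := F) hn hlt hlt' (m₁ := 1) (m₂ := 0)
    (fun B hB => ?_) (fun B hB => ?_)
  · rw [main, mul_one, mul_zero, add_zero]
  · have hinv' : (affineSwap hn p * f * affineSwap hn p)⁻¹ p <
        (affineSwap hn p * f * affineSwap hn p)⁻¹ (p + 1) := by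
      simpa [Equiv.Perm.mul_apply, affineSwap_self, affineSwap_succ, affineSwap_inv,
          mul_inv_rev] using hinv
    have hcr : (affineSwap hn p * f * affineSwap hn p) (p + 1) <
        (affineSwap hn p * f * affineSwap hn p) p := by
      simpa [Equiv.Perm.mul_apply, affineSwap_self, affineSwap_succ] using hlt'
    obtain ⟨c₀, hc₀, huniq⟩ := existsUnique_bridge_param hB.2 hcr hinv'
    -- Here the roles are reversed: only the exceptional parameter moves both pairs of strands,
    -- which is what leads from `s f s` to `f`.
    have key : ∀ c, bridgeMat p c B ∈ matSet n k F f ↔ c = c₀ := fun c => by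
      rcases bridge_hasPos_of_lt (c := c) hn (colSeq_periodic B)
        (Subgroup.mul_mem _ (Subgroup.mul_mem _ hs hf) hs) hB.2
        hcr hinv' with ⟨h1, h2⟩ | ⟨h1, h2⟩
      · rw [bridgeMat_mem_matSet_iff hn hB h1, mul_assoc, mul_assoc, affineSwap_mul_self, mul_one,
          ← mul_assoc, affineSwap_mul_self, one_mul]
        exact ⟨fun _ => huniq c h2, fun _ => rfl⟩
      · rw [bridgeMat_mem_matSet_iff hn hB h1, mul_assoc, affineSwap_mul_self, mul_one]
        exact ⟨fun h => (affineSwap_mul_ne hn p f h).elim, fun h => (h2 (h ▸ hc₀)).elim⟩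
    rw [Nat.card_congr (Equiv.subtypeEquivRight key)]
    exact Nat.card_unique
  · have key : ∀ c, ¬ bridgeMat p c B ∈ matSet n k F f := fun c => by
      have h1 := bridge_hasPos_of_gt (c := c) (p := p) hn (colSeq_periodic B)
        (Subgroup.mul_mem _ hf hs) hB.2
        (by simpa [Equiv.Perm.mul_apply, affineSwap_self, affineSwap_succ] using hlt)
        (by simpa [Equiv.Perm.mul_apply, affineSwap_self, affineSwap_succ, affineSwap_inv,
          mul_inv_rev] using hinv)
      rw [bridgeMat_mem_matSet_iff hn hB h1, mul_assoc, mul_assoc, affineSwap_mul_self, mul_one]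
      exact affineSwap_mul_ne hn p f
    have : IsEmpty {c : F // bridgeMat p c B ∈ matSet n k F f} := ⟨fun c => key c.1 c.2⟩
    exact Nat.card_of_isEmpty

theorem natCard_matSet_of_not_bounded (hn : 0 < n) {f : Equiv.Perm ℤ}
    (h : ¬ ∀ j, j ≤ f j ∧ f j ≤ j + n) : Nat.card (matSet n k F f) = 0 := by
  have : IsEmpty (matSet n k F f) :=
    ⟨fun A => h fun j => ⟨A.2.2.le j, A.2.2.le_add hn (colSeq_periodic A.1) j⟩⟩
  exact Nat.card_of_isEmpty

end Matrix

end PositroidCatalan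

namespace PositroidCatalan

/-! ### The affine permutation of a pair of permutations -/

section Pair

variable {n k : ℕ}

/-- The extension of a permutation of `Fin n` to `ℕ` by fixed points. -/
def permExt (u : Equiv.Perm (Fin n)) : Equiv.Perm ℕ := u.extendDomain Fin.equivSubtype

theorem permExt_apply (u : Equiv.Perm (Fin n)) (i : Fin n) : permExt u (i : ℕ) = u i :=
  Equiv.Perm.extendDomain_apply_image u Fin.equivSubtype i

theorem permExt_of_le (u : Equiv.Perm (Fin n)) {p : ℕ} (hp : n ≤ p) : permExt u p = p :=
  Equiv.Perm.extendDomain_apply_not_subtype u Fin.equivSubtype (not_lt.2 hp)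

theorem permExt_mul (u v : Equiv.Perm (Fin n)) : permExt (u * v) = permExt u * permExt v :=
  (Equiv.Perm.extendDomain_mul Fin.equivSubtype u v).symm

theorem permExt_one : permExt (1 : Equiv.Perm (Fin n)) = 1 :=
  Equiv.Perm.extendDomain_one Fin.equivSubtype

theorem permExt_injective : Function.Injective (permExt : Equiv.Perm (Fin n) → Equiv.Perm ℕ) :=
  Equiv.Perm.extendDomainHom_injective Fin.equivSubtype

theorem permExt_swap (i j : Fin n) : permExt (Equiv.swap i j) = Equiv.swap (i : ℕ) (j : ℕ) := by
  ext p
  rcases lt_or_ge p n with hp | hp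
  · have := permExt_apply (Equiv.swap i j) ⟨p, hp⟩
    rw [show ((⟨p, hp⟩ : Fin n) : ℕ) = p from rfl] at this
    rw [this, Equiv.swap_apply_def, Equiv.swap_apply_def]
    simp only [Fin.ext_iff]
    split_ifs <;> rfl
  · rw [permExt_of_le _ hp, Equiv.swap_apply_of_ne_of_ne] <;> omega

/-- The exits list, for each position, the path leaving there, so they give the inverse of the path
permutation; this is the reason for `v⁻¹` as the target order below. -/
theorem hasPathPerm_iff {lam : YoungDiagram} {D : Finset (ℕ × ℕ)} (hkn : k ≤ n)
    (hlam : FitsIn lam k (n - k)) (u : Equiv.Perm (Fin n)) :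
    HasPathPerm k lam D u ↔ ∀ p, exitLabel k lam D p = permExt u⁻¹ p := by
  constructor
  · intro h p
    rcases lt_or_ge p n with hp | hp
    · have h1 := h (u⁻¹ ⟨p, hp⟩)
      have h2 := permExt_apply u⁻¹ ⟨p, hp⟩
      rw [show u (u⁻¹ ⟨p, hp⟩) = ⟨p, hp⟩ from u.apply_symm_apply _] at h1
      exact h1.trans h2.symm
    · rw [permExt_of_le _ hp, exitLabel_of_le hlam (by omega)]
  · intro h i
    rw [h, permExt_apply, show u⁻¹ (u i) = i from u.symm_apply_apply i]

/-- The integer in position `i` of the `m`-th period. -/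
def coordEquiv (n : ℕ) [NeZero n] : ℤ × Fin n ≃ ℤ :=
  (Int.divModEquiv n).symm.trans (Equiv.addRight 1)

theorem coordEquiv_apply [NeZero n] (m : ℤ) (i : Fin n) :
    coordEquiv n (m, i) = (i : ℤ) + 1 + n * m := by
  change m * n + (i : ℤ) + 1 = _
  ring

theorem exists_coord (n : ℕ) [NeZero n] (j : ℤ) : ∃ (m : ℤ) (i : Fin n),
    j = (i : ℤ) + 1 + n * m := by
  obtain ⟨⟨m, i⟩, h⟩ := (coordEquiv n).surjective j
  exact ⟨m, i, by rw [← h, coordEquiv_apply]⟩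

theorem coord_inj [NeZero n] {m m' : ℤ} {i i' : Fin n}
    (h : (i : ℤ) + 1 + n * m = (i' : ℤ) + 1 + n * m') : i = i' ∧ m = m' := by
  rw [← coordEquiv_apply, ← coordEquiv_apply] at h
  have := (coordEquiv n).injective h
  rw [Prod.mk.injEq] at this
  exact ⟨this.2, this.1⟩

/-- The affine permutation `f_{v,w}`: first `w`, then the translation by `n` of the first `k`
positions, and then `v⁻¹`. -/
def pairPerm [NeZero n] (k : ℕ) (v w : Equiv.Perm (Fin n)) : Equiv.Perm ℤ :=
  (coordEquiv n).permCongr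
    { toFun := fun x => (x.1 + (if (w x.2 : ℕ) < k then 1 else 0), v.symm (w x.2))
      invFun := fun x => (x.1 - (if (v x.2 : ℕ) < k then 1 else 0), w.symm (v x.2))
      left_inv := fun x => by simp
      right_inv := fun x => by simp }

theorem pairPerm_apply [NeZero n] (v w : Equiv.Perm (Fin n)) (m : ℤ) (i : Fin n) :
    pairPerm k v w ((i : ℤ) + 1 + n * m) =
      (v.symm (w i) : ℤ) + 1 + n * (m + (if (w i : ℕ) < k then 1 else 0)) := by
  rw [← coordEquiv_apply, ← coordEquiv_apply]
  simp [pairPerm, Equiv.permCongr_apply]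

theorem pairPerm_inv_apply [NeZero n] (v w : Equiv.Perm (Fin n)) (m : ℤ) (i : Fin n) :
    (pairPerm k v w)⁻¹ ((i : ℤ) + 1 + n * m) =
      (w.symm (v i) : ℤ) + 1 + n * (m - (if (v i : ℕ) < k then 1 else 0)) := by
  rw [Equiv.Perm.inv_eq_iff_eq, pairPerm_apply]
  simp

theorem pairPerm_mem [NeZero n] (v w : Equiv.Perm (Fin n)) : pairPerm k v w ∈ affinePerms n := by
  intro j
  obtain ⟨m, i, rfl⟩ := exists_coord n j
  rw [show (i : ℤ) + 1 + n * m + n = (i : ℤ) + 1 + n * (m + 1) by ring, pairPerm_apply,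
    pairPerm_apply]
  ring

theorem affineSwap_coord [NeZero n] (hn : 2 ≤ n) {a b : Fin n} (hab : (b : ℕ) = a + 1) (m : ℤ)
    (i : Fin n) : affineSwap hn ((a : ℤ) + 1) ((i : ℤ) + 1 + n * m) =
      (Equiv.swap a b i : Fin n) + 1 + n * m := by
  have hdvd : ∀ x y : Fin n, (n : ℤ) ∣ (x : ℤ) - y → x = y := by
    rintro x y h
    have hx := x.2
    have hy := y.2
    by_contra hne
    rcases lt_or_gt_of_ne (fun h' => hne (Fin.ext h') : (x : ℕ) ≠ y) with h1 | h1
    · rw [← dvd_neg] at h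
      exact not_dvd_of_lt (by omega) (by omega) h
    · exact not_dvd_of_lt (by omega) (by omega) h
  have e1 : (n : ℤ) ∣ (i : ℤ) + 1 + n * m - ((a : ℤ) + 1) ↔ i = a := by
    rw [show (i : ℤ) + 1 + n * m - ((a : ℤ) + 1) = (i : ℤ) - a + n * m by ring,
      dvd_add_left (dvd_mul_right _ _)]
    exact ⟨hdvd i a, by rintro rfl; simp⟩
  have e2 : (n : ℤ) ∣ (i : ℤ) + 1 + n * m - ((a : ℤ) + 1 + 1) ↔ i = b := by
    rw [show (i : ℤ) + 1 + n * m - ((a : ℤ) + 1 + 1) = (i : ℤ) - (b : ℕ) + n * m by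
      rw [hab]; push_cast; ring, dvd_add_left (dvd_mul_right _ _)]
    exact ⟨hdvd i b, by rintro rfl; simp⟩
  rw [affineSwap_apply, affineSwapFun, Equiv.swap_apply_def]
  simp only [e1, e2]
  split_ifs with h1 h2
  · rw [h1, hab]; push_cast; ring
  · rw [h2, hab]; push_cast; ring
  · rfl

theorem pairPerm_mul_swap [NeZero n] (hn : 2 ≤ n) {a b : Fin n} (hab : (b : ℕ) = a + 1)
    (v w : Equiv.Perm (Fin n)) :
    pairPerm k v (w * Equiv.swap a b) = pairPerm k v w * affineSwap hn ((a : ℤ) + 1) := by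
  ext j
  obtain ⟨m, i, rfl⟩ := exists_coord n j
  rw [Equiv.Perm.mul_apply, affineSwap_coord hn hab, pairPerm_apply, pairPerm_apply,
    Equiv.Perm.mul_apply]

theorem pairPerm_swap_mul_swap [NeZero n] (hn : 2 ≤ n) {a b : Fin n} (hab : (b : ℕ) = a + 1)
    (v w : Equiv.Perm (Fin n)) :
    pairPerm k (v * Equiv.swap a b) (w * Equiv.swap a b) =
      affineSwap hn ((a : ℤ) + 1) * pairPerm k v w * affineSwap hn ((a : ℤ) + 1) := by
  ext j
  obtain ⟨m, i, rfl⟩ := exists_coord n j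
  have h : ∀ x, (v * Equiv.swap a b).symm x = Equiv.swap a b (v.symm x) := fun x => by
    rw [Equiv.symm_apply_eq]; simp
  rw [Equiv.Perm.mul_apply, Equiv.Perm.mul_apply, affineSwap_coord hn hab, pairPerm_apply,
    pairPerm_apply, Equiv.Perm.mul_apply, affineSwap_coord hn hab, h]

/-! ### The all-crossing filling -/

theorem vertLabel_empty {lam : YoungDiagram} {r c : ℕ} (hc : c ≤ lam.rowLen r) :
    vertLabel k lam ∅ r c = k - 1 - r + lam.rowLen r := by
  obtain ⟨d, hd⟩ := Nat.exists_eq_add_of_le hc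
  induction d generalizing c with
  | zero =>
    rw [vertLabel_of_notMem (by rw [YoungDiagram.mem_iff_lt_rowLen]; omega)]
    omega
  | succ d ih =>
    rw [vertLabel_crossing (YoungDiagram.mem_iff_lt_rowLen.2 (by omega)) (Finset.notMem_empty _)]
    exact ih (by omega) (by omega)

theorem horLabel_empty {lam : YoungDiagram} {r c : ℕ} (hr : r ≤ lam.colLen c) :
    horLabel k lam ∅ r c = k - lam.colLen c + c := by
  obtain ⟨d, hd⟩ := Nat.exists_eq_add_of_le hr
  induction d generalizing r with
  | zero =>
    rw [horLabel_of_notMem (by rw [YoungDiagram.mem_iff_lt_colLen]; omega)]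
    omega
  | succ d ih =>
    rw [horLabel_crossing (YoungDiagram.mem_iff_lt_colLen.2 (by omega)) (Finset.notMem_empty _)]
    exact ih (by omega) (by omega)

theorem exitLabel_empty_of_lt {lam : YoungDiagram} {p : ℕ} (hp : p < k) :
    exitLabel k lam ∅ p = p + lam.rowLen (k - 1 - p) := by
  rw [exitLabel, if_pos hp, vertLabel_empty (Nat.zero_le _)]
  omega

theorem exitLabel_empty_of_le {lam : YoungDiagram} {p : ℕ} (hp : k ≤ p) :
    exitLabel k lam ∅ p = k - lam.colLen (p - k) + (p - k) := by
  rw [exitLabel, if_neg (not_lt.2 hp), horLabel_empty (Nat.zero_le _)]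

theorem FitsIn.row_lt {lam : YoungDiagram} {m : ℕ} (h : FitsIn lam k m) : ∀ x ∈ lam, x.1 < k :=
  fun x hx => (h x.1 x.2 hx).1

theorem isGrassmannian_of_hasPathPerm {lam : YoungDiagram} (hkn : k ≤ n)
    (hlam : FitsIn lam k (n - k)) {w : Equiv.Perm (Fin n)} (hw : HasPathPerm k lam ∅ w) :
    IsGrassmannian k w := by
  rw [hasPathPerm_iff hkn hlam] at hw
  have key : ∀ a : Fin n, ((w.symm a : Fin n) : ℕ) = exitLabel k lam ∅ a := fun a => by
    rw [hw, permExt_apply]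
    rfl
  intro a b hab h
  rw [Fin.lt_def, key, key]
  have hab' : (a : ℕ) < b := hab
  rcases h with h | h
  · rw [exitLabel_empty_of_lt (by omega), exitLabel_empty_of_lt h]
    have := lam.rowLen_anti (k - 1 - b) (k - 1 - a) (by omega)
    omega
  · rw [exitLabel_empty_of_le h, exitLabel_empty_of_le (by omega)]
    have h1 := lam.colLen_anti (a - k) (b - k) (by omega)
    have h2 := colLen_le_of_rows hlam.row_lt (a - k)
    omega

theorem rowLen_of_isCorner {lam : YoungDiagram} {r c : ℕ} (h : IsCorner lam r c) :
    lam.rowLen r = c + 1 := by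
  have h1 := YoungDiagram.mem_iff_lt_rowLen.1 h.1
  have h2 := mt YoungDiagram.mem_iff_lt_rowLen.2 h.2.2
  omega

theorem colLen_of_isCorner {lam : YoungDiagram} {r c : ℕ} (h : IsCorner lam r c) :
    lam.colLen c = r + 1 := by
  have h1 := YoungDiagram.mem_iff_lt_colLen.1 h.1
  have h2 := mt YoungDiagram.mem_iff_lt_colLen.2 h.2.1
  omega

/-- A crossing in a corner exchanges two entrance labels, so removing it multiplies the path
permutation by a simple transposition on the right. -/
theorem hasPathPerm_eraseCorner {lam : YoungDiagram} {r c : ℕ} (hkn : k ≤ n)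
    (hlam : FitsIn lam k (n - k)) (h : IsCorner lam r c) {D : Finset (ℕ × ℕ)} (hD : (r, c) ∉ D)
    {w : Equiv.Perm (Fin n)} {a b : Fin n} (ha : (a : ℕ) = k - 1 - r + c) (hb : (b : ℕ) = a + 1) :
    HasPathPerm k lam D w ↔ HasPathPerm k (eraseCorner h) D (w * Equiv.swap a b) := by
  have hlam' : FitsIn (eraseCorner h) k (n - k) := fun x y hxy =>
    hlam x y ((mem_eraseCorner h).1 hxy).2
  rw [hasPathPerm_iff hkn hlam, hasPathPerm_iff hkn hlam']
  refine forall_congr' fun p => ?_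
  rw [exitLabel_of_crossing_corner hlam.row_lt h hD, mul_inv_rev, Equiv.swap_inv, permExt_mul,
    permExt_swap, hb, ha, Equiv.Perm.mul_apply]
  constructor
  · intro h1
    rw [← h1, Equiv.swap_apply_self]
  · intro h1
    rw [h1, Equiv.swap_apply_self]

theorem eq_one_of_hasPathPerm_bot (hkn : k ≤ n) (hlam : FitsIn ⊥ k (n - k))
    {w : Equiv.Perm (Fin n)} (hw : HasPathPerm k ⊥ ∅ w) : w = 1 := by
  rw [hasPathPerm_iff hkn hlam] at hw
  have h1 : permExt w⁻¹ = permExt (1 : Equiv.Perm (Fin n)) := by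
    rw [permExt_one]
    ext p
    rw [← hw, exitLabel_bot]
    rfl
  exact inv_eq_one.1 (permExt_injective h1)

/-! ### Counting matrices by Deograms -/

variable {F : Type} [Field F]

/-- A permutation can neither move all small elements weakly down nor all large ones weakly up
without fixing them: argue from the two ends. -/
theorem perm_eq_one_of_bounded {u : Equiv.Perm (Fin n)}
    (h1 : ∀ i : Fin n, (i : ℕ) < k → (u i : ℕ) ≤ i) (h2 : ∀ i : Fin n, k ≤ (i : ℕ) → (i : ℕ) ≤ u i) :
    u = 1 := by
  have a1 : ∀ N : ℕ, ∀ i : Fin n, (i : ℕ) = N → N < k → u i = i := by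
    intro N
    induction N using Nat.strong_induction_on with
    | _ N ih =>
      intro i hi hN
      have := h1 i (by omega)
      by_contra hne
      have hlt : (u i : ℕ) < N := lt_of_le_of_ne (hi ▸ this) fun h => hne (Fin.ext (h.trans hi.symm))
      have := ih _ hlt (u i) rfl (by omega)
      exact hne (u.injective this)
  have a2 : ∀ N : ℕ, ∀ i : Fin n, n - (i : ℕ) = N → k ≤ (i : ℕ) → u i = i := by
    intro N
    induction N using Nat.strong_induction_on with
    | _ N ih =>
      intro i hi hk
      have := h2 i hk
      by_contra hne
      have hlt : (i : ℕ) < u i := lt_of_le_of_ne this fun h => hne (Fin.ext h.symm)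
      have hb := (u i).2
      have := ih (n - (u i : ℕ)) (by omega) (u i) rfl (by omega)
      exact hne (u.injective this)
  ext i
  rcases lt_or_ge (i : ℕ) k with h | h
  · rw [a1 _ i rfl h]; rfl
  · rw [a2 _ i rfl h]; rfl

theorem pairPerm_one_one_apply [NeZero n] (m : ℤ) (i : Fin n) :
    pairPerm (n := n) k 1 1 ((i : ℤ) + 1 + n * m) =
      (i : ℤ) + 1 + n * m + (if (i : ℕ) < k then (n : ℤ) else 0) := by
  rw [pairPerm_apply]
  change (i : ℤ) + 1 + n * (m + (if (i : ℕ) < k then 1 else 0)) = _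
  by_cases hi : (i : ℕ) < k
  · rw [if_pos hi, if_pos hi]
    ring
  · rw [if_neg hi, if_neg hi]
    ring

/-- The index of a residue class modulo `n`. -/
def residueIndex [NeZero n] (x : ZMod n) : ℕ := (x - 1).val

theorem residueIndex_coord [NeZero n] (m : ℤ) (i : Fin n) :
    residueIndex ((((i : ℤ) + 1 + n * m : ℤ)) : ZMod n) = i := by
  unfold residueIndex
  push_cast
  rw [ZMod.natCast_self, zero_mul, add_zero, add_sub_cancel_right, ZMod.val_natCast_of_lt i.2]

/-- The matrix with the given square block in the first `k` columns and zeros elsewhere. -/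
def blockMat [NeZero n] (g : Matrix (Fin k) (Fin k) F) : Matrix (Fin k) (ZMod n) F :=
  Matrix.of fun r x => if h : residueIndex x < k then g r ⟨residueIndex x, h⟩ else 0

theorem blockMat_apply_of_lt [NeZero n] (hkn : k ≤ n) (g : Matrix (Fin k) (Fin k) F) (r i : Fin k)
    (m : ℤ) : blockMat g r ((((i : ℕ) : ℤ) + 1 + n * m : ℤ) : ZMod n) = g r i := by
  have h1 := residueIndex_coord (n := n) m ⟨(i : ℕ), i.2.trans_le hkn⟩
  simp only at h1
  change (if h : _ then _ else _) = _
  rw [dif_pos (by rw [h1]; exact i.2)]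
  congr 1
  exact Fin.ext h1

theorem blockMat_apply_of_le [NeZero n] (g : Matrix (Fin k) (Fin k) F) (r : Fin k) {i : Fin n}
    (hi : k ≤ (i : ℕ)) (m : ℤ) : blockMat g r (((i : ℤ) + 1 + n * m : ℤ) : ZMod n) = 0 := by
  change (if h : _ then _ else _) = _
  rw [dif_neg (by rw [residueIndex_coord]; omega)]

theorem linearIndependent_blockMat [NeZero n] (hkn : k ≤ n) (g : Matrix (Fin k) (Fin k) F) :
    LinearIndependent F (blockMat (n := n) g).row ↔ IsUnit g := by
  rw [← Matrix.linearIndependent_rows_iff_isUnit, Fintype.linearIndependent_iff,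
    Fintype.linearIndependent_iff]
  have key : ∀ a : Fin k → F, (∑ r, a r • (blockMat (n := n) g).row r = 0 ↔
      ∑ r, a r • g.row r = 0) := by
    intro a
    constructor
    · intro h
      funext i
      have := congrFun h ((((i : ℕ) : ℤ) + 1 + n * 0 : ℤ) : ZMod n)
      simpa only [Finset.sum_apply, Pi.smul_apply, Matrix.row, blockMat_apply_of_lt hkn,
        Pi.zero_apply] using this
    · intro h
      funext x
      obtain ⟨j, rfl⟩ := ZMod.intCast_surjective x
      obtain ⟨m, i, rfl⟩ := exists_coord n j
      rcases lt_or_ge (i : ℕ) k with hi | hi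
      · have := congrFun h ⟨i, hi⟩
        have e := fun r => blockMat_apply_of_lt hkn g r ⟨i, hi⟩ m
        simp only at e
        simp only [Finset.sum_apply, Pi.smul_apply, Matrix.row, e, Pi.zero_apply]
        simpa only [Finset.sum_apply, Pi.smul_apply, Matrix.row, Pi.zero_apply] using this
      · simp only [Finset.sum_apply, Pi.smul_apply, Matrix.row, blockMat_apply_of_le g _ hi,
          smul_zero, Finset.sum_const_zero, Pi.zero_apply]
  simp only [key]

theorem blockMat_hasPos [NeZero n] (hkn : k ≤ n) {g : Matrix (Fin k) (Fin k) F} (hg : IsUnit g) :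
    HasPos F (pairPerm (n := n) k 1 1) (colSeq (blockMat (n := n) g)) := by
  have hn : 0 < n := Nat.pos_of_ne_zero (NeZero.ne n)
  intro j
  obtain ⟨m, i, rfl⟩ := exists_coord n j
  rw [pairPerm_one_one_apply]
  rcases lt_or_ge (i : ℕ) k with hi | hi
  · rw [if_pos hi]
    refine ⟨⟨by omega, ?_⟩, fun l hl => ?_⟩
    · rw [← colSeq_periodic]
      exact mem_span_image (Set.mem_Ioc.2 (by omega))
    · by_contra hlt
      have hdet := (Matrix.isUnit_iff_isUnit_det g).1 hg
      -- This is a coordinate functional for the basis of block columns: it vanishes on all columns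
      -- before the next copy of column `i`.
      set L : (Fin k → F) →ₗ[F] F := (LinearMap.proj ⟨i, hi⟩).comp (Matrix.mulVecLin g⁻¹) with hL
      have hLcol : ∀ i' : Fin k, ∀ m' : ℤ,
          L (colSeq (blockMat (n := n) g) (((i' : ℕ) : ℤ) + 1 + n * m')) = if i' = ⟨i, hi⟩ then 1 else 0 := by
        intro i' m'
        have h1 : colSeq (blockMat (n := n) g) (((i' : ℕ) : ℤ) + 1 + n * m') = g.col i' := by
          funext r
          exact blockMat_apply_of_lt hkn g r i' m'
        rw [h1]
        have h2 : g⁻¹.mulVec (g.col i') = Pi.single i' 1 := by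
          have h3 : g.col i' = g.mulVec (Pi.single i' 1) := by
            rw [Matrix.mulVec_single_one]
          rw [h3, Matrix.mulVec_mulVec, Matrix.nonsing_inv_mul _ hdet, Matrix.one_mulVec]
        rw [hL, LinearMap.comp_apply, Matrix.mulVecLin_apply, h2, LinearMap.proj_apply,
          Pi.single_apply]
        simp only [eq_comm]
      have hker : Submodule.span F (colSeq (blockMat (n := n) g) '' Set.Ioc ((i : ℤ) + 1 + n * m) l) ≤
          LinearMap.ker L := by
        rw [Submodule.span_le]
        rintro _ ⟨x, hx, rfl⟩
        obtain ⟨m', i', rfl⟩ := exists_coord n x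
        rw [SetLike.mem_coe, LinearMap.mem_ker]
        rcases lt_or_ge (i' : ℕ) k with hi' | hi'
        · have := hLcol ⟨i', hi'⟩ m'
          simp only at this
          rw [this, if_neg]
          intro heq
          rw [Fin.mk.injEq] at heq
          rw [Set.mem_Ioc, heq] at hx
          have hm : m' = m ∨ m' < m ∨ m + 1 ≤ m' := by omega
          rcases hm with rfl | h | h
          · omega
          · have := mul_lt_mul_of_pos_left h (show (0 : ℤ) < n by omega)
            omega
          · have := mul_le_mul_of_nonneg_left h (show (0 : ℤ) ≤ n by omega)
            rw [mul_add] at this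
            omega
        · have h0 : colSeq (blockMat (n := n) g) ((i' : ℤ) + 1 + n * m') = 0 := by
            funext r
            exact blockMat_apply_of_le g r hi' m'
          rw [h0, map_zero]
      have h1 := LinearMap.mem_ker.1 (hker hl.2)
      have h2 := hLcol ⟨i, hi⟩ m
      simp only at h2
      rw [h1] at h2
      simp at h2
  · rw [if_neg (not_lt.2 hi), add_zero]
    refine ⟨⟨le_rfl, ?_⟩, fun l hl => hl.1⟩
    have h0 : colSeq (blockMat (n := n) g) ((i : ℤ) + 1 + n * m) = 0 := by
      funext r
      exact blockMat_apply_of_le g r hi m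
    rw [h0]
    exact Submodule.zero_mem _

/-- For the empty diagram the last `n - k` columns are zero, and the first `k` columns form an
arbitrary invertible block. -/
theorem natCard_matSet_one [NeZero n] (hkn : k ≤ n) :
    Nat.card (matSet n k F (pairPerm (n := n) k 1 1)) = Nat.card (GL (Fin k) F) := by
  symm
  refine Nat.card_congr (Equiv.ofBijective
    (fun g : GL (Fin k) F => ⟨blockMat (n := n) (g : Matrix (Fin k) (Fin k) F),
      (linearIndependent_blockMat hkn _).2 g.isUnit, blockMat_hasPos hkn g.isUnit⟩) ⟨?_, ?_⟩)
  · intro g g' h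
    have h1 := Subtype.ext_iff.1 h
    apply Units.ext
    ext r i
    have := congrFun (congrFun h1 r) ((((i : ℕ) : ℤ) + 1 + n * 0 : ℤ) : ZMod n)
    simpa only [blockMat_apply_of_lt hkn] using this
  · rintro ⟨A, hA1, hA2⟩
    set g : Matrix (Fin k) (Fin k) F :=
      Matrix.of fun r i => A r ((((i : ℕ) : ℤ) + 1 + n * 0 : ℤ) : ZMod n) with hg
    have hAg : blockMat (n := n) g = A := by
      ext r x
      obtain ⟨j, rfl⟩ := ZMod.intCast_surjective x
      obtain ⟨m, i, rfl⟩ := exists_coord n j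
      rcases lt_or_ge (i : ℕ) k with hi | hi
      · have := blockMat_apply_of_lt hkn g r ⟨i, hi⟩ m
        simp only at this
        rw [this, hg, Matrix.of_apply]
        congr 1
        push_cast
        simp
      · rw [blockMat_apply_of_le g r hi]
        have h1 := pairPerm_one_one_apply (k := k) m i
        rw [if_neg (not_lt.2 hi), add_zero] at h1
        exact (congrFun (hA2.eq_self_iff.1 h1) r).symm
    have hu : IsUnit g := by rw [← linearIndependent_blockMat (n := n) hkn, hAg]; exact hA1
    exact ⟨hu.unit, Subtype.ext hAg⟩

/-- The number of matrices with a given affine permutation, in terms of Deograms. -/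
theorem natCard_matSet_pairPerm [NeZero n] [Finite F] (hkn : k ≤ n) {lam : YoungDiagram}
    (hlam : FitsIn lam k (n - k)) {w : Equiv.Perm (Fin n)} (hw : HasPathPerm k lam ∅ w)
    (v : Equiv.Perm (Fin n)) :
    (Nat.card (matSet n k F (pairPerm k v w)) : ℤ) =
      Nat.card (GL (Fin k) F) * deogramSum (Nat.card F : ℤ) k lam 1 (permExt v⁻¹) := by
  have hn0 : 0 < n := Nat.pos_of_ne_zero (NeZero.ne n)
  induction hN : lam.cells.card generalizing lam w v with
  | zero =>
    have hbot : lam = ⊥ := YoungDiagram.ext (Finset.card_eq_zero.1 hN)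
    subst hbot
    have hw1 : w = 1 := eq_one_of_hasPathPerm_bot hkn hlam hw
    subst hw1
    rw [deogramSum_bot]
    by_cases hv : v = 1
    · rw [hv, natCard_matSet_one hkn, inv_one, permExt_one, if_pos rfl, mul_one]
    · have hne : (1 : Equiv.Perm ℕ) ≠ permExt v⁻¹ := fun h => hv (by
        rw [← permExt_one (n := n)] at h
        exact (inv_eq_one.1 (permExt_injective h).symm))
      -- For `w = 1` and `v ≠ 1` the affine permutation is not bounded, so both sides vanish.
      rw [if_neg hne, mul_zero, natCard_matSet_of_not_bounded hn0, Nat.cast_zero]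
      intro hb
      apply hv
      have h1 : v⁻¹ = 1 := by
        apply perm_eq_one_of_bounded (k := k)
        · intro i hi
          have := (hb ((i : ℤ) + 1 + n * 0)).2
          rw [pairPerm_apply, Equiv.Perm.one_apply, if_pos hi] at this
          change ((v.symm i : Fin n) : ℕ) ≤ i
          omega
        · intro i hi
          have := (hb ((i : ℤ) + 1 + n * 0)).1
          rw [pairPerm_apply, Equiv.Perm.one_apply, if_neg (not_lt.2 hi)] at this
          change (i : ℕ) ≤ ((v.symm i : Fin n) : ℕ)
          omega
      exact inv_eq_one.1 h1
  | succ N ih =>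
    obtain ⟨r, c, h⟩ := exists_isCorner (lam := lam) (Finset.card_pos.1 (by omega))
    have hcard : (eraseCorner h).cells.card = N := by
      rw [cells_eraseCorner, Finset.card_erase_of_mem h.1]
      omega
    have hlam' : FitsIn (eraseCorner h) k (n - k) := fun x y hxy =>
      hlam x y ((mem_eraseCorner h).1 hxy).2
    have hrc := hlam r c h.1
    have hn : 2 ≤ n := by omega
    obtain ⟨a, ha⟩ : ∃ a : Fin n, (a : ℕ) = k - 1 - r + c := ⟨⟨k - 1 - r + c, by omega⟩, rfl⟩
    obtain ⟨b, hb⟩ : ∃ b : Fin n, (b : ℕ) = a + 1 := ⟨⟨a + 1, by omega⟩, rfl⟩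
    have hw' := (hasPathPerm_eraseCorner hkn hlam h (Finset.notMem_empty _) ha hb).1 hw
    have hwa : (w a : ℕ) = k + c := by
      have h1 := (hasPathPerm_iff hkn hlam w).1 hw (k + c)
      rw [exitLabel_empty_of_le (by omega), add_tsub_cancel_left, colLen_of_isCorner h,
        show k - (r + 1) + c = a by omega] at h1
      have h2 := permExt_apply w⁻¹ ⟨k + c, by omega⟩
      simp only at h2
      rw [← h1] at h2
      have h3 : a = w⁻¹ ⟨k + c, by omega⟩ := Fin.ext h2
      rw [h3]
      simp
    have hwb : (w b : ℕ) = k - 1 - r := by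
      have h1 := (hasPathPerm_iff hkn hlam w).1 hw (k - 1 - r)
      rw [exitLabel_empty_of_lt (by omega), show k - 1 - (k - 1 - r) = r by omega,
        rowLen_of_isCorner h, show k - 1 - r + (c + 1) = b by omega] at h1
      have h2 := permExt_apply w⁻¹ ⟨k - 1 - r, by omega⟩
      simp only at h2
      rw [← h1] at h2
      have h3 : b = w⁻¹ ⟨k - 1 - r, by omega⟩ := Fin.ext h2
      rw [h3]
      simp
    have hgr := isGrassmannian_of_hasPathPerm hkn hlam' hw'
    set f := pairPerm k v w with hf
    set p : ℤ := (a : ℤ) + 1 with hp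
    have hfp : f p = (v.symm (w a) : ℕ) + 1 + n * 0 := by
      have := pairPerm_apply (k := k) v w 0 a
      rw [if_neg (by omega), mul_zero, add_zero, add_zero, mul_zero] at this
      rw [this, mul_zero]
    have hfp1 : f (p + 1) = (v.symm (w b) : ℕ) + 1 + n * 1 := by
      have := pairPerm_apply (k := k) v w 0 b
      rw [if_pos (by omega), mul_zero, add_zero, zero_add] at this
      rw [← this, hp, hb]
      push_cast
      rfl
    -- At a corner `w a` is large and `w b` is small, so `f p` stays in the first period while `f (p
    -- + 1)` is shifted into the next one.
    have hlt : f p < f (p + 1) := by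
      have := (v.symm (w a)).2
      rw [hfp, hfp1]
      omega
    have hlt' : affineSwap hn p (f p) < affineSwap hn p (f (p + 1)) := by
      rw [hfp, hfp1, affineSwap_coord hn hb, affineSwap_coord hn hb]
      have := (Equiv.swap a b (v.symm (w a))).2
      omega
    have hinvp : affineSwap hn p (f⁻¹ p) = ((w * Equiv.swap a b).symm (v a) : ℕ) + 1 +
        n * (0 - (if (v a : ℕ) < k then 1 else 0)) := by
      have h1 := pairPerm_inv_apply (k := k) v w 0 a
      rw [mul_zero, add_zero] at h1
      rw [h1, affineSwap_coord hn hb]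
      rfl
    have hinvp1 : affineSwap hn p (f⁻¹ (p + 1)) = ((w * Equiv.swap a b).symm (v b) : ℕ) + 1 +
        n * (0 - (if (v b : ℕ) < k then 1 else 0)) := by
      have h1 := pairPerm_inv_apply (k := k) v w 0 b
      rw [mul_zero, add_zero, hb] at h1
      push_cast at h1
      rw [h1, affineSwap_coord hn hb]
      rfl
    -- The incoming strands are ordered as `v a`, `v b`: small values come from the preceding
    -- period, and within each block the Grassmannian permutation of the smaller diagram is
    -- increasing.
    have hmono : ∀ x y : Fin n, v x < v y → ((w * Equiv.swap a b).symm (v x) : ℤ) + 1 +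
        n * (0 - (if (v x : ℕ) < k then 1 else 0)) < ((w * Equiv.swap a b).symm (v y) : ℕ) + 1 +
        n * (0 - (if (v y : ℕ) < k then 1 else 0)) := by
      intro x y hxy
      have hxy' : (v x : ℕ) < v y := hxy
      have b1 := ((w * Equiv.swap a b).symm (v x)).2
      rcases lt_or_ge (v y : ℕ) k with h1 | h1
      · have h2 := hgr _ _ hxy (Or.inl h1)
        rw [Fin.lt_def] at h2
        rw [if_pos h1, if_pos (by omega)]
        omega
      · rcases lt_or_ge (v x : ℕ) k with h3 | h3
        · rw [if_pos h3, if_neg (not_lt.2 h1)]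
          omega
        · have h2 := hgr _ _ hxy (Or.inr h3)
          rw [Fin.lt_def] at h2
          rw [if_neg (not_lt.2 h3), if_neg (not_lt.2 h1)]
          omega
    have hq : 1 ≤ Nat.card F := Nat.card_pos
    rw [deogramSum_one_corner _ hlam.row_lt h]
    have hsymm : ∀ x : Fin n, (permExt v⁻¹).symm (x : ℕ) = v x := fun x => by
      rw [Equiv.symm_apply_eq, permExt_apply]
      simp
    have hdual : Equiv.swap (a : ℕ) (b : ℕ) * permExt v⁻¹ = permExt (v * Equiv.swap a b)⁻¹ := by
      rw [mul_inv_rev, Equiv.swap_inv, permExt_mul, permExt_swap]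
    have i1 := ih hlam' hw' (v * Equiv.swap a b) hcard
    have i2 := ih hlam' hw' v hcard
    rw [pairPerm_swap_mul_swap hn hb] at i1
    rw [pairPerm_mul_swap hn hb] at i2
    unfold leftOpDual
    rw [← ha, ← hb, hsymm, hsymm, hdual]
    -- The two cases of the matrix recursion are now exactly the two cases of the Hecke operator on
    -- Deogram sums.
    by_cases hv : v a < v b
    · rw [if_pos (show (v a : ℕ) < v b from hv), natCard_matSet_of_lt hn (pairPerm_mem v w) hlt hlt' (by
        rw [hinvp, hinvp1]; exact hmono a b hv)]
      rw [Nat.cast_add, Nat.cast_mul, Nat.cast_mul, Nat.cast_sub hq, Nat.cast_one, i1, i2]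
      ring
    · have hv' : v b < v a := lt_of_le_of_ne (not_lt.1 hv) (fun h' => by
        have := v.injective h'
        rw [this] at hb
        omega)
      rw [if_neg (show ¬ (v a : ℕ) < v b from hv), natCard_matSet_of_gt hn (pairPerm_mem v w) hlt hlt' (by
        rw [hinvp, hinvp1]; exact hmono b a hv'), i1]

end Pair

end PositroidCatalan

namespace PositroidCatalan

-- Total displacement of affine permutations

section Displacement

variable {n : ℕ}

theorem exists_perm_coord [NeZero n] {f : Equiv.Perm ℤ} (hf : f ∈ affinePerms n) :
    ∃ (g : Equiv.Perm (Fin n)) (m : Fin n → ℤ), ∀ (t : ℤ) (i : Fin n),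
      f ((i : ℤ) + 1 + n * t) = (g i : ℤ) + 1 + n * (t + m i) := by
  choose m g hg using fun i : Fin n => exists_coord n (f ((i : ℤ) + 1))
  have hinj : Function.Injective g := by
    intro i i' h
    have h1 : f ((i : ℤ) + 1) = f ((i' : ℤ) + 1 + n * (m i - m i')) := by
      rw [affinePerms_add_mul hf, hg, hg, h]
      ring
    have h2 := f.injective h1
    rw [show (i : ℤ) + 1 = (i : ℤ) + 1 + n * 0 by ring] at h2
    exact (coord_inj h2).1
  refine ⟨Equiv.ofBijective g (Finite.injective_iff_bijective.1 hinj), m, fun t i => ?_⟩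
  rw [affinePerms_add_mul hf, hg, Equiv.ofBijective_apply]
  ring

/-- The total displacement over one period. -/
def displacement (n : ℕ) (f : ℤ → ℤ) : ℤ := ∑ i : Fin n, (f ((i : ℤ) + 1) - ((i : ℤ) + 1))

theorem displacement_eq_sum_Icc (f : ℤ → ℤ) :
    displacement n f = ∑ j ∈ Finset.Icc (1 : ℤ) n, (f j - j) := by
  refine Finset.sum_bij (fun i _ => (i : ℤ) + 1) (fun i _ => ?_) (fun i _ i' _ h => ?_)
    (fun j hj => ?_) (fun _ _ => rfl)
  · have := i.2
    rw [Finset.mem_Icc]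
    omega
  · exact Fin.ext (by omega)
  · rw [Finset.mem_Icc] at hj
    exact ⟨⟨(j - 1).toNat, by omega⟩, Finset.mem_univ _, by simp only; omega⟩

/-- The displacement of `f` at `g i` depends only on a residue, and `g` permutes the residues. -/
theorem displacement_mul [NeZero n] {f g : Equiv.Perm ℤ} (hf : f ∈ affinePerms n)
    (hg : g ∈ affinePerms n) :
    displacement n (f * g : Equiv.Perm ℤ) = displacement n f + displacement n g := by
  obtain ⟨u, m, hu⟩ := exists_perm_coord hg
  unfold displacement
  rw [← Equiv.sum_comp u (fun i => f ((i : ℤ) + 1) - ((i : ℤ) + 1)), ← Finset.sum_add_distrib]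
  refine Finset.sum_congr rfl fun i _ => ?_
  have h := hu 0 i
  rw [mul_zero, add_zero] at h
  rw [Equiv.Perm.mul_apply, h, affinePerms_add_mul hf]
  ring

/-- Displacement is additive and the transposition is an involution, so twice its displacement is
zero. -/
theorem displacement_affineSwap [NeZero n] (hn : 2 ≤ n) (p : ℤ) :
    displacement n (affineSwap hn p) = 0 := by
  have h := displacement_mul (affineSwap_mem hn p) (affineSwap_mem hn p)
  rw [affineSwap_mul_self] at h
  have h1 : displacement n (1 : Equiv.Perm ℤ) = 0 := by simp [displacement]
  omega

theorem displacement_mul_affineSwap [NeZero n] (hn : 2 ≤ n) {f : Equiv.Perm ℤ}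
    (hf : f ∈ affinePerms n) (p : ℤ) :
    displacement n (f * affineSwap hn p : Equiv.Perm ℤ) = displacement n f := by
  rw [displacement_mul hf (affineSwap_mem hn p), displacement_affineSwap, add_zero]

theorem displacement_affineSwap_conj [NeZero n] (hn : 2 ≤ n) {f : Equiv.Perm ℤ}
    (hf : f ∈ affinePerms n) (p : ℤ) :
    displacement n (affineSwap hn p * f * affineSwap hn p : Equiv.Perm ℤ) = displacement n f := by
  rw [displacement_mul (Subgroup.mul_mem _ (affineSwap_mem hn p) hf) (affineSwap_mem hn p),
    displacement_mul (affineSwap_mem hn p) hf, displacement_affineSwap, add_zero, zero_add]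

end Displacement

-- Grassmannian permutations and Young diagrams

section Grassmannian

variable {n k : ℕ}

theorem card_filter_apply_lt (w : Equiv.Perm (Fin n)) (i : Fin n) :
    (Finset.univ.filter fun j => w j < w i).card = (w i : ℕ) := by
  have h : (Finset.univ.filter fun j => w j < w i) = (Finset.Iio (w i)).map w.symm.toEmbedding := by
    ext j
    simp only [Finset.mem_filter, Finset.mem_univ, true_and, Finset.mem_map, Finset.mem_Iio,
      Equiv.coe_toEmbedding]
    exact ⟨fun h => ⟨w j, h, by simp⟩, by rintro ⟨x, hx, rfl⟩; simpa using hx⟩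
  rw [h, Finset.card_map, Fin.card_Iio]

theorem IsGrassmannian.apply_lt_iff {w : Equiv.Perm (Fin n)} (hw : IsGrassmannian k w)
    {i j : Fin n} (h : ((w i : ℕ) < k ↔ (w j : ℕ) < k)) : w i < w j ↔ i < j := by
  have key : ∀ {i j : Fin n}, ((w i : ℕ) < k ↔ (w j : ℕ) < k) → w i < w j → i < j := by
    intro i j h hij
    have := hw _ _ hij (by
      by_cases h1 : (w j : ℕ) < k
      · exact Or.inl h1
      · exact Or.inr (not_lt.1 fun h2 => h1 (h.1 h2)))
    simpa using this
  refine ⟨key h, fun hij => ?_⟩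
  rcases lt_trichotomy (w i) (w j) with h1 | h1 | h1
  · exact h1
  · exact absurd (w.injective h1) hij.ne
  · exact absurd (key h.symm h1) hij.not_gt

/-- The positions of the small values determine all comparisons of values, and a permutation value
is the number of values below it. -/
theorem IsGrassmannian.eq_of_iff {w w' : Equiv.Perm (Fin n)} (hw : IsGrassmannian k w)
    (hw' : IsGrassmannian k w') (h : ∀ i, ((w i : ℕ) < k ↔ (w' i : ℕ) < k)) : w = w' := by
  have key : ∀ {w : Equiv.Perm (Fin n)}, IsGrassmannian k w → ∀ i j, (w j < w i ↔
      (if (w i : ℕ) < k then (w j : ℕ) < k ∧ j < i else ((w j : ℕ) < k ∨ j < i))) := by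
    intro w hw i j
    by_cases h1 : (w i : ℕ) < k <;> by_cases h2 : (w j : ℕ) < k
    · simp only [h1, h2, if_true, true_and, hw.apply_lt_iff (i := j) (j := i) (by simp [h1, h2])]
    · simp only [h1, h2, if_true, false_and, iff_false, Fin.lt_def]
      omega
    · simp only [h1, h2, if_false, true_or, iff_true, Fin.lt_def]
      omega
    · simp only [h1, h2, if_false, false_or, hw.apply_lt_iff (i := j) (j := i) (by simp [h1, h2])]
  ext i
  rw [← card_filter_apply_lt w i, ← card_filter_apply_lt w' i]
  congr 1
  ext j
  simp only [Finset.mem_filter, Finset.mem_univ, true_and, key hw, key hw', h]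

theorem exists_isGrassmannian (hkn : k ≤ n) (S : Finset (Fin n)) (hS : S.card = k) :
    ∃ w : Equiv.Perm (Fin n), IsGrassmannian k w ∧ ∀ i, (w i : ℕ) < k ↔ i ∈ S := by
  have hSc : (Sᶜ).card = n - k := by rw [Finset.card_compl, Fintype.card_fin, hS]
  set e : Fin n ≃ Fin n := (finCongr (by omega : n = k + (n - k))).trans
    (finSumFinEquiv.symm.trans (finSumEquivOfFinset hS hSc)) with he
  have e1 : ∀ a : Fin n, ∀ h : (a : ℕ) < k, e a = S.orderEmbOfFin hS ⟨a, h⟩ := by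
    intro a h
    have : (finCongr (by omega : n = k + (n - k))) a = Fin.castAdd (n - k) ⟨a, h⟩ := Fin.ext rfl
    rw [he, Equiv.trans_apply, Equiv.trans_apply, this, finSumFinEquiv_symm_apply_castAdd,
      finSumEquivOfFinset_inl]
  have e2 : ∀ a : Fin n, ∀ h : k ≤ (a : ℕ), e a = (Sᶜ).orderEmbOfFin hSc ⟨a - k, by omega⟩ := by
    intro a h
    have : (finCongr (by omega : n = k + (n - k))) a = Fin.natAdd k ⟨a - k, by omega⟩ :=
      Fin.ext (by simp; omega)
    rw [he, Equiv.trans_apply, Equiv.trans_apply, this, finSumFinEquiv_symm_apply_natAdd,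
      finSumEquivOfFinset_inr]
  refine ⟨e.symm, fun a b hab h => ?_, fun i => ?_⟩
  · rw [Equiv.symm_symm]
    have hab' : (a : ℕ) < b := hab
    rcases h with h | h
    · rw [e1 a (by omega), e1 b h, OrderEmbedding.lt_iff_lt]
      exact hab
    · rw [e2 a h, e2 b (by omega), OrderEmbedding.lt_iff_lt, Fin.lt_def]
      simp only
      omega
  · obtain ⟨a, rfl⟩ := e.surjective i
    rw [Equiv.symm_apply_apply]
    rcases lt_or_ge (a : ℕ) k with h | h
    · rw [e1 a h]
      exact iff_of_true h (Finset.orderEmbOfFin_mem _ _ _)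
    · rw [e2 a h]
      exact iff_of_false (not_lt.2 h) (Finset.mem_compl.1 (Finset.orderEmbOfFin_mem _ _ _))

/-- The Young diagram of a Grassmannian permutation. -/
theorem IsGrassmannian.exists_youngDiagram {w : Equiv.Perm (Fin n)} (hw : IsGrassmannian k w)
    (hkn : k ≤ n) : ∃ lam : YoungDiagram, FitsIn lam k (n - k) ∧ HasPathPerm k lam ∅ w := by
  classical
  -- Boxes are inversions: row `r` stands for the value `k - 1 - r`, column `c` for `k + c`, and the
  -- box is present if the large value occurs first.
  set P : ℕ × ℕ → Prop := fun x => ∃ (h1 : x.1 < k) (h2 : x.2 < n - k),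
    w.symm ⟨k + x.2, by omega⟩ < w.symm ⟨k - 1 - x.1, by omega⟩ with hP
  set lam : YoungDiagram :=
    { cells := (Finset.range k ×ˢ Finset.range (n - k)).filter P
      isLowerSet := by
        intro x y hyx hx
        rw [Finset.mem_coe, Finset.mem_filter, Finset.mem_product, Finset.mem_range,
          Finset.mem_range] at hx ⊢
        obtain ⟨⟨_, _⟩, h1, h2, h3⟩ := hx
        have hyx1 : y.1 ≤ x.1 := hyx.1
        have hyx2 : y.2 ≤ x.2 := hyx.2
        refine ⟨⟨by omega, by omega⟩, by omega, by omega, ?_⟩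
        refine lt_of_le_of_lt ?_ (lt_of_lt_of_le h3 ?_)
        · rcases eq_or_lt_of_le hyx2 with h | h
          · simp only [h, le_refl]
          · exact (hw _ _ (Fin.mk_lt_mk.2 (by omega)) (Or.inr (by simp))).le
        · rcases eq_or_lt_of_le hyx1 with h | h
          · simp only [h, le_refl]
          · exact (hw _ _ (Fin.mk_lt_mk.2 (by omega)) (Or.inl (by simp only; omega))).le } with hlamdef
  have hmem : ∀ r c, (r, c) ∈ lam ↔ P (r, c) := by
    intro r c
    rw [← YoungDiagram.mem_cells, Finset.mem_filter, Finset.mem_product, Finset.mem_range,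
      Finset.mem_range]
    exact ⟨fun h => h.2, fun h => ⟨⟨h.1, h.2.1⟩, h⟩⟩
  have hfit : FitsIn lam k (n - k) := fun r c h => by
    obtain ⟨h1, h2, -⟩ := (hmem r c).1 h
    exact ⟨h1, h2⟩
  refine ⟨lam, hfit, fun i => ?_⟩
  -- The position `i` counts the earlier small and the earlier large values; one count is given by
  -- the order within its own block, the other by a row or column length.
  have hi : (i : ℕ) = (Finset.univ.filter fun j => j < i ∧ (w j : ℕ) < k).card +
      (Finset.univ.filter fun j => j < i ∧ ¬ (w j : ℕ) < k).card := by
    rw [← Finset.filter_filter, ← Finset.filter_filter, Finset.card_filter_add_card_filter_not,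
      ← Fin.card_Iio]
    congr 1
    ext j
    simp
  have hrange : ∀ a b : ℕ, b ≤ n →
      (Finset.univ.filter fun j : Fin n => a ≤ (w j : ℕ) ∧ (w j : ℕ) < b).card = b - a := by
    intro a b hb
    rw [← Nat.card_Ico a b]
    refine Finset.card_bij (fun x _ => (w x : ℕ)) (fun x hx => ?_)
      (fun x _ y _ h => w.injective (Fin.ext h)) (fun x hx => ?_)
    · simpa using hx
    · rw [Finset.mem_Ico] at hx
      exact ⟨w.symm ⟨x, by omega⟩, by simpa using hx, by simp⟩
  rcases lt_or_ge (w i : ℕ) k with h | h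
  · rw [exitLabel_empty_of_lt h, hi]
    congr 1
    · have e : (Finset.univ.filter fun j => j < i ∧ (w j : ℕ) < k) =
          (Finset.univ.filter fun j => w j < w i) := by
        ext j
        simp only [Finset.mem_filter, Finset.mem_univ, true_and]
        constructor
        · rintro ⟨h1, h2⟩
          exact (hw.apply_lt_iff (by simp [h, h2])).2 h1
        · intro h1
          have h2 : (w j : ℕ) < k := lt_trans h1 h
          exact ⟨(hw.apply_lt_iff (by simp [h, h2])).1 h1, h2⟩
      rw [e, card_filter_apply_lt]
    · have e : (Finset.univ.filter fun j => j < i ∧ ¬ (w j : ℕ) < k) =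
          (Finset.univ.filter fun j => k ≤ (w j : ℕ) ∧ (w j : ℕ) < k + lam.rowLen (k - 1 - (w i : ℕ))) := by
        ext j
        simp only [Finset.mem_filter, Finset.mem_univ, true_and, not_lt]
        rw [and_comm]
        refine and_congr_right fun h1 => ?_
        have h2 := (hmem (k - 1 - (w i : ℕ)) ((w j : ℕ) - k))
        rw [YoungDiagram.mem_iff_lt_rowLen] at h2
        rw [show (w j : ℕ) < k + lam.rowLen (k - 1 - (w i : ℕ)) ↔
          (w j : ℕ) - k < lam.rowLen (k - 1 - (w i : ℕ)) by omega, h2, hP]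
        have e1 : (⟨k + ((w j : ℕ) - k), by omega⟩ : Fin n) = w j := Fin.ext (by simp only; omega)
        have e2 : (⟨k - 1 - (k - 1 - (w i : ℕ)), by omega⟩ : Fin n) = w i :=
          Fin.ext (by simp only; omega)
        simp only [e1, e2, Equiv.symm_apply_apply]
        exact ⟨fun h3 => ⟨by omega, by omega, h3⟩, fun h3 => h3.2.2⟩
      have hle : lam.rowLen (k - 1 - (w i : ℕ)) ≤ n - k := by
        by_contra hlt
        have := (hfit (k - 1 - (w i : ℕ)) (n - k)
          (YoungDiagram.mem_iff_lt_rowLen.2 (by omega))).2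
        omega
      rw [e, hrange _ _ (by omega)]
      omega
  · have hwi := (w i).2
    have hcol := colLen_le_of_rows hfit.row_lt ((w i : ℕ) - k)
    rw [exitLabel_empty_of_le h, hi]
    congr 1
    · have e : (Finset.univ.filter fun j => j < i ∧ (w j : ℕ) < k) = (Finset.univ.filter
          fun j => 0 ≤ (w j : ℕ) ∧ (w j : ℕ) < k - lam.colLen ((w i : ℕ) - k)) := by
        ext j
        simp only [Finset.mem_filter, Finset.mem_univ, true_and, zero_le]
        rw [and_comm]
        by_cases h1 : (w j : ℕ) < k
        · have h2 := (hmem (k - 1 - (w j : ℕ)) ((w i : ℕ) - k))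
          rw [YoungDiagram.mem_iff_lt_colLen] at h2
          rw [show (w j : ℕ) < k - lam.colLen ((w i : ℕ) - k) ↔
            ¬ (k - 1 - (w j : ℕ) < lam.colLen ((w i : ℕ) - k)) by omega, h2, hP]
          have e1 : (⟨k + ((w i : ℕ) - k), by omega⟩ : Fin n) = w i :=
            Fin.ext (by simp only; omega)
          have e2 : (⟨k - 1 - (k - 1 - (w j : ℕ)), by omega⟩ : Fin n) = w j :=
            Fin.ext (by simp only; omega)
          simp only [e1, e2, Equiv.symm_apply_apply]
          constructor
          · rintro ⟨-, h3⟩ ⟨-, -, h4⟩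
            exact lt_asymm h3 h4
          · intro h3
            refine ⟨h1, lt_of_le_of_ne (not_lt.1 fun h4 => h3 ⟨by omega, by omega, h4⟩) ?_⟩
            rintro rfl
            omega
        · exact iff_of_false (fun h2 => h1 h2.1) (by omega)
      rw [e, hrange _ _ (by omega)]
      omega
    · have e : (Finset.univ.filter fun j => j < i ∧ ¬ (w j : ℕ) < k) =
          (Finset.univ.filter fun j => k ≤ (w j : ℕ) ∧ (w j : ℕ) < w i) := by
        ext j
        simp only [Finset.mem_filter, Finset.mem_univ, true_and, not_lt]
        rw [and_comm]
        refine and_congr_right fun h1 => ?_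
        rw [← hw.apply_lt_iff (i := j) (j := i) (by omega), Fin.lt_def]
      rw [e, hrange _ _ (by omega)]

/-- With crossings only, the exits on the left side of the rectangle reveal all row lengths. -/
theorem youngDiagram_unique {w : Equiv.Perm (Fin n)} (hkn : k ≤ n) {lam lam' : YoungDiagram}
    (hlam : FitsIn lam k (n - k)) (hlam' : FitsIn lam' k (n - k)) (hw : HasPathPerm k lam ∅ w)
    (hw' : HasPathPerm k lam' ∅ w) : lam = lam' := by
  have hrow : ∀ r, lam.rowLen r = lam'.rowLen r := by
    intro r
    rcases lt_or_ge r k with hr | hr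
    · have h1 := hw (w.symm ⟨k - 1 - r, by omega⟩)
      have h2 := hw' (w.symm ⟨k - 1 - r, by omega⟩)
      rw [Equiv.apply_symm_apply, exitLabel_empty_of_lt (by simp only; omega)] at h1 h2
      simp only at h1 h2
      rw [show k - 1 - (k - 1 - r) = r by omega] at h1 h2
      omega
    · have key : ∀ {mu : YoungDiagram}, FitsIn mu k (n - k) → mu.rowLen r = 0 := by
        intro mu hmu
        by_contra h0
        have := hmu r 0 (YoungDiagram.mem_iff_lt_rowLen.2 (Nat.pos_of_ne_zero h0))
        omega
      rw [key hlam, key hlam']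
  apply SetLike.coe_injective
  ext ⟨r, c⟩
  rw [SetLike.mem_coe, SetLike.mem_coe, YoungDiagram.mem_iff_lt_rowLen,
    YoungDiagram.mem_iff_lt_rowLen, hrow]

end Grassmannian
end PositroidCatalan

namespace PositroidCatalan

-- A criterion for the Bruhat order below a Grassmannian permutation

section Bruhat

variable {n k : ℕ}

/-- Inversions are injected into the inversions of the product, missing the new inversion `(a, b)`:
a pair is carried along by the swap if this keeps its order, and is left in place otherwise. -/
theorem inversionCount_lt_mul_swap {u : Equiv.Perm (Fin n)} {a b : Fin n} (hab : a < b)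
    (h : u a < u b) : inversionCount u < inversionCount (u * Equiv.swap a b) := by
  classical
  set s := Equiv.swap a b with hs
  have sa : s a = b := Equiv.swap_apply_left a b
  have sb : s b = a := Equiv.swap_apply_right a b
  have so : ∀ x, x ≠ a → x ≠ b → s x = x := fun x h1 h2 => Equiv.swap_apply_of_ne_of_ne h1 h2
  have ss : ∀ x, s (s x) = x := Equiv.swap_apply_self a b
  -- reversed pairs involve exactly one of the two positions
  have rev : ∀ x y, x < y → ¬ s x < s y → (x = a ∧ y = b) ∨ (x = a ∧ a < y ∧ y < b) ∨
      (y = b ∧ a < x ∧ x < b) := by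
    intro x y hxy hsxy
    by_cases hxa : x = a
    · subst hxa
      by_cases hyb : y = b
      · exact Or.inl ⟨rfl, hyb⟩
      · rw [sa, so y hxy.ne' hyb, not_lt] at hsxy
        exact Or.inr (Or.inl ⟨rfl, hxy, lt_of_le_of_ne hsxy hyb⟩)
    · by_cases hyb : y = b
      · subst hyb
        rw [sb, so x hxa hxy.ne, not_lt] at hsxy
        exact Or.inr (Or.inr ⟨rfl, lt_of_le_of_ne hsxy (Ne.symm hxa), hxy⟩)
      · exfalso
        by_cases hxb : x = b
        · subst hxb
          rw [sb, so y (hab.trans hxy).ne' hxy.ne'] at hsxy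
          exact hsxy (hab.trans hxy)
        · by_cases hya : y = a
          · subst hya
            rw [sa, so x hxa hxb] at hsxy
            exact hsxy (hxy.trans hab)
          · rw [so x hxa hxb, so y hya hyb] at hsxy
            exact hsxy hxy
  set φ : Fin n × Fin n → Fin n × Fin n := fun x => if s x.1 < s x.2 then (s x.1, s x.2) else x
    with hφ
  have hmem : (a, b) ∈ (Finset.univ.filter fun p : Fin n × Fin n =>
      p.1 < p.2 ∧ (u * s) p.2 < (u * s) p.1) := by
    refine Finset.mem_filter.2 ⟨Finset.mem_univ _, hab, ?_⟩
    rw [Equiv.Perm.mul_apply, Equiv.Perm.mul_apply, sa, sb]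
    exact h
  unfold inversionCount
  refine lt_of_le_of_lt (Finset.card_le_card_of_injOn φ (t := (Finset.univ.filter
    fun p : Fin n × Fin n => p.1 < p.2 ∧ (u * s) p.2 < (u * s) p.1).erase (a, b)) ?_ ?_)
    (Finset.card_erase_lt_of_mem hmem)
  · rintro ⟨x, y⟩ hxy
    simp only [Finset.coe_filter, Finset.mem_univ, true_and, Set.mem_ofPred_eq] at hxy
    rw [Finset.mem_coe, Finset.mem_erase, Finset.mem_filter]
    by_cases h1 : s x < s y
    · simp only [hφ, h1, if_true, Finset.mem_univ, true_and, Equiv.Perm.mul_apply, ss]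
      refine ⟨fun h2 => ?_, hxy.2⟩
      rw [Prod.mk.injEq] at h2
      have h3 : x = b := by rw [← ss x, h2.1, sa]
      have h4 : y = a := by rw [← ss y, h2.2, sb]
      rw [h3, h4] at hxy
      exact lt_asymm hab hxy.1
    · simp only [hφ, h1, if_false, Finset.mem_univ, true_and, Equiv.Perm.mul_apply]
      rcases rev x y hxy.1 h1 with ⟨rfl, rfl⟩ | ⟨rfl, h2, h3⟩ | ⟨rfl, h2, h3⟩
      · exact absurd hxy.2 h.not_gt
      · refine ⟨fun h4 => h3.ne (Prod.mk.inj h4).2, hxy.1, ?_⟩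
        rw [sa, so y h2.ne' h3.ne]
        exact hxy.2.trans h
      · refine ⟨fun h4 => h2.ne' (Prod.mk.inj h4).1, hxy.1, ?_⟩
        rw [sb, so x h2.ne' h3.ne]
        exact h.trans hxy.2
  · rintro ⟨x, y⟩ hxy ⟨x', y'⟩ hxy' heq
    simp only [Finset.coe_filter, Finset.mem_univ, true_and, Set.mem_ofPred_eq] at hxy hxy'
    by_cases h1 : s x < s y <;> by_cases h2 : s x' < s y' <;>
      simp only [hφ, h1, h2, if_true, if_false, Prod.mk.injEq] at heq
    · rw [Prod.mk.injEq]
      exact ⟨s.injective heq.1, s.injective heq.2⟩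
    · rw [← heq.1, ← heq.2, ss, ss] at h2
      exact absurd hxy.1 h2
    · rw [heq.1, heq.2, ss, ss] at h1
      exact absurd hxy'.1 h1
    · rw [Prod.mk.injEq]
      exact heq

theorem inversionCount_le (u : Equiv.Perm (Fin n)) : inversionCount u ≤ n * n := by
  refine (Finset.card_filter_le _ _).trans ?_
  simp

/-- A permutation obtained by moving small values to the left and large values to the right in a
Grassmannian permutation lies below it in the Bruhat order. -/
theorem bruhatLE_of_isGrassmannian {v w : Equiv.Perm (Fin n)} (hw : IsGrassmannian k w)
    (h1 : ∀ x : Fin n, (x : ℕ) < k → v.symm x ≤ w.symm x)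
    (h2 : ∀ x : Fin n, k ≤ (x : ℕ) → w.symm x ≤ v.symm x) : BruhatLE v w := by
  induction hN : n * n - inversionCount v using Nat.strong_induction_on generalizing v with
  | _ N ih =>
    by_cases hvw : v = w
    · rw [hvw]
      exact Relation.ReflTransGen.refl
    -- the leftmost difference
    obtain ⟨a, ha, hmin⟩ : ∃ a, v a ≠ w a ∧ ∀ x < a, v x = w x := by
      have hne : (Finset.univ.filter fun x => v x ≠ w x).Nonempty := by
        by_contra hne
        rw [Finset.not_nonempty_iff_eq_empty, Finset.filter_eq_empty_iff] at hne
        exact hvw (Equiv.ext fun x => not_not.1 (hne (Finset.mem_univ x)))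
      refine ⟨Finset.min' _ hne, ?_, fun x hx => ?_⟩
      · exact (Finset.mem_filter.1 (Finset.min'_mem _ hne)).2
      · by_contra hx'
        exact (Finset.min'_le _ x (Finset.mem_filter.2 ⟨Finset.mem_univ _, hx'⟩)).not_gt hx
    have hv : ∀ x, w.symm x < a → v.symm x = w.symm x := fun x hx => by
      rw [Equiv.symm_apply_eq, hmin _ hx, Equiv.apply_symm_apply]
    have hge : ∀ x, v (a) = x → a < w.symm x := by
      rintro x rfl
      rcases lt_trichotomy a (w.symm (v a)) with h | h | h
      · exact h
      · exact absurd ((Equiv.eq_symm_apply w).1 h).symm ha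
      · have := hv _ h
        rw [Equiv.symm_apply_apply] at this
        exact absurd this h.ne'
    set i := w.symm (v a) with hi
    have hai : a < i := hge _ rfl
    -- At the first difference `v` has placed a small value too early, and the value `w a` still to
    -- come must be large.
    have hm : (v a : ℕ) < k := by
      by_contra hm
      have := h2 (v a) (not_lt.1 hm)
      rw [Equiv.symm_apply_apply] at this
      exact this.not_gt hai
    have hva : a < v.symm (w a) := by
      rcases lt_trichotomy a (v.symm (w a)) with h | h | h
      · exact h
      · exact absurd ((Equiv.eq_symm_apply v).1 h) ha
      · have := hmin _ h
        rw [Equiv.apply_symm_apply] at this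
        exact absurd (w.injective this) h.ne'
    have hm' : k ≤ (w a : ℕ) := by
      by_contra hm'
      have := h1 (w a) (not_le.1 hm')
      rw [Equiv.symm_apply_apply] at this
      exact this.not_gt hva
    -- The bound `b ≤ i` keeps the small value `v a` weakly to the left of its place in `w`, so the
    -- transposed permutation still satisfies both hypotheses.
    obtain ⟨b, hab, hbi, hb⟩ : ∃ b, a < b ∧ b ≤ i ∧ ((v a < v b ∧ (v b : ℕ) < k) ∨ v b = w a) := by
      by_contra hcon
      push Not at hcon
      -- If no such `b` existed, all values of `v` up to position `i` would occur in `w` up to `i`.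
      -- By cardinality the two sets agree, so `w a` would appear in `v` between `a` and `i`.
      have hsub : (Finset.Iic i).map v.toEmbedding ⊆ (Finset.Iic i).map w.toEmbedding := by
        intro x hx
        rw [Finset.mem_map_equiv, Finset.mem_Iic] at hx ⊢
        rcases lt_trichotomy (v.symm x) a with h | h | h
        · have h3 := hmin _ h
          rw [Equiv.apply_symm_apply] at h3
          rw [h3, Equiv.symm_apply_apply] at *
          exact hx
        · rw [Equiv.symm_apply_eq] at h
          rw [h]
        · by_cases hxk : (x : ℕ) < k
          · have h3 := (hcon _ h hx).1
            rw [Equiv.apply_symm_apply] at h3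
            have h4 : x ≤ v a := not_lt.1 fun h5 => absurd (h3 h5) (not_le.2 hxk)
            rcases eq_or_lt_of_le h4 with h5 | h5
            · rw [h5]
            · exact (hw _ _ h5 (Or.inl hm)).le
          · exact (h2 x (not_lt.1 hxk)).trans hx
      have heq := Finset.eq_of_subset_of_card_le hsub (by rw [Finset.card_map, Finset.card_map])
      have hwa : w a ∈ (Finset.Iic i).map v.toEmbedding := by
        rw [heq, Finset.mem_map_equiv, Finset.mem_Iic, Equiv.symm_apply_apply]
        exact hai.le
      rw [Finset.mem_map_equiv, Finset.mem_Iic] at hwa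
      exact (hcon _ hva hwa).2 (Equiv.apply_symm_apply _ _)
    have hlt : v a < v b := by
      rcases hb with hb | hb
      · exact hb.1
      · rw [hb, Fin.lt_def]
        omega
    have hinv := inversionCount_lt_mul_swap hab hlt
    have hsymm : ∀ x, (v * Equiv.swap a b).symm x = Equiv.swap a b (v.symm x) := fun x => by
      rw [Equiv.symm_apply_eq]
      simp
    refine Relation.ReflTransGen.head ⟨a, b, rfl, hinv⟩ (ih _ ?_ ?_ ?_ rfl)
    · have := inversionCount_le (v * Equiv.swap a b)
      omega
    · intro x hx
      rw [hsymm]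
      by_cases e1 : v.symm x = a
      · rw [e1, Equiv.swap_apply_left]
        rw [Equiv.symm_apply_eq] at e1
        rw [e1]
        exact hbi
      · by_cases e2 : v.symm x = b
        · rw [e2, Equiv.swap_apply_right]
          exact (hab.le.trans e2.ge).trans (h1 x hx)
        · rw [Equiv.swap_apply_of_ne_of_ne e1 e2]
          exact h1 x hx
    · intro x hx
      rw [hsymm]
      by_cases e1 : v.symm x = a
      · rw [Equiv.symm_apply_eq] at e1
        rw [e1] at hx
        omega
      · by_cases e2 : v.symm x = b
        · rw [e2, Equiv.swap_apply_right]
          rw [Equiv.symm_apply_eq] at e2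
          rcases hb with hb | hb
          · rw [← e2] at hb
            omega
          · rw [e2, hb, Equiv.symm_apply_apply]
        · rw [Equiv.swap_apply_of_ne_of_ne e1 e2]
          exact h2 x hx

end Bruhat

-- Bounded affine permutations as pairs of permutations

section PairExists

variable {n k : ℕ} [NeZero n]

/-- Boundedness allows each index to be shifted by zero or one period, and the displacement says
that exactly `k` are shifted. These indices determine `w`; then `v` is forced. -/
theorem exists_pairPerm {f : Equiv.Perm ℤ} (hf : f ∈ affinePerms n)
    (hb : ∀ j, j ≤ f j ∧ f j ≤ j + n) (hd : displacement n f = k * n) :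
    k ≤ n ∧ ∃ v w : Equiv.Perm (Fin n), IsGrassmannian k w ∧ f = pairPerm k v w := by
  have hn : 0 < n := Nat.pos_of_ne_zero (NeZero.ne n)
  obtain ⟨g, m, hg⟩ := exists_perm_coord hf
  have hg0 : ∀ i : Fin n, f ((i : ℤ) + 1) = (g i : ℤ) + 1 + n * m i := fun i => by
    have := hg 0 i
    rwa [mul_zero, add_zero, zero_add] at this
  have hm : ∀ i, m i = 0 ∨ m i = 1 := by
    intro i
    have h1 := hb ((i : ℤ) + 1)
    rw [hg0] at h1
    have h2 := (g i).2
    have h3 := i.2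
    have h4 : -1 < m i := by
      by_contra h
      have := mul_le_mul_of_nonneg_left (show m i ≤ -1 by omega) (show (0 : ℤ) ≤ n by omega)
      omega
    have h5 : m i < 2 := by
      by_contra h
      have := mul_le_mul_of_nonneg_left (show 2 ≤ m i by omega) (show (0 : ℤ) ≤ n by omega)
      omega
    omega
  set S : Finset (Fin n) := Finset.univ.filter fun i => m i = 1 with hS
  have hcard : S.card = k := by
    have h1 : displacement n f = n * ∑ i, m i := by
      unfold displacement
      have h2 : ∀ i : Fin n, f ((i : ℤ) + 1) - ((i : ℤ) + 1) = (g i : ℤ) - i + n * m i :=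
        fun i => by rw [hg0]; ring
      rw [Finset.sum_congr rfl fun i _ => h2 i, Finset.sum_add_distrib, Finset.sum_sub_distrib,
        Equiv.sum_comp g (fun i : Fin n => (i : ℤ)), sub_self, zero_add, Finset.mul_sum]
    have h2 : ∑ i, m i = S.card := by
      rw [Finset.card_filter, Nat.cast_sum]
      refine Finset.sum_congr rfl fun i _ => ?_
      rcases hm i with h | h <;> simp [h]
    rw [hd, h2, mul_comm] at h1
    have := mul_left_cancel₀ (show (n : ℤ) ≠ 0 by omega) h1
    exact_mod_cast this.symm
  have hkn : k ≤ n := by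
    rw [← hcard]
    exact (Finset.card_le_univ S).trans_eq (Fintype.card_fin n)
  obtain ⟨w, hw, hwS⟩ := exists_isGrassmannian hkn S hcard
  refine ⟨hkn, w * g⁻¹, w, hw, ?_⟩
  ext j
  obtain ⟨t, i, rfl⟩ := exists_coord n j
  have h1 : (w * g⁻¹).symm (w i) = g i := by
    rw [Equiv.symm_apply_eq]
    simp
  have h2 : m i = if (w i : ℕ) < k then 1 else 0 := by
    have h3 := hwS i
    rw [hS, Finset.mem_filter] at h3
    rcases hm i with h | h
    · rw [h, if_neg]
      rw [h3, h]
      simp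
    · rw [h, if_pos]
      rw [h3, h]
      simp
  rw [hg, pairPerm_apply, h1, h2]

/-- These two conditions are the ones under which `v` lies below `w` in the Bruhat order by
`bruhatLE_of_isGrassmannian`. -/
theorem pairPerm_bounded_iff (v w : Equiv.Perm (Fin n)) :
    (∀ j, j ≤ pairPerm k v w j ∧ pairPerm k v w j ≤ j + n) ↔
      (∀ x : Fin n, (x : ℕ) < k → v.symm x ≤ w.symm x) ∧
        ∀ x : Fin n, k ≤ (x : ℕ) → w.symm x ≤ v.symm x := by
  have hn : 0 < n := Nat.pos_of_ne_zero (NeZero.ne n)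
  constructor
  · intro h
    refine ⟨fun x hx => ?_, fun x hx => ?_⟩
    · have h1 := (h ((w.symm x : Fin n) + 1 + n * 0)).2
      rw [pairPerm_apply, Equiv.apply_symm_apply, if_pos hx] at h1
      rw [Fin.le_def]
      omega
    · have h1 := (h ((w.symm x : Fin n) + 1 + n * 0)).1
      rw [pairPerm_apply, Equiv.apply_symm_apply, if_neg (not_lt.2 hx)] at h1
      rw [Fin.le_def]
      omega
  · rintro ⟨h1, h2⟩ j
    obtain ⟨t, i, rfl⟩ := exists_coord n j
    rw [pairPerm_apply, mul_add]
    have hi := i.2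
    have hv := (v.symm (w i)).2
    by_cases h : (w i : ℕ) < k
    · have := h1 _ h
      rw [Equiv.symm_apply_apply, Fin.le_def] at this
      rw [if_pos h]
      omega
    · have := h2 _ (not_lt.1 h)
      rw [Equiv.symm_apply_apply, Fin.le_def] at this
      rw [if_neg h]
      omega

end PairExists
end PositroidCatalan

namespace PositroidCatalan

open Polynomial

-- The counting polynomial in `q - 1`

section Count

variable {n k : ℕ}

theorem map_deogramSum {R S : Type*} [CommRing R] [CommRing S] (φ : R →+* S) (q : R) (k : ℕ)
    (lam : YoungDiagram) (sig tau : Equiv.Perm ℕ) :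
    φ (deogramSum q k lam sig tau) = deogramSum (φ q) k lam sig tau := by
  unfold deogramSum deogramTerm
  rw [map_sum]
  refine Finset.sum_congr rfl fun D _ => ?_
  split_ifs <;> simp

/-- Up to the order of `GL_k`, the number of matrices over a field with `q` elements with affine
permutation `f` is given by a polynomial in `q - 1`. -/
def HasCount (n k : ℕ) (f : ℤ → ℤ) (P : ℤ[X]) : Prop :=
  ∀ (F : Type) [Field F] [Finite F], (Nat.card (matSet n k F f) : ℤ) =
    Nat.card (GL (Fin k) F) * P.eval ((Nat.card F : ℤ) - 1)

/-- The prime fields already give infinitely many evaluation points. -/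
theorem eq_of_eval_card_sub_one {P Q : ℤ[X]} (h : ∀ (F : Type) [Field F] [Finite F],
    P.eval ((Nat.card F : ℤ) - 1) = Q.eval ((Nat.card F : ℤ) - 1)) : P = Q := by
  apply Polynomial.eq_of_infinite_eval_eq
  refine Set.Infinite.mono (s := (fun p : ℕ => (p : ℤ) - 1) '' {p | p.Prime}) ?_ ?_
  · rintro _ ⟨p, hp, rfl⟩
    have : Fact p.Prime := ⟨hp⟩
    have := h (ZMod p)
    rwa [Nat.card_zmod] at this
  · exact Nat.infinite_setOfPred_prime.image fun x _ y _ h => by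
      simp only [sub_left_inj, Nat.cast_inj] at h
      exact h

theorem HasCount.unique {f : ℤ → ℤ} {P Q : ℤ[X]} (hP : HasCount n k f P) (hQ : HasCount n k f Q) :
    P = Q := by
  refine eq_of_eval_card_sub_one fun F _ _ => ?_
  have h := (hP F).symm.trans (hQ F)
  exact mul_left_cancel₀ (by exact_mod_cast Nat.card_pos.ne') h

open Classical in
/-- The polynomial of `HasCount`, if it exists. -/
noncomputable def countPoly (n k : ℕ) (f : ℤ → ℤ) : ℤ[X] :=
  if h : ∃ P, HasCount n k f P then h.choose else 0

theorem HasCount.countPoly_eq {f : ℤ → ℤ} {P : ℤ[X]} (hP : HasCount n k f P) :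
    countPoly n k f = P := by
  have h : ∃ P, HasCount n k f P := ⟨P, hP⟩
  rw [countPoly, dif_pos h]
  exact h.choose_spec.unique hP

theorem hasCount_of_not_bounded (hn : 0 < n) {f : Equiv.Perm ℤ}
    (h : ¬ ∀ j, j ≤ f j ∧ f j ≤ j + n) : HasCount n k f 0 := fun F _ _ => by
  rw [natCard_matSet_of_not_bounded hn h]
  simp

theorem countPoly_of_not_bounded (hn : 0 < n) {f : Equiv.Perm ℤ}
    (h : ¬ ∀ j, j ≤ f j ∧ f j ≤ j + n) : countPoly n k f = 0 :=
  (hasCount_of_not_bounded hn h).countPoly_eq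

/-- Here `q` is replaced by `X + 1`, so that elbows become powers of `X` and all coefficients are
nonnegative. -/
theorem hasCount_pairPerm [NeZero n] (hkn : k ≤ n) {lam : YoungDiagram}
    (hlam : FitsIn lam k (n - k)) {w : Equiv.Perm (Fin n)} (hw : HasPathPerm k lam ∅ w)
    (v : Equiv.Perm (Fin n)) :
    HasCount n k (pairPerm k v w) (deogramSum (X + 1) k lam 1 (permExt v⁻¹)) := fun F _ _ => by
  rw [natCard_matSet_pairPerm hkn hlam hw, ← coe_evalRingHom, map_deogramSum]
  simp

section

variable [NeZero n]

theorem hasCount_countPoly {f : Equiv.Perm ℤ} (hf : f ∈ affinePerms n)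
    (hd : displacement n f = k * n) : HasCount n k f (countPoly n k f) := by
  by_cases hb : ∀ j, j ≤ f j ∧ f j ≤ j + n
  · obtain ⟨hkn, v, w, hw, rfl⟩ := exists_pairPerm hf hb hd
    obtain ⟨lam, hlam, hlw⟩ := hw.exists_youngDiagram hkn
    have h := hasCount_pairPerm hkn hlam hlw v
    rwa [h.countPoly_eq]
  · have h := hasCount_of_not_bounded (k := k) (Nat.pos_of_ne_zero (NeZero.ne n)) hb
    rwa [h.countPoly_eq]

theorem coeff_nonneg_of_mem_lifts {P : ℤ[X]} (hP : P ∈ Polynomial.lifts (Nat.castRingHom ℤ))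
    (e : ℕ) : 0 ≤ P.coeff e := by
  obtain ⟨Q, rfl⟩ := (Polynomial.mem_lifts _).1 hP
  rw [Polynomial.coeff_map]
  simp

theorem X_pow_mul_mem_lifts (d e : ℕ) :
    (X : ℤ[X]) ^ d * (X + 1) ^ e ∈ Polynomial.lifts (Nat.castRingHom ℤ) :=
  mul_mem (pow_mem (X_mem_lifts _) _) (pow_mem (add_mem (X_mem_lifts _) (one_mem _)) _)

theorem deogramTerm_mem_lifts (lam : YoungDiagram) (sig tau : Equiv.Perm ℕ) (D : Finset (ℕ × ℕ)) :
    deogramTerm (X + 1 : ℤ[X]) k lam sig tau D ∈ Polynomial.lifts (Nat.castRingHom ℤ) := by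
  unfold deogramTerm
  split_ifs
  · rw [add_sub_cancel_right]
    exact X_pow_mul_mem_lifts _ _
  · exact zero_mem _

/-- Each Deogram contributes `X^d (X + 1)^e`, which has natural number coefficients; hence no
cancellation can occur. -/
theorem countPoly_coeff_nonneg {f : Equiv.Perm ℤ} (hf : f ∈ affinePerms n)
    (hd : displacement n f = k * n) (e : ℕ) : 0 ≤ (countPoly n k f).coeff e := by
  by_cases hb : ∀ j, j ≤ f j ∧ f j ≤ j + n
  · obtain ⟨hkn, v, w, hw, rfl⟩ := exists_pairPerm hf hb hd
    obtain ⟨lam, hlam, hlw⟩ := hw.exists_youngDiagram hkn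
    rw [(hasCount_pairPerm hkn hlam hlw v).countPoly_eq]
    exact coeff_nonneg_of_mem_lifts (sum_mem fun D _ => deogramTerm_mem_lifts _ _ _ _) e
  · rw [countPoly_of_not_bounded (Nat.pos_of_ne_zero (NeZero.ne n)) hb, coeff_zero]

/-- The number of elbows of every Deogram occurs as an exponent. -/
theorem deogramSum_coeff_pos {lam : YoungDiagram} {sig tau : Equiv.Perm ℕ} {D : Finset (ℕ × ℕ)}
    (hD : D ⊆ lam.cells) (h : IsRelabeledDeogram k lam sig tau D) :
    0 < (deogramSum (X + 1 : ℤ[X]) k lam sig tau).coeff D.card := by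
  unfold deogramSum
  rw [finsetSum_coeff]
  refine lt_of_lt_of_le ?_ (Finset.single_le_sum
    (fun D _ => coeff_nonneg_of_mem_lifts (deogramTerm_mem_lifts _ _ _ _) _)
    (Finset.mem_powerset.2 hD))
  rw [deogramTerm, if_pos h, add_sub_cancel_right, coeff_X_pow_mul', if_pos le_rfl, Nat.sub_self,
    coeff_zero_eq_eval_zero]
  simp

-- Below degree `e` everything vanishes, so every Deogram has at least `e` elbows, and those with
-- exactly `e` contribute constant term one after removal of `X^e`.
open Classical in
theorem deogramSum_coeff {lam : YoungDiagram} {sig tau : Equiv.Perm ℕ} {e : ℕ}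
    (he : ∀ d < e, (deogramSum (X + 1 : ℤ[X]) k lam sig tau).coeff d = 0) :
    (deogramSum (X + 1 : ℤ[X]) k lam sig tau).coeff e =
      (lam.cells.powerset.filter fun D => IsRelabeledDeogram k lam sig tau D ∧ D.card = e).card := by
  have hle : ∀ D ∈ lam.cells.powerset, IsRelabeledDeogram k lam sig tau D → e ≤ D.card := by
    intro D hD h
    by_contra hlt
    have := deogramSum_coeff_pos (Finset.mem_powerset.1 hD) h
    rw [he _ (not_le.1 hlt)] at this
    exact lt_irrefl _ this
  rw [Finset.card_filter, Nat.cast_sum]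
  conv_lhs => unfold deogramSum
  rw [finsetSum_coeff]
  refine Finset.sum_congr rfl fun D hD => ?_
  unfold deogramTerm
  by_cases h : IsRelabeledDeogram k lam sig tau D
  · rw [if_pos h, add_sub_cancel_right, coeff_X_pow_mul']
    by_cases hc : D.card = e
    · rw [if_pos hc.le, if_pos ⟨h, hc⟩, hc, Nat.sub_self, coeff_zero_eq_eval_zero]
      simp
    · rw [if_neg, if_neg (fun h' => hc h'.2)]
      · simp
      · have := hle D hD h
        omega
  · rw [if_neg h, if_neg (fun h' => h h'.1)]
    simp

/-- If `f` and its inverse order `p` and `p + 1` differently, then the count does not change under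
conjugation. -/
theorem countPoly_conj_of_lt_of_gt (hn : 2 ≤ n) {f : Equiv.Perm ℤ} (hf : f ∈ affinePerms n)
    (hd : displacement n f = k * n) {p : ℤ} (h1 : f p < f (p + 1)) (h2 : f⁻¹ (p + 1) < f⁻¹ p) :
    countPoly n k (affineSwap hn p * f * affineSwap hn p : Equiv.Perm ℤ) = countPoly n k f := by
  refine HasCount.countPoly_eq fun F _ _ => ?_
  -- The transposition could reverse the order only if `f` fixed both classes modulo `n`; then `f⁻¹`
  -- would order `p`, `p + 1` as `f` does.
  have hlt' : affineSwap hn p (f p) < affineSwap hn p (f (p + 1)) := by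
    rw [affineSwap_lt_iff hn]
    · exact h1
    · rintro ⟨⟨m, hm⟩, h3⟩
      have h4 : f⁻¹ p = p + n * (-m) := by
        rw [Equiv.Perm.inv_eq_iff_eq, affinePerms_add_mul hf]
        linarith
      have h5 : f⁻¹ (p + 1) = p + 1 + n * (-m) := by
        rw [Equiv.Perm.inv_eq_iff_eq, affinePerms_add_mul hf]
        linarith
      linarith
    · rintro ⟨-, h3⟩
      linarith
  have hinv : affineSwap hn p (f⁻¹ (p + 1)) < affineSwap hn p (f⁻¹ p) := by
    rw [affineSwap_lt_iff hn]
    · exact h2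
    · rintro ⟨⟨m, hm⟩, h3⟩
      have h4 : f (p + n * m) = p + 1 := by
        rw [← Equiv.Perm.eq_inv_iff_eq]
        linarith
      have h5 : f (p + 1 + n * m) = p := by
        rw [← Equiv.Perm.eq_inv_iff_eq]
        linarith
      rw [affinePerms_add_mul hf] at h4 h5
      linarith
    · rintro ⟨-, h3⟩
      linarith
  rw [← natCard_matSet_of_gt hn hf h1 hlt' hinv]
  exact hasCount_countPoly hf hd F

/-- Conjugation exchanges this situation with that of `countPoly_conj_of_lt_of_gt`. -/
theorem countPoly_conj_of_gt_of_lt (hn : 2 ≤ n) {f : Equiv.Perm ℤ} (hf : f ∈ affinePerms n)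
    (hd : displacement n f = k * n) {p : ℤ} (h1 : f (p + 1) < f p) (h2 : f⁻¹ p < f⁻¹ (p + 1)) :
    countPoly n k (affineSwap hn p * f * affineSwap hn p : Equiv.Perm ℤ) = countPoly n k f := by
  have hs := affineSwap_mem hn p
  have key := countPoly_conj_of_lt_of_gt (k := k) hn (p := p)
    (f := affineSwap hn p * f * affineSwap hn p)
    (Subgroup.mul_mem _ (Subgroup.mul_mem _ hs hf) hs)
    (by rw [displacement_affineSwap_conj hn hf, hd]) ?_ ?_
  · rw [← key]
    congr 1
    ext j
    simp [affineSwap_affineSwap]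
  · simp only [Equiv.Perm.mul_apply, affineSwap_self, affineSwap_succ]
    rw [affineSwap_lt_iff hn]
    · exact h1
    · rintro ⟨⟨m, hm⟩, h3⟩
      have h4 : f⁻¹ p = p + 1 + n * (-m) := by
        rw [Equiv.Perm.inv_eq_iff_eq, affinePerms_add_mul hf]
        linarith
      have h5 : f⁻¹ (p + 1) = p + n * (-m) := by
        rw [Equiv.Perm.inv_eq_iff_eq, affinePerms_add_mul hf]
        linarith
      linarith
    · rintro ⟨-, h3⟩
      linarith
  · simp only [mul_inv_rev, affineSwap_inv, Equiv.Perm.mul_apply, affineSwap_self, affineSwap_succ]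
    rw [affineSwap_lt_iff hn]
    · exact h2
    · rintro ⟨⟨m, hm⟩, h3⟩
      have h4 : f (p + n * m) = p := by
        rw [← Equiv.Perm.eq_inv_iff_eq]
        linarith
      have h5 : f (p + 1 + n * m) = p + 1 := by
        rw [← Equiv.Perm.eq_inv_iff_eq]
        linarith
      rw [affinePerms_add_mul hf] at h4 h5
      linarith
    · rintro ⟨-, h3⟩
      linarith

/-- The excluded case is the one where `f` commutes with the transposition; there conjugation
returns `f` itself and does not produce crossings. -/
theorem countPoly_of_lt_of_lt (hn : 2 ≤ n) {f : Equiv.Perm ℤ} (hf : f ∈ affinePerms n)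
    (hd : displacement n f = k * n) {p : ℤ} (h1 : f p < f (p + 1)) (h2 : f⁻¹ p < f⁻¹ (p + 1))
    (hne : ¬ ((n : ℤ) ∣ f p - p ∧ f (p + 1) = f p + 1)) :
    countPoly n k f =
      (X + 1) * countPoly n k (affineSwap hn p * f * affineSwap hn p : Equiv.Perm ℤ) +
        X * countPoly n k (f * affineSwap hn p : Equiv.Perm ℤ) := by
  have hs := affineSwap_mem hn p
  refine HasCount.countPoly_eq fun F _ _ => ?_
  have hlt' : affineSwap hn p (f p) < affineSwap hn p (f (p + 1)) := by
    rw [affineSwap_lt_iff hn]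
    · exact h1
    · exact hne
    · rintro ⟨-, h3⟩
      linarith
  have hinv : affineSwap hn p (f⁻¹ p) < affineSwap hn p (f⁻¹ (p + 1)) := by
    rw [affineSwap_lt_iff hn]
    · exact h2
    · rintro ⟨⟨m, hm⟩, h3⟩
      have h4 : f (p + n * m) = p := by
        rw [← Equiv.Perm.eq_inv_iff_eq]
        linarith
      have h5 : f (p + 1 + n * m) = p + 1 := by
        rw [← Equiv.Perm.eq_inv_iff_eq]
        linarith
      rw [affinePerms_add_mul hf] at h4 h5
      exact hne ⟨⟨-m, by linarith⟩, by linarith⟩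
    · rintro ⟨-, h3⟩
      linarith
  have hq : 1 ≤ Nat.card F := Nat.card_pos
  rw [natCard_matSet_of_lt hn hf h1 hlt' hinv, Nat.cast_add, Nat.cast_mul, Nat.cast_mul,
    Nat.cast_sub hq, Nat.cast_one,
    hasCount_countPoly (k := k) (Subgroup.mul_mem _ (Subgroup.mul_mem _ hs hf) hs)
      (by rw [displacement_affineSwap_conj hn hf, hd]) F,
    hasCount_countPoly (k := k) (Subgroup.mul_mem _ hf hs)
      (by rw [displacement_mul_affineSwap hn hf, hd]) F]
  simp only [eval_add, eval_mul, eval_X, eval_one]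
  ring

end

end Count
end PositroidCatalan

namespace PositroidCatalan

-- Cycles modulo `n` through invariant functions

section Cycles

variable {n k : ℕ}

/-- The rational functions on `ℤ` that are periodic modulo `n` and invariant under `f`, that is, the
functions on the cycles of `f` modulo `n`. -/
def invariants (n : ℕ) (f : ℤ → ℤ) : Submodule ℚ (ℤ → ℚ) where
  carrier := {x | (∀ j, x (j + n) = x j) ∧ ∀ j, x (f j) = x j}
  add_mem' := fun {x y} hx hy =>
    ⟨fun j => by rw [Pi.add_apply, Pi.add_apply, hx.1, hy.1],
      fun j => by rw [Pi.add_apply, Pi.add_apply, hx.2, hy.2]⟩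
  zero_mem' := ⟨fun _ => rfl, fun _ => rfl⟩
  smul_mem' := fun c x hx =>
    ⟨fun j => by rw [Pi.smul_apply, Pi.smul_apply, hx.1],
      fun j => by rw [Pi.smul_apply, Pi.smul_apply, hx.2]⟩

/-- The number of cycles of `f` modulo `n`. -/
noncomputable def cycleNumber (n : ℕ) (f : ℤ → ℤ) : ℕ := Module.finrank ℚ (invariants n f)

theorem periodic_add_mul {α : Type*} {x : ℤ → α} (hx : ∀ j, x (j + n) = x j) (j m : ℤ) :
    x (j + n * m) = x j := by
  have h : Function.Periodic x ((n : ℤ)) := hx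
  have := h.int_mul m j
  rwa [mul_comm] at this

theorem periodic_of_dvd {α : Type*} {x : ℤ → α} (hx : ∀ j, x (j + n) = x j) {i j : ℤ}
    (h : (n : ℤ) ∣ i - j) : x i = x j := by
  obtain ⟨m, hm⟩ := h
  rw [show i = j + n * m by linarith, periodic_add_mul hx]

/-- The restriction of an invariant function to one period. -/
def invariantsRestrict (n : ℕ) (f : ℤ → ℤ) : invariants n f →ₗ[ℚ] (Fin n → ℚ) :=
  (LinearMap.funLeft ℚ ℚ fun i : Fin n => (i : ℤ) + 1).comp (invariants n f).subtype

theorem invariantsRestrict_injective [NeZero n] (f : ℤ → ℤ) :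
    Function.Injective (invariantsRestrict n f) := by
  intro x y h
  apply Subtype.ext
  funext j
  obtain ⟨m, i, rfl⟩ := exists_coord n j
  rw [periodic_add_mul x.2.1, periodic_add_mul y.2.1]
  exact congrFun h i

instance finite_invariants [NeZero n] (f : ℤ → ℤ) : Module.Finite ℚ (invariants n f) :=
  Module.Finite.of_injective _ (invariantsRestrict_injective f)

theorem cycleNumber_le [NeZero n] (f : ℤ → ℤ) : cycleNumber n f ≤ n := by
  have h := LinearMap.finrank_le_finrank_of_injective (invariantsRestrict_injective (n := n) f)
  rwa [Module.finrank_fin_fun] at h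

theorem cycleNumber_eq_of_forall_dvd [NeZero n] {f : ℤ → ℤ} (h : ∀ j, (n : ℤ) ∣ f j - j) :
    cycleNumber n f = n := by
  refine le_antisymm (cycleNumber_le f) ?_
  set L : (Fin n → ℚ) →ₗ[ℚ] (ℤ → ℚ) := LinearMap.funLeft ℚ ℚ fun j => ((coordEquiv n).symm j).2
    with hL
  have hper : ∀ (y : Fin n → ℚ) (j : ℤ), L y (j + n) = L y j := by
    intro y j
    obtain ⟨m, i, rfl⟩ := exists_coord n j
    rw [show (i : ℤ) + 1 + n * m + n = (i : ℤ) + 1 + n * (m + 1) by ring, hL,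
      LinearMap.funLeft_apply, LinearMap.funLeft_apply, ← coordEquiv_apply, ← coordEquiv_apply,
      Equiv.symm_apply_apply, Equiv.symm_apply_apply]
  have hmem : ∀ y, L y ∈ invariants n f := fun y => ⟨hper y, fun j => periodic_of_dvd (hper y) (h j)⟩
  have hinj : Function.Injective (L.codRestrict (invariants n f) hmem) := by
    intro y z hyz
    funext i
    have := congrFun (Subtype.ext_iff.1 hyz) ((i : ℤ) + 1 + n * 0)
    change y ((coordEquiv n).symm _).2 = z ((coordEquiv n).symm _).2 at this
    rwa [← coordEquiv_apply, Equiv.symm_apply_apply] at this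
  have h := LinearMap.finrank_le_finrank_of_injective hinj
  rwa [Module.finrank_fin_fun] at h

theorem cycleNumber_affineSwap_conj_le [NeZero n] (hn : 2 ≤ n) (f : Equiv.Perm ℤ) (p : ℤ) :
    cycleNumber n f ≤ cycleNumber n (affineSwap hn p * f * affineSwap hn p : Equiv.Perm ℤ) := by
  set L : (ℤ → ℚ) →ₗ[ℚ] (ℤ → ℚ) := LinearMap.funLeft ℚ ℚ (affineSwap hn p) with hL
  have hmem : ∀ x : invariants n f, (L.comp (invariants n f).subtype) x ∈
      invariants n (affineSwap hn p * f * affineSwap hn p : Equiv.Perm ℤ) := by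
    intro x
    refine ⟨fun j => ?_, fun j => ?_⟩
    · change x.1 (affineSwap hn p (j + n)) = x.1 (affineSwap hn p j)
      rw [affineSwap_mem hn p j, x.2.1]
    · change x.1 (affineSwap hn p (affineSwap hn p (f (affineSwap hn p j)))) =
        x.1 (affineSwap hn p j)
      rw [affineSwap_affineSwap, x.2.2]
  refine LinearMap.finrank_le_finrank_of_injective
    (f := (L.comp (invariants n f).subtype).codRestrict _ hmem) ?_
  intro x y hxy
  apply Subtype.ext
  funext j
  have := congrFun (Subtype.ext_iff.1 hxy) (affineSwap hn p j)
  change x.1 (affineSwap hn p (affineSwap hn p j)) = y.1 (affineSwap hn p (affineSwap hn p j)) at this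
  rwa [affineSwap_affineSwap] at this

theorem affineSwap_conj_conj (hn : 2 ≤ n) (f : Equiv.Perm ℤ) (p : ℤ) :
    affineSwap hn p * (affineSwap hn p * f * affineSwap hn p) * affineSwap hn p = f := by
  ext j
  simp [affineSwap_affineSwap]

theorem cycleNumber_affineSwap_conj [NeZero n] (hn : 2 ≤ n) (f : Equiv.Perm ℤ) (p : ℤ) :
    cycleNumber n (affineSwap hn p * f * affineSwap hn p : Equiv.Perm ℤ) = cycleNumber n f := by
  refine le_antisymm ?_ (cycleNumber_affineSwap_conj_le hn f p)
  have := cycleNumber_affineSwap_conj_le hn (affineSwap hn p * f * affineSwap hn p) p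
  rwa [affineSwap_conj_conj] at this

theorem periodic_affineSwap {x : ℤ → ℚ} (hn : 2 ≤ n) {p : ℤ} (hx : ∀ j, x (j + n) = x j)
    (hp : x p = x (p + 1)) (j : ℤ) : x (affineSwap hn p j) = x j := by
  rcases affineSwap_cases hn p j with ⟨h1, h2⟩ | ⟨h1, h2⟩ | ⟨-, -, h2⟩
  · rw [h2, periodic_of_dvd hx h1]
    refine (periodic_of_dvd hx ?_).trans hp.symm
    rwa [add_sub_add_right_eq_sub]
  · rw [h2, periodic_of_dvd hx h1, ← hp]
    refine (periodic_of_dvd hx ?_)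
    rwa [sub_sub, add_comm 1 p]
  · rw [h2]

/-- Invariant functions taking equal values at `p` and `p + 1` are also invariant under the product,
and this is a single linear condition. -/
theorem cycleNumber_le_mul_affineSwap [NeZero n] (hn : 2 ≤ n) (f : Equiv.Perm ℤ) (p : ℤ) :
    cycleNumber n f ≤ cycleNumber n (f * affineSwap hn p : Equiv.Perm ℤ) + 1 := by
  set L : invariants n f →ₗ[ℚ] ℚ :=
    (LinearMap.proj (R := ℚ) (φ := fun _ : ℤ => ℚ) p - LinearMap.proj (p + 1)).comp (invariants n f).subtype
    with hL
  have h1 := LinearMap.finrank_range_add_finrank_ker L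
  have h2 : Module.finrank ℚ (LinearMap.range L) ≤ 1 := by
    have := Submodule.finrank_le (LinearMap.range L)
    rwa [Module.finrank_self] at this
  have hmem : ∀ x : LinearMap.ker L, ((invariants n f).subtype.comp (LinearMap.ker L).subtype) x ∈
      invariants n (f * affineSwap hn p : Equiv.Perm ℤ) := by
    rintro ⟨x, hx⟩
    have hp : x.1 p = x.1 (p + 1) := sub_eq_zero.1 (LinearMap.mem_ker.1 hx)
    refine ⟨x.2.1, fun j => ?_⟩
    change x.1 (f (affineSwap hn p j)) = x.1 j
    rw [x.2.2, periodic_affineSwap hn x.2.1 hp]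
  have h3 := LinearMap.finrank_le_finrank_of_injective
    (f := ((invariants n f).subtype.comp (LinearMap.ker L).subtype).codRestrict _ hmem)
    (fun x y hxy => by
      have := Subtype.ext_iff.1 hxy
      exact Subtype.ext (Subtype.ext this))
  unfold cycleNumber
  omega

theorem cycleNumber_mul_affineSwap_le [NeZero n] (hn : 2 ≤ n) (f : Equiv.Perm ℤ) (p : ℤ) :
    cycleNumber n (f * affineSwap hn p : Equiv.Perm ℤ) ≤ cycleNumber n f + 1 := by
  have := cycleNumber_le_mul_affineSwap hn (f * affineSwap hn p) p
  rwa [mul_assoc, affineSwap_mul_self, mul_one] at this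

/-- A separating function shows that multiplication by a transposition splits a cycle. -/
theorem cycleNumber_mul_affineSwap_of_separating [NeZero n] (hn : 2 ≤ n) {f : Equiv.Perm ℤ} {p : ℤ}
    (hf : ∀ x ∈ invariants n f, x p = x (p + 1)) {y : ℤ → ℚ}
    (hy : y ∈ invariants n (f * affineSwap hn p : Equiv.Perm ℤ)) (hyp : y p ≠ y (p + 1)) :
    cycleNumber n (f * affineSwap hn p : Equiv.Perm ℤ) = cycleNumber n f + 1 := by
  refine le_antisymm (cycleNumber_mul_affineSwap_le hn f p) ?_
  refine Submodule.finrank_lt_finrank_of_lt (lt_of_le_of_ne ?_ ?_)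
  · intro x hx
    refine ⟨hx.1, fun j => ?_⟩
    change x (f (affineSwap hn p j)) = x j
    rw [hx.2, periodic_affineSwap hn hx.1 (hf x hx)]
  · intro h
    rw [← h] at hy
    exact hyp (hf y hy)

/-- A residue fixed by `g` is a cycle of its own, so its indicator function is invariant and
separates it from everything else. -/
theorem indicator_mem_invariants {g : Equiv.Perm ℤ} (hg : g ∈ affinePerms n) {r : ℤ}
    (h : (n : ℤ) ∣ g r - r) : (fun j : ℤ => if (n : ℤ) ∣ j - r then (1 : ℚ) else 0) ∈
      invariants n g := by
  obtain ⟨m, hm⟩ := h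
  refine ⟨fun j => ?_, fun j => ?_⟩
  · simp only [show j + n - r = j - r + n by ring, dvd_add_self_right]
  · have key : (n : ℤ) ∣ g j - r ↔ (n : ℤ) ∣ j - r := by
      constructor
      · rintro ⟨t, ht⟩
        have h1 : g j = g (r + n * (t - m)) := by
          rw [affinePerms_add_mul hg]
          linarith
        exact ⟨t - m, by rw [g.injective h1]; ring⟩
      · rintro ⟨t, ht⟩
        refine ⟨t + m, ?_⟩
        rw [show j = r + n * t by linarith, affinePerms_add_mul hg]
        linarith
    simp only [key]

/-- Multiplication by a transposition that produces a fixed point splits a cycle. -/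
theorem cycleNumber_mul_affineSwap_of_fixed [NeZero n] (hn : 2 ≤ n) {f : Equiv.Perm ℤ}
    (hf : f ∈ affinePerms n) {p : ℤ} (h : (n : ℤ) ∣ f p - (p + 1) ∨ (n : ℤ) ∣ f (p + 1) - p) :
    cycleNumber n (f * affineSwap hn p : Equiv.Perm ℤ) = cycleNumber n f + 1 := by
  have hg := Subgroup.mul_mem _ hf (affineSwap_mem hn p)
  have h1 := two_le_not_dvd_one hn
  rcases h with h | h
  · refine cycleNumber_mul_affineSwap_of_separating hn (fun x hx => ?_)
      (indicator_mem_invariants hg (r := p + 1) ?_) ?_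
    · rw [← hx.2 p, periodic_of_dvd hx.1 h]
    · rwa [Equiv.Perm.mul_apply, affineSwap_succ]
    · simp only [sub_self, dvd_zero, if_true, sub_add_cancel_left, dvd_neg, h1, if_false]
      norm_num
  · refine cycleNumber_mul_affineSwap_of_separating hn (fun x hx => ?_)
      (indicator_mem_invariants hg (r := p) ?_) ?_
    · rw [← hx.2 (p + 1), periodic_of_dvd hx.1 h]
    · rwa [Equiv.Perm.mul_apply, affineSwap_self]
    · simp only [sub_self, dvd_zero, if_true, add_sub_cancel_left, h1, if_false]
      norm_num

end Cycles

-- Divisibility by a power of `q - 1`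

section Divisibility

open Polynomial

variable {n k : ℕ} [NeZero n]

/-- Induction over corners. Conjugation preserves the cycle number; multiplication by the
transposition adds at most one cycle, and that term carries an extra factor `X`. -/
theorem X_pow_dvd_deogramSum (hkn : k ≤ n) {lam : YoungDiagram}
    (hlam : FitsIn lam k (n - k)) {w : Equiv.Perm (Fin n)} (hw : HasPathPerm k lam ∅ w)
    (v : Equiv.Perm (Fin n)) : (X : ℤ[X]) ^ (n - cycleNumber n (pairPerm k v w)) ∣
      deogramSum (X + 1) k lam 1 (permExt v⁻¹) := by
  induction hN : lam.cells.card generalizing lam w v with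
  | zero =>
    have hbot : lam = ⊥ := YoungDiagram.ext (Finset.card_eq_zero.1 hN)
    subst hbot
    have hw1 : w = 1 := eq_one_of_hasPathPerm_bot hkn hlam hw
    subst hw1
    rw [deogramSum_bot]
    by_cases hv : v = 1
    · rw [cycleNumber_eq_of_forall_dvd, Nat.sub_self, pow_zero]
      · exact one_dvd _
      · intro j
        obtain ⟨m, i, rfl⟩ := exists_coord n j
        rw [hv, pairPerm_one_one_apply, add_sub_cancel_left]
        split_ifs <;> simp
    · rw [if_neg]
      · exact dvd_zero _
      · intro h
        rw [← permExt_one (n := n)] at h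
        exact hv (inv_eq_one.1 (permExt_injective h).symm)
  | succ N ih =>
    obtain ⟨r, c, h⟩ := exists_isCorner (lam := lam) (Finset.card_pos.1 (by omega))
    have hcard : (eraseCorner h).cells.card = N := by
      rw [cells_eraseCorner, Finset.card_erase_of_mem h.1]
      omega
    have hlam' : FitsIn (eraseCorner h) k (n - k) := fun x y hxy =>
      hlam x y ((mem_eraseCorner h).1 hxy).2
    have hrc := hlam r c h.1
    have hn : 2 ≤ n := by omega
    obtain ⟨a, ha⟩ : ∃ a : Fin n, (a : ℕ) = k - 1 - r + c := ⟨⟨k - 1 - r + c, by omega⟩, rfl⟩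
    obtain ⟨b, hb⟩ : ∃ b : Fin n, (b : ℕ) = a + 1 := ⟨⟨a + 1, by omega⟩, rfl⟩
    have hw' := (hasPathPerm_eraseCorner hkn hlam h (Finset.notMem_empty _) ha hb).1 hw
    have hdual : Equiv.swap (a : ℕ) (a + 1) * permExt v⁻¹ = permExt (v * Equiv.swap a b)⁻¹ := by
      rw [mul_inv_rev, Equiv.swap_inv, permExt_mul, permExt_swap, hb]
    have i1 := ih hlam' hw' (v * Equiv.swap a b) hcard
    have i2 := ih hlam' hw' v hcard
    rw [pairPerm_swap_mul_swap hn hb, cycleNumber_affineSwap_conj] at i1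
    rw [pairPerm_mul_swap hn hb] at i2
    have h3 := cycleNumber_mul_affineSwap_le hn (pairPerm k v w) ((a : ℤ) + 1)
    rw [deogramSum_one_corner _ hlam.row_lt h]
    unfold leftOpDual
    rw [← ha, hdual, add_sub_cancel_right]
    split_ifs
    · refine dvd_add (i1.mul_left _) ?_
      refine (pow_dvd_pow X (show n - cycleNumber n (pairPerm k v w) ≤
        n - cycleNumber n (pairPerm k v w * affineSwap hn ((a : ℤ) + 1) : Equiv.Perm ℤ) + 1
        by omega)).trans ?_
      rw [pow_succ']
      exact mul_dvd_mul_left _ i2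
    · exact i1

/-- The count is divisible by a power of `q - 1`. -/
theorem X_pow_dvd_countPoly {f : Equiv.Perm ℤ} (hf : f ∈ affinePerms n)
    (hd : displacement n f = k * n) : (X : ℤ[X]) ^ (n - cycleNumber n f) ∣ countPoly n k f := by
  by_cases hb : ∀ j, j ≤ f j ∧ f j ≤ j + n
  · obtain ⟨hkn, v, w, hw, rfl⟩ := exists_pairPerm hf hb hd
    obtain ⟨lam, hlam, hlw⟩ := hw.exists_youngDiagram hkn
    rw [(hasCount_pairPerm hkn hlam hlw v).countPoly_eq]
    exact X_pow_dvd_deogramSum hkn hlam hlw v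
  · rw [countPoly_of_not_bounded (Nat.pos_of_ne_zero (NeZero.ne n)) hb]
    exact dvd_zero _

theorem countPoly_coeff_eq_zero {f : Equiv.Perm ℤ} (hf : f ∈ affinePerms n)
    (hd : displacement n f = k * n) {e : ℕ} (he : e + cycleNumber n f < n) :
    (countPoly n k f).coeff e = 0 :=
  X_pow_dvd_iff.1 (X_pow_dvd_countPoly hf hd) e (by omega)

end Divisibility
end PositroidCatalan

namespace PositroidCatalan

open Polynomial

-- Positivity of the lowest coefficient

section Positivity

variable {n k : ℕ}

theorem bounded_mul_affineSwap (hn : 2 ≤ n) {f : Equiv.Perm ℤ} (hf : f ∈ affinePerms n)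
    (hb : ∀ j, j ≤ f j ∧ f j ≤ j + n) {p : ℤ} (h1 : p + 1 ≤ f p) (h2 : f (p + 1) ≤ p + n) (j : ℤ) :
    j ≤ (f * affineSwap hn p) j ∧ (f * affineSwap hn p) j ≤ j + n := by
  rw [Equiv.Perm.mul_apply]
  rcases affineSwap_cases hn p j with ⟨⟨m, hm⟩, h⟩ | ⟨⟨m, hm⟩, h⟩ | ⟨-, -, h⟩
  · have := hb (p + 1)
    rw [h, show j = p + n * m by linarith, show p + n * m + 1 = p + 1 + n * m by ring,
      affinePerms_add_mul hf]
    omega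
  · have := hb p
    rw [h, show j = p + 1 + n * m by linarith, show p + 1 + n * m - 1 = p + n * m by ring,
      affinePerms_add_mul hf]
    omega
  · rw [h]
    exact hb j

/-- The transposition preserves all inequalities except those between two exchanged neighbors, and
these would require one of the two excluded values. -/
theorem bounded_affineSwap_conj (hn : 2 ≤ n) {f : Equiv.Perm ℤ} (hf : f ∈ affinePerms n)
    (hb : ∀ j, j ≤ f j ∧ f j ≤ j + n) {p : ℤ} (h1 : f p ≠ p + 1) (h2 : f (p + 1) ≠ p + n) (j : ℤ) :
    j ≤ (affineSwap hn p * f * affineSwap hn p) j ∧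
      (affineSwap hn p * f * affineSwap hn p) j ≤ j + n := by
  rw [Equiv.Perm.mul_apply, Equiv.Perm.mul_apply]
  obtain ⟨x, rfl⟩ := (affineSwap hn p).surjective j
  rw [affineSwap_affineSwap, ← affineSwap_mem hn p, ← not_lt, ← not_lt]
  have hx := hb x
  rw [affineSwap_lt_iff hn, affineSwap_lt_iff hn]
  · omega
  · rintro ⟨-, h⟩
    omega
  · rintro ⟨⟨m, hm⟩, h⟩
    apply h2
    have h3 : x = p + 1 + n * (m - 1) := by linarith
    rw [h3, affinePerms_add_mul hf] at h
    linarith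
  · rintro ⟨-, h⟩
    omega
  · rintro ⟨⟨m, hm⟩, h⟩
    apply h1
    have h3 : x = p + n * m := by linarith
    rw [h3, affinePerms_add_mul hf] at h
    linarith

theorem not_bounded_affineSwap_conj (hn : 2 ≤ n) {f : Equiv.Perm ℤ}
    {p : ℤ} (h : f p = p + 1 ∨ f (p + 1) = p + n) :
    ¬ ∀ j, j ≤ (affineSwap hn p * f * affineSwap hn p) j ∧
      (affineSwap hn p * f * affineSwap hn p) j ≤ j + n := by
  intro hb
  rcases h with h | h
  · have := (hb (p + 1)).1
    rw [Equiv.Perm.mul_apply, Equiv.Perm.mul_apply, affineSwap_succ, h, affineSwap_succ] at this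
    omega
  · have := (hb p).2
    rw [Equiv.Perm.mul_apply, Equiv.Perm.mul_apply, affineSwap_self, h, affineSwap_mem hn p,
      affineSwap_self] at this
    omega

variable [NeZero n]

/-- If all residues are fixed, then `v = w`, and the filling by crossings only is a Deogram without
elbows. -/
theorem countPoly_coeff_zero_pos {f : Equiv.Perm ℤ} (hf : f ∈ affinePerms n)
    (hb : ∀ j, j ≤ f j ∧ f j ≤ j + n) (hd : displacement n f = k * n)
    (h : ∀ j, (n : ℤ) ∣ f j - j) : 0 < (countPoly n k f).coeff 0 := by
  obtain ⟨hkn, v, w, hw, rfl⟩ := exists_pairPerm hf hb hd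
  obtain ⟨lam, hlam, hlw⟩ := hw.exists_youngDiagram hkn
  have hvw : v = w := by
    ext i
    obtain ⟨m, hm⟩ := h ((i : ℤ) + 1 + n * 0)
    rw [pairPerm_apply] at hm
    have h1 : (v.symm (w i) : ℤ) + 1 + n * (0 + if (w i : ℕ) < k then 1 else 0) =
      (i : ℤ) + 1 + n * m := by linarith
    have h2 := (coord_inj h1).1
    rw [Equiv.symm_apply_eq] at h2
    rw [h2]
  rw [(hasCount_pairPerm hkn hlam hlw v).countPoly_eq, ← Finset.card_empty (α := ℕ × ℕ)]
  refine deogramSum_coeff_pos (Finset.empty_subset _)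
    ⟨fun x hx => absurd hx (Finset.notMem_empty x), ?_⟩
  rw [hvw]
  exact (hasPathPerm_iff hkn hlam w).1 hlw

/-- A split of a cycle in which the conjugate is not bounded. -/
theorem countPoly_coeff_pos_of_split (hn : 2 ≤ n) {f : Equiv.Perm ℤ} (hf : f ∈ affinePerms n)
    (hb : ∀ j, j ≤ f j ∧ f j ≤ j + n) (hd : displacement n f = k * n)
    (IH : ∀ g ∈ affinePerms n, (∀ j, j ≤ g j ∧ g j ≤ j + n) → displacement n g = k * n →
      n - cycleNumber n g < n - cycleNumber n f → 0 < (countPoly n k g).coeff (n - cycleNumber n g))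
    {p : ℤ} (h : f p = p + 1 ∨ f (p + 1) = p + n) (h1 : f p ≠ p) (h2 : f (p + 1) ≠ p + 1 + n) :
    0 < (countPoly n k f).coeff (n - cycleNumber n f) := by
  have hbp := hb p
  have hbp1 := hb (p + 1)
  have hne : f p ≠ f (p + 1) := fun h => by
    have := f.injective h
    omega
  have hinvp := hb (f⁻¹ p)
  have hinvp1 := hb (f⁻¹ (p + 1))
  have e1 : f (f⁻¹ p) = p := f.apply_symm_apply p
  have e2 : f (f⁻¹ (p + 1)) = p + 1 := f.apply_symm_apply (p + 1)
  rw [e1] at hinvp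
  rw [e2] at hinvp1
  have a1 : f p < f (p + 1) := by omega
  have hpn : f⁻¹ p ≠ p := fun h' => by
    rw [h'] at e1
    exact h1 e1
  have hp1n : f⁻¹ (p + 1) ≠ p + 1 - n := fun h' => by
    rw [h'] at e2
    apply h2
    have := hf (p + 1 - n)
    rw [sub_add_cancel, e2] at this
    exact this
  have a2 : f⁻¹ p < f⁻¹ (p + 1) := by
    rcases h with h | h
    · have h3 : f⁻¹ (p + 1) = p := by rw [Equiv.Perm.inv_eq_iff_eq, h]
      omega
    · have h3 : f⁻¹ p = p + 1 - n := by
        rw [Equiv.Perm.inv_eq_iff_eq]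
        have := hf (p + 1 - n)
        rw [sub_add_cancel, h] at this
        linarith
      omega
  have a3 : ¬ (n : ℤ) ∣ f p - p := fun h3 => by
    have h4 := Int.le_of_dvd (by omega) h3
    rcases h with h | h <;> omega
  have hg := Subgroup.mul_mem _ hf (affineSwap_mem hn p)
  have hcyc := cycleNumber_mul_affineSwap_of_fixed hn hf (p := p) (by
    rcases h with h | h
    · left
      rw [h, sub_self]
      exact dvd_zero _
    · right
      rw [h, add_sub_cancel_left])
  have hle := cycleNumber_le (n := n) (f * affineSwap hn p : Equiv.Perm ℤ)
  have := IH _ hg (bounded_mul_affineSwap hn hf hb (by omega) (by omega))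
    (by rw [displacement_mul_affineSwap hn hf, hd]) (by omega)
  -- The conjugate contributes nothing, so the count is `X` times that of the product, which has one
  -- more cycle and falls under the induction hypothesis.
  rw [countPoly_of_lt_of_lt hn hf hd a1 a2 fun h => a3 h.1, countPoly_of_not_bounded
    (Nat.pos_of_ne_zero (NeZero.ne n)) (not_bounded_affineSwap_conj hn h), mul_zero, zero_add,
    show n - cycleNumber n f = n - cycleNumber n (f * affineSwap hn p : Equiv.Perm ℤ) + 1 by omega,
    coeff_X_mul]
  exact this

/-- In the recursion all terms besides the conjugate itself have nonnegative coefficients. -/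
theorem countPoly_coeff_conj_le (hn : 2 ≤ n) {f : Equiv.Perm ℤ} (hf : f ∈ affinePerms n)
    (hd : displacement n f = k * n) {p : ℤ} (h1 : f p < f (p + 1)) (h2 : f⁻¹ p < f⁻¹ (p + 1))
    (hne : ¬ (n : ℤ) ∣ f p - p) (e : ℕ) :
    (countPoly n k (affineSwap hn p * f * affineSwap hn p : Equiv.Perm ℤ)).coeff e ≤
      (countPoly n k f).coeff e := by
  have hs := affineSwap_mem hn p
  have n1 := countPoly_coeff_nonneg (k := k) (Subgroup.mul_mem _ (Subgroup.mul_mem _ hs hf) hs)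
    (by rw [displacement_affineSwap_conj hn hf, hd])
  have n2 := countPoly_coeff_nonneg (k := k) (Subgroup.mul_mem _ hf hs)
    (by rw [displacement_mul_affineSwap hn hf, hd])
  rw [countPoly_of_lt_of_lt hn hf hd h1 h2 fun h => hne h.1, add_mul, one_mul, coeff_add, coeff_add]
  have key : ∀ P : ℤ[X], (∀ e, 0 ≤ P.coeff e) → 0 ≤ (X * P).coeff e := by
    intro P hP
    cases e with
    | zero => rw [coeff_X_mul_zero]
    | succ e => rw [coeff_X_mul]; exact hP e
  have := key _ n1
  have := key _ n2
  omega

/-- The strand from `i` is shortened by one with each conjugation at its end, until a cycle splits.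
Condition `hQ` prevents the case in which both pairs of strands cross, where the coefficient bound
would go the wrong way. -/
theorem countPoly_coeff_pos_of_step {N : ℕ}
    (IH : ∀ g ∈ affinePerms n, (∀ j, j ≤ g j ∧ g j ≤ j + n) → displacement n g = k * n →
      n - cycleNumber n g < N → 0 < (countPoly n k g).coeff (n - cycleNumber n g))
    (d : ℕ) {f : Equiv.Perm ℤ} (hf : f ∈ affinePerms n) (hb : ∀ j, j ≤ f j ∧ f j ≤ j + n)
    (hd : displacement n f = k * n) (hN : n - cycleNumber n f = N) {i : ℤ} (hi : f i = i + d + 1)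
    (hin : (d : ℤ) + 1 < n) (hQ : ∀ t, i < t → t < f i → f⁻¹ t < i ∨ (n : ℤ) ∣ f t - t) :
    0 < (countPoly n k f).coeff N := by
  have hn : 2 ≤ n := by omega
  induction d generalizing f with
  | zero =>
    subst hN
    have hi' : f i = i + 1 := by simpa using hi
    refine countPoly_coeff_pos_of_split hn hf hb hd IH (p := i) (Or.inl hi') (by omega) ?_
    intro h
    have h1 : f (i + n) = f (i + 1) → False := fun h' => by
      have := f.injective h'
      omega
    apply h1
    rw [hf, hi', h]
  | succ d ih =>
    push_cast at hi hin
    -- The strand from `i` ends at `p + 1`; conjugation makes it end at `p`.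
    set p : ℤ := i + d + 1 with hp
    have hip : f i = p + 1 := by rw [hi]; ring
    have hinv : f⁻¹ (p + 1) = i := by rw [Equiv.Perm.inv_eq_iff_eq, hip]
    have hfp : f p ≠ p + 1 := fun h => by
      have := f.injective (h.trans hip.symm)
      omega
    have hbp := hb p
    have hbp1 := hb (p + 1)
    have hfne : f p ≠ f (p + 1) := fun h => by
      have := f.injective h
      omega
    have e1 : f (f⁻¹ p) = p := f.apply_symm_apply p
    have hi_ne : ∀ m : ℤ, f (p + 1) ≠ p + 1 + n * m := by
      intro m h
      have h1 : f (p + 1) = f (i + n * m) := by rw [affinePerms_add_mul hf, hip, h]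
      have h2 := f.injective h1
      exact not_dvd_of_lt (n := n) (x := p + 1 - i) (by omega) (by omega) ⟨m, by linarith⟩
    -- Here the conjugate is unbounded, but the transposition already splits off a fixed residue.
    by_cases hsplit : f (p + 1) = p + n
    · subst hN
      refine countPoly_coeff_pos_of_split hn hf hb hd IH (p := p) (Or.inr hsplit) ?_ ?_
      · intro h
        have h1 : f (p + n) = f (p + 1) := by rw [hf, h, hsplit]
        have := f.injective h1
        omega
      · rw [hsplit]
        omega
    · set g : Equiv.Perm ℤ := affineSwap hn p * f * affineSwap hn p with hg
      have hs := affineSwap_mem hn p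
      have hgm : g ∈ affinePerms n := Subgroup.mul_mem _ (Subgroup.mul_mem _ hs hf) hs
      have hgb := bounded_affineSwap_conj hn hf hb hfp hsplit
      have hgd : displacement n g = k * n := by rw [displacement_affineSwap_conj hn hf, hd]
      have fixed : ∀ t : ℤ, i ≤ t → t < p → affineSwap hn p t = t := by
        intro t h1 h2
        refine affineSwapFun_of_not ?_ ?_
        · rw [← dvd_neg]
          exact not_dvd_of_lt (by omega) (by omega)
        · rw [← dvd_neg]
          exact not_dvd_of_lt (by omega) (by omega)
      have hgi : g i = p := by
        rw [hg, Equiv.Perm.mul_apply, Equiv.Perm.mul_apply, fixed i le_rfl (by omega), hip,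
          affineSwap_succ]
      have hpos : 0 < (countPoly n k g).coeff N := by
        refine ih hgm hgb hgd (by rw [cycleNumber_affineSwap_conj, hN]) hgi (by omega) ?_
        intro t h1 h2
        rw [hgi] at h2
        have hst := fixed t h1.le h2
        rcases hQ t h1 (by omega) with h | ⟨m, hm⟩
        · left
          rw [hg, mul_inv_rev, mul_inv_rev, affineSwap_inv, Equiv.Perm.mul_apply,
            Equiv.Perm.mul_apply, hst]
          have := (affineSwap_lt_iff hn (p := p) (x := f⁻¹ t) (y := i) ?_ ?_).2 h
          · rwa [fixed i le_rfl (by omega)] at this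
          · rintro ⟨⟨m, hm⟩, h3⟩
            exact not_dvd_of_lt (n := n) (x := p + 1 - i) (by omega) (by omega)
              ⟨-m, by linarith⟩
          · rintro ⟨-, h3⟩
            omega
        · right
          refine ⟨m, ?_⟩
          rw [hg, Equiv.Perm.mul_apply, Equiv.Perm.mul_apply, hst,
            show f t = t + n * m by linarith, affinePerms_add_mul hs, hst]
          ring
      by_cases hlt : f p < f (p + 1)
      · by_cases hlt' : f⁻¹ p < f⁻¹ (p + 1)
        · refine hpos.trans_le (countPoly_coeff_conj_le hn hf hd hlt hlt' ?_ N)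
          rintro ⟨m, hm⟩
          rw [hinv] at hlt'
          have h1 : f⁻¹ p = p + n * (-m) := by
            rw [Equiv.Perm.inv_eq_iff_eq, affinePerms_add_mul hf]
            linarith
          have hm1 : m = 1 := by
            have h2 : 0 < m := by
              by_contra h2
              have := mul_nonneg (show (0 : ℤ) ≤ n by omega) (show 0 ≤ -m by omega)
              omega
            have h3 : m < 2 := by
              by_contra h3
              have := mul_le_mul_of_nonneg_left (show 2 ≤ m by omega) (show (0 : ℤ) ≤ n by omega)
              omega
            omega
          rw [hm1, mul_one] at hm
          have := hi_ne 1
          rw [mul_one] at this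
          omega
        · rw [← countPoly_conj_of_lt_of_gt hn hf hd hlt (lt_of_le_of_ne (not_lt.1 hlt')
            fun h => by have := f⁻¹.injective h; omega)]
          exact hpos
      · rcases hQ p (by omega) (by omega) with h | ⟨m, hm⟩
        · rw [← countPoly_conj_of_gt_of_lt hn hf hd (p := p) (by omega) (by rw [hinv]; exact h)]
          exact hpos
        · have h1 : f⁻¹ p = p + n * (-m) := by
            rw [Equiv.Perm.inv_eq_iff_eq, affinePerms_add_mul hf]
            linarith
          have h2 : 0 < m := by
            by_contra h2
            have := mul_nonneg (show (0 : ℤ) ≤ n by omega) (show 0 ≤ -m by omega)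
            rw [mul_neg] at this
            omega
          rw [← countPoly_conj_of_gt_of_lt hn hf hd (p := p) (by omega) ?_]
          · exact hpos
          · rw [hinv, h1]
            have := mul_le_mul_of_nonneg_left (show 1 ≤ m by omega) (show (0 : ℤ) ≤ n by omega)
            rw [mul_neg]
            omega

/-- The least exponent in the count of a bounded affine permutation. -/
theorem countPoly_coeff_pos {f : Equiv.Perm ℤ} (hf : f ∈ affinePerms n)
    (hb : ∀ j, j ≤ f j ∧ f j ≤ j + n) (hd : displacement n f = k * n) :
    0 < (countPoly n k f).coeff (n - cycleNumber n f) := by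
  have hn0 : 0 < n := Nat.pos_of_ne_zero (NeZero.ne n)
  induction hN : n - cycleNumber n f using Nat.strong_induction_on generalizing f with
  | _ N ih =>
    by_cases hfix : ∀ j, (n : ℤ) ∣ f j - j
    · rw [cycleNumber_eq_of_forall_dvd hfix, Nat.sub_self] at hN
      rw [← hN]
      exact countPoly_coeff_zero_pos hf hb hd hfix
    · push Not at hfix
      -- Choose a strand of least displacement among those not fixed modulo `n`.
      have hex : ∃ d : ℕ, ∃ i : ℤ, ¬ (n : ℤ) ∣ f i - i ∧ f i = i + d := by
        obtain ⟨i, hi⟩ := hfix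
        exact ⟨(f i - i).toNat, i, hi, by have := hb i; omega⟩
      classical
      obtain ⟨i, hi, hid⟩ := Nat.find_spec hex
      have hmin : ∀ u, ¬ (n : ℤ) ∣ f u - u → f i - i ≤ f u - u := by
        intro u hu
        have hbu := hb u
        have := Nat.find_min' hex ⟨u, hu, show f u = u + ((f u - u).toNat : ℕ) by omega⟩
        omega
      have h0 : f i ≠ i := fun h => hi (by rw [h, sub_self]; exact dvd_zero _)
      have h1 : f i ≠ i + n := fun h => hi (by rw [h, add_sub_cancel_left])
      have hbi := hb i
      refine countPoly_coeff_pos_of_step (fun g hg hgb hgd hgN => ih _ hgN hg hgb hgd rfl)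
        (Nat.find hex - 1) hf hb hd hN (i := i) (by omega) (by omega) ?_
      intro t ht1 ht2
      by_cases ht : (n : ℤ) ∣ f t - t
      · exact Or.inr ht
      -- The strand ending at `t` is not fixed modulo `n` either, so it is at least as long as the
      -- chosen one; ending before `f i`, it starts before `i`.
      · left
        have e : f (f⁻¹ t) = t := f.apply_symm_apply t
        have := hmin (f⁻¹ t) (by
          rintro ⟨m, hm⟩
          apply ht
          refine ⟨m, ?_⟩
          rw [e] at hm
          have h2 : f t = f (f⁻¹ t + n * m) := by
            congr 1
            linarith
          rw [h2, affinePerms_add_mul hf, e]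
          ring)
        rw [e] at this
        omega

end Positivity
end PositroidCatalan

namespace PositroidCatalan

-- Row operations, column rescaling and the orbit count

section Torus

variable {n k : ℕ} {F : Type} [Field F]

theorem HasPos.smul_map {V W : Type*} [AddCommGroup V] [Module F V] [AddCommGroup W] [Module F W]
    {f : ℤ → ℤ} {A : ℤ → V} (hA : HasPos F f A) {L : V →ₗ[F] W} (hL : Function.Injective L)
    (c : ℤ → Fˣ) : HasPos F f fun j => (c j : F) • L (A j) := by
  have key : ∀ i (s : Set ℤ), (c i : F) • L (A i) ∈
      Submodule.span F ((fun j => (c j : F) • L (A j)) '' s) ↔ A i ∈ Submodule.span F (A '' s) := by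
    intro i s
    have h1 : Submodule.span F ((fun j => (c j : F) • L (A j)) '' s) =
        (Submodule.span F (A '' s)).map L := by
      rw [Submodule.map_span, ← Set.image_comp]
      refine le_antisymm (Submodule.span_le.2 ?_) (Submodule.span_le.2 ?_)
      · rintro _ ⟨j, hj, rfl⟩
        exact Submodule.smul_mem _ _ (Submodule.subset_span ⟨j, hj, rfl⟩)
      · rintro _ ⟨j, hj, rfl⟩
        rw [SetLike.mem_coe, ← Submodule.smul_mem_iff _ (c j).ne_zero]
        exact Submodule.subset_span ⟨j, hj, rfl⟩
    rw [h1, Submodule.smul_mem_iff _ (c i).ne_zero, Submodule.mem_map]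
    exact ⟨fun ⟨y, hy, hyi⟩ => hL hyi ▸ hy, fun h => ⟨_, h, rfl⟩⟩
  intro i
  simp only [key]
  exact hA i

/-- If all columns are eigenvectors of an endomorphism, then the eigenvalue is constant on the
cycles of `f`. -/
theorem HasPos.eigenvalue_eq {V : Type*} [AddCommGroup V] [Module F V]
    {f : ℤ → ℤ} {A : ℤ → V} (hA : HasPos F f A) {L : V →ₗ[F] V} {c : ℤ → F}
    (hL : ∀ j, L (A j) = c j • A j) (i : ℤ) : c (f i) = c i := by
  by_cases h0 : f i = i
  · rw [h0]
  have hi := hA.le i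
  have hmem := (hA i).1.2
  have hIoc : Set.Ioc i (f i) = insert (f i) (Set.Ioc i (f i - 1)) := by
    ext x
    simp only [Set.mem_Ioc, Set.mem_insert_iff]
    omega
  rw [hIoc, span_image_insert] at hmem
  obtain ⟨a, z, hz, haz⟩ := hmem
  have hLz : L z ∈ Submodule.span F (A '' Set.Ioc i (f i - 1)) := by
    have h1 : Submodule.span F (A '' Set.Ioc i (f i - 1)) ≤
        (Submodule.span F (A '' Set.Ioc i (f i - 1))).comap L := by
      rw [Submodule.span_le]
      rintro _ ⟨j, hj, rfl⟩
      rw [SetLike.mem_coe, Submodule.mem_comap, hL]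
      exact Submodule.smul_mem _ _ (mem_span_image hj)
    exact h1 hz
  by_contra hne
  -- Applying `L - c (f i)` to the relation removes `A (f i)`. If the eigenvalues differed, `A i`
  -- would already be spanned by `A (i + 1), …, A (f i - 1)`.
  have h2 : (c i - c (f i)) • A i = L z - c (f i) • z := by
    have h3 := hL i
    have h4 : L (A i) = a • c (f i) • A (f i) + L z := by
      conv_lhs => rw [haz]
      rw [map_add, map_smul, hL]
    have h5 : c (f i) • A i = a • c (f i) • A (f i) + c (f i) • z := by
      conv_lhs => rw [haz]
      rw [smul_add, smul_comm]
    rw [sub_smul, ← h3, h4, h5]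
    abel
  have h3 : (c i - c (f i)) • A i ∈ Submodule.span F (A '' Set.Ioc i (f i - 1)) := by
    rw [h2]
    exact Submodule.sub_mem _ hLz (Submodule.smul_mem _ _ hz)
  rw [Submodule.smul_mem_iff _ (sub_ne_zero.2 (Ne.symm hne)), hA.mem_iff (by omega)] at h3
  omega

theorem torusMap_injective (t : ZMod n → Fˣ) : Function.Injective (torusMap (F := F) t) := by
  intro x y h
  funext j
  have h1 : (t j : F) * x j = (t j : F) * y j := congrFun h j
  exact mul_left_cancel₀ (t j).ne_zero h1

theorem const_of_isSingleCycle {f : BoundedAffinePerm k n} (hf : f.IsSingleCycle) {α : Type*}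
    {t : ZMod n → α} (ht : ∀ i : ℤ, t ((f.toPerm i : ℤ) : ZMod n) = t (i : ZMod n)) (x y : ZMod n) :
    t x = t y := by
  have h1 : ∀ x, t (f.reduction x) = t x := fun x => by
    have := ht (x.cast : ℤ)
    rwa [ZMod.intCast_zmod_cast] at this
  have h2 : ∀ m : ℕ, ∀ x, t ((f.reduction ^ m) x) = t x := by
    intro m
    induction m with
    | zero => intro x; rfl
    | succ m ih => intro x; rw [pow_succ', Equiv.Perm.mul_apply, h1, ih]
  obtain ⟨i, hi⟩ := hf.2 (Set.mem_univ x) (Set.mem_univ y)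
  rw [← hi]
  obtain ⟨m, rfl | rfl⟩ := Int.eq_nat_or_neg i
  · rw [zpow_natCast, h2]
  · rw [zpow_neg, zpow_natCast]
    have := h2 m ((f.reduction ^ m)⁻¹ x)
    rw [← Equiv.Perm.mul_apply, mul_inv_cancel, Equiv.Perm.one_apply] at this
    exact this

variable [NeZero n]

/-- Row operations and rescaling of the columns. -/
def rowColAct (x : GL (Fin k) F × (ZMod n → Fˣ)) (A : Matrix (Fin k) (ZMod n) F) :
    Matrix (Fin k) (ZMod n) F :=
  (x.1 : Matrix (Fin k) (Fin k) F) * A * Matrix.diagonal fun j => (x.2 j : F)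

theorem rowColAct_apply (x : GL (Fin k) F × (ZMod n → Fˣ)) (A : Matrix (Fin k) (ZMod n) F)
    (r : Fin k) (j : ZMod n) : rowColAct x A r j =
      ((x.1 : Matrix (Fin k) (Fin k) F) * A) r j * (x.2 j : F) :=
  Matrix.mul_diagonal _ _ _ _

theorem rowColAct_mul (x y : GL (Fin k) F × (ZMod n → Fˣ)) (A : Matrix (Fin k) (ZMod n) F) :
    rowColAct (x * y) A = rowColAct x (rowColAct y A) := by
  have : (Matrix.diagonal fun j => (((x * y).2 j : Fˣ) : F)) =
      (Matrix.diagonal fun j => (y.2 j : F)) * Matrix.diagonal fun j => (x.2 j : F) := by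
    rw [Matrix.diagonal_mul_diagonal]
    congr 1
    ext j
    simp [mul_comm]
  rw [rowColAct, this]
  simp only [rowColAct, Prod.fst_mul, Units.val_mul, Matrix.mul_assoc]

theorem rowColAct_one (A : Matrix (Fin k) (ZMod n) F) : rowColAct 1 A = A := by
  simp [rowColAct]

theorem colSeq_rowColAct (x : GL (Fin k) F × (ZMod n → Fˣ)) (A : Matrix (Fin k) (ZMod n) F) (j : ℤ) :
    colSeq (rowColAct x A) j = (x.2 (j : ZMod n) : F) •
      Matrix.mulVecLin (x.1 : Matrix (Fin k) (Fin k) F) (colSeq A j) := by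
  funext r
  exact (rowColAct_apply x A r (j : ZMod n)).trans (mul_comm _ _)

theorem row_rowColAct (x : GL (Fin k) F × (ZMod n → Fˣ)) (A : Matrix (Fin k) (ZMod n) F) :
    (rowColAct x A).row = fun r => torusMap x.2 (Matrix.vecMulLinear A
      ((x.1 : Matrix (Fin k) (Fin k) F).row r)) := by
  funext r j
  exact (rowColAct_apply x A r j).trans (mul_comm _ _)

theorem span_row_rowColAct (x : GL (Fin k) F × (ZMod n → Fˣ)) (A : Matrix (Fin k) (ZMod n) F) :
    Submodule.span F (Set.range (rowColAct x A).row) =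
      (Submodule.span F (Set.range A.row)).map (torusMap x.2) := by
  have key : ∀ B : Matrix (Fin k) (ZMod n) F, Submodule.span F (Set.range B.row) =
      LinearMap.range (Matrix.vecMulLinear B) := fun B => (range_vecMulLinear B).symm
  rw [key A, row_rowColAct, ← LinearMap.range_comp]
  refine le_antisymm (Submodule.span_le.2 ?_) ?_
  · rintro _ ⟨r, rfl⟩
    exact ⟨_, rfl⟩
  · rintro _ ⟨y, rfl⟩
    obtain ⟨z, rfl⟩ : ∃ z, Matrix.vecMul z (x.1 : Matrix (Fin k) (Fin k) F) = y :=
      ⟨Matrix.vecMul y ((x.1⁻¹ : GL (Fin k) F) : Matrix (Fin k) (Fin k) F), by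
        rw [Matrix.vecMul_vecMul, ← Units.val_mul, inv_mul_cancel, Units.val_one,
          Matrix.vecMul_one]⟩
    rw [Matrix.vecMul_eq_sum, map_sum]
    refine Submodule.sum_mem _ fun r _ => ?_
    rw [map_smul]
    exact Submodule.smul_mem _ _ (Submodule.subset_span ⟨r, rfl⟩)

theorem linearIndependent_rowColAct (x : GL (Fin k) F × (ZMod n → Fˣ))
    {A : Matrix (Fin k) (ZMod n) F} (hA : LinearIndependent F A.row) :
    LinearIndependent F (rowColAct x A).row := by
  rw [row_rowColAct]
  have h1 : LinearIndependent F (x.1 : Matrix (Fin k) (Fin k) F).row :=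
    Matrix.linearIndependent_rows_iff_isUnit.2 x.1.isUnit
  have h2 : Function.Injective ((torusMap x.2).comp (Matrix.vecMulLinear A)) := by
    rw [LinearMap.coe_comp]
    exact (torusMap_injective x.2).comp (Matrix.vecMul_injective_iff.2 hA)
  exact h1.map' ((torusMap x.2).comp (Matrix.vecMulLinear A)) (LinearMap.ker_eq_bot.2 h2)

theorem rowColAct_mem {f : ℤ → ℤ} (x : GL (Fin k) F × (ZMod n → Fˣ))
    {A : Matrix (Fin k) (ZMod n) F} (hA : A ∈ matSet n k F f) : rowColAct x A ∈ matSet n k F f := by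
  refine ⟨linearIndependent_rowColAct x hA.1, ?_⟩
  have h := hA.2.smul_map (L := Matrix.mulVecLin (x.1 : Matrix (Fin k) (Fin k) F))
    (Matrix.mulVec_injective_iff_isUnit.2 x.1.isUnit) (fun j => x.2 (j : ZMod n))
  have e : colSeq (rowColAct x A) = fun j : ℤ => (x.2 (j : ZMod n) : F) •
    Matrix.mulVecLin (x.1 : Matrix (Fin k) (Fin k) F) (colSeq A j) :=
    funext (colSeq_rowColAct x A)
  rw [e]
  exact h

instance rowColAction (f : ℤ → ℤ) : MulAction (GL (Fin k) F × (ZMod n → Fˣ)) (matSet n k F f) where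
  smul x A := ⟨rowColAct x A.1, rowColAct_mem x A.2⟩
  one_smul A := Subtype.ext (rowColAct_one A.1)
  mul_smul x y A := Subtype.ext (rowColAct_mul x y A.1)

/-- Matrices of full rank with the same row span differ by an invertible row operation; the torus
element is prescribed. -/
theorem exists_rowColAct_eq {A B : Matrix (Fin k) (ZMod n) F} (hB : LinearIndependent F B.row)
    {t : ZMod n → Fˣ} (h : (Submodule.span F (Set.range A.row)).map (torusMap t) =
      Submodule.span F (Set.range B.row)) : ∃ g : GL (Fin k) F, rowColAct (g, t) A = B := by
  have h1 : ∀ r, ∃ y : Fin k → F, torusMap t (Matrix.vecMulLinear A y) = B.row r := by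
    intro r
    have h2 : B.row r ∈ (Submodule.span F (Set.range A.row)).map (torusMap t) := by
      rw [h]
      exact Submodule.subset_span ⟨r, rfl⟩
    obtain ⟨z, hz, hzr⟩ := h2
    have h3 : Submodule.span F (Set.range A.row) = LinearMap.range (Matrix.vecMulLinear A) :=
      (range_vecMulLinear A).symm
    rw [h3] at hz
    obtain ⟨y, rfl⟩ := hz
    exact ⟨y, hzr⟩
  choose y hy using h1
  set g : Matrix (Fin k) (Fin k) F := Matrix.of y with hg
  have hgu : IsUnit g := by
    rw [← Matrix.linearIndependent_rows_iff_isUnit]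
    refine LinearIndependent.of_comp ((torusMap t).comp (Matrix.vecMulLinear A)) ?_
    have : (((torusMap t).comp (Matrix.vecMulLinear A)) ∘ g.row) = B.row := funext hy
    rw [this]
    exact hB
  refine ⟨hgu.unit, ?_⟩
  have := row_rowColAct (hgu.unit, t) A
  exact this.trans (funext hy)

/-- The orbits of row operations and column rescalings are the points of the configuration space. -/
theorem natCard_orbits_eq (f : BoundedAffinePerm k n) :
    Nat.card (MulAction.orbitRel.Quotient (GL (Fin k) F × (ZMod n → Fˣ)) (matSet n k F f.toPerm)) =
      Nat.card (ConfigurationSpace f F) := by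
  set φ : matSet n k F f.toPerm → openPositroid f F := fun A =>
    ⟨Submodule.span F (Set.range A.1.row), A.1, A.2.1, A.2.2, rfl⟩ with hφ
  have hrel : ∀ A B : matSet n k F f.toPerm,
      (MulAction.orbitRel (GL (Fin k) F × (ZMod n → Fˣ)) (matSet n k F f.toPerm)).r A B ↔
        (torusSetoid f F).r (φ A) (φ B) := by
    intro A B
    constructor
    · intro h
      obtain ⟨x, hx⟩ := MulAction.orbitRel_apply.1 ((MulAction.orbitRel _ _).symm h)
      refine ⟨x.2, ?_⟩
      have h1 : rowColAct x A.1 = B.1 := Subtype.ext_iff.1 hx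
      change (Submodule.span F (Set.range A.1.row)).map _ = Submodule.span F (Set.range B.1.row)
      rw [← h1, span_row_rowColAct]
    · rintro ⟨t, ht⟩
      obtain ⟨g, hg⟩ := exists_rowColAct_eq B.2.1 ht
      exact (MulAction.orbitRel _ _).symm (MulAction.orbitRel_apply.2 ⟨(g, t), Subtype.ext hg⟩)
  refine Nat.card_congr (Equiv.ofBijective (Quotient.map φ fun A B h => (hrel A B).1 h) ⟨?_, ?_⟩)
  · intro a b
    induction a using Quotient.inductionOn with | _ A
    induction b using Quotient.inductionOn with | _ B
    intro h
    exact Quotient.sound ((hrel A B).2 (Quotient.exact h))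
  · intro b
    induction b using Quotient.inductionOn with | _ V
    obtain ⟨V, A, hA1, hA2, rfl⟩ := V
    exact ⟨Quotient.mk _ ⟨A, hA1, hA2⟩, rfl⟩

/-- If `(g, t)` fixes `A`, every column is an eigenvector of `g` with eigenvalue the inverse of its
entry of `t`. These are constant on cycles, so `t` is scalar, and full rank makes `g` the inverse
scalar. -/
theorem nonempty_stabilizer_equiv {f : BoundedAffinePerm k n} (hf : f.IsSingleCycle)
    (A : matSet n k F f.toPerm) :
    Nonempty (MulAction.stabilizer (GL (Fin k) F × (ZMod n → Fˣ)) A ≃ Fˣ) := by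
  set φ : Fˣ → GL (Fin k) F × (ZMod n → Fˣ) := fun c =>
    (Units.map (Matrix.scalar (Fin k) : F →+* Matrix (Fin k) (Fin k) F).toMonoidHom c⁻¹, fun _ => c)
    with hφ
  have hφ1 : ∀ c, (((φ c).1 : GL (Fin k) F) : Matrix (Fin k) (Fin k) F) =
      Matrix.scalar (Fin k) ((c⁻¹ : Fˣ) : F) := fun c => rfl
  have hmem : ∀ c, φ c ∈ MulAction.stabilizer (GL (Fin k) F × (ZMod n → Fˣ)) A := by
    intro c
    rw [MulAction.mem_stabilizer_iff]
    apply Subtype.ext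
    ext r j
    change rowColAct (φ c) A.1 r j = _
    rw [rowColAct_apply, hφ1, Matrix.scalar_apply, Matrix.diagonal_mul]
    change ((c⁻¹ : Fˣ) : F) * A.1 r j * (c : F) = A.1 r j
    rw [mul_right_comm, Units.inv_mul, one_mul]
  refine ⟨(Equiv.ofBijective (fun c => ⟨φ c, hmem c⟩) ⟨fun c d h => ?_, ?_⟩).symm⟩
  · exact congrFun (Prod.mk.inj (Subtype.ext_iff.1 h)).2 0
  · rintro ⟨⟨g, t⟩, hgt⟩
    rw [MulAction.mem_stabilizer_iff] at hgt
    have h1 : rowColAct (g, t) A.1 = A.1 := Subtype.ext_iff.1 hgt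
    have h2 : ∀ j : ℤ, Matrix.mulVecLin (g : Matrix (Fin k) (Fin k) F) (colSeq A.1 j) =
        (((t (j : ZMod n))⁻¹ : Fˣ) : F) • colSeq A.1 j := by
      intro j
      have h3 := colSeq_rowColAct (g, t) A.1 j
      rw [h1] at h3
      conv_rhs => rw [h3]
      rw [smul_smul, Units.inv_mul, one_smul]
    have h3 : ∀ x y, t x = t y := const_of_isSingleCycle hf fun i => by
      have h4 := A.2.2.eigenvalue_eq h2 i
      exact inv_injective (Units.ext h4)
    refine ⟨t 0, Subtype.ext (Prod.ext (Units.ext ?_) (funext fun x => h3 0 x))⟩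
    rw [hφ1]
    have hinj := Matrix.vecMul_injective_iff.2 A.2.1
    ext r i
    have h4 : Matrix.vecMul (Matrix.scalar (Fin k) (((t 0)⁻¹ : Fˣ) : F) r) A.1 =
        Matrix.vecMul ((g : Matrix (Fin k) (Fin k) F) r) A.1 := by
      funext x
      obtain ⟨j, rfl⟩ := ZMod.intCast_surjective x
      have h5 := congrFun (h2 j) r
      rw [h3 _ 0] at h5
      refine Eq.trans ?_ h5.symm
      change ((Matrix.scalar (Fin k) (((t 0)⁻¹ : Fˣ) : F)) * A.1) r (j : ZMod n) = _
      rw [Matrix.scalar_apply, Matrix.diagonal_mul]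
      rfl
    exact congrFun (hinj h4) i

/-- Count pairs of a group element and a matrix fixed by it: by matrices through the stabilizers, or
by orbits through Burnside's bijection. -/
theorem natCard_matSet_mul [Finite F] {f : BoundedAffinePerm k n} (hf : f.IsSingleCycle) :
    Nat.card (matSet n k F f.toPerm) * (Nat.card F - 1) =
      Nat.card (ConfigurationSpace f F) * (Nat.card (GL (Fin k) F) * (Nat.card F - 1) ^ n) := by
  set G := GL (Fin k) F × (ZMod n → Fˣ) with hG
  set β := matSet n k F f.toPerm
  have e1 := Nat.card_congr (MulAction.sigmaFixedByEquivOrbitsProdGroup G β)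
  have e2 : (Σ a : G, MulAction.fixedBy β a) ≃ (Σ b : β, MulAction.stabilizer G b) :=
    { toFun := fun x => ⟨x.2.1, x.1, x.2.2⟩
      invFun := fun x => ⟨x.2.1, x.1, x.2.2⟩
      left_inv := fun x => rfl
      right_inv := fun x => rfl }
  have e3 : (Σ b : β, MulAction.stabilizer G b) ≃ β × Fˣ :=
    (Equiv.sigmaCongrRight fun b => (nonempty_stabilizer_equiv hf b).some).trans (Equiv.sigmaEquivProd _ _)
  rw [Nat.card_congr (e2.trans e3), Nat.card_prod, Nat.card_prod, natCard_orbits_eq, Nat.card_units,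
    hG, Nat.card_prod, Nat.card_fun, Nat.card_units, Nat.card_zmod] at e1
  exact e1

end Torus
end PositroidCatalan

namespace PositroidCatalan

open Polynomial

-- The relation of lying in one cycle

section CycleRel

variable {n k : ℕ}

/-- Two integers lie in the same cycle of `f` modulo `n`. -/
def CycleRel (n : ℕ) (f : ℤ → ℤ) (i j : ℤ) : Prop := ∀ x ∈ invariants n f, x i = x j

variable {f : ℤ → ℤ}

theorem CycleRel.refl (i : ℤ) : CycleRel n f i i := fun _ _ => rfl

theorem CycleRel.symm {i j : ℤ} (h : CycleRel n f i j) : CycleRel n f j i :=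
  fun x hx => (h x hx).symm

theorem CycleRel.trans {i j l : ℤ} (h : CycleRel n f i j) (h' : CycleRel n f j l) :
    CycleRel n f i l := fun x hx => (h x hx).trans (h' x hx)

theorem cycleRel_apply (i : ℤ) : CycleRel n f (f i) i := fun _ hx => hx.2 i

theorem cycleRel_of_dvd {i j : ℤ} (h : (n : ℤ) ∣ i - j) : CycleRel n f i j :=
  fun _ hx => periodic_of_dvd hx.1 h

open Classical in
theorem indicator_mem_of_closed {Q : ℤ → Prop} (h1 : ∀ j, Q (j + n) ↔ Q j)
    (h2 : ∀ j, Q (f j) ↔ Q j) : (fun j => if Q j then (1 : ℚ) else 0) ∈ invariants n f :=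
  ⟨fun j => by simp only [h1], fun j => by simp only [h2]⟩

theorem CycleRel.iff_of_closed {Q : ℤ → Prop} (h1 : ∀ j, Q (j + n) ↔ Q j)
    (h2 : ∀ j, Q (f j) ↔ Q j) {i j : ℤ} (h : CycleRel n f i j) : Q i ↔ Q j := by
  classical
  have := h _ (indicator_mem_of_closed h1 h2)
  by_cases hi : Q i <;> by_cases hj : Q j <;> simp_all

theorem cycleRel_add_left_iff {i j : ℤ} : CycleRel n f (i + n) j ↔ CycleRel n f i j :=
  have h : CycleRel n f (i + n) i := cycleRel_of_dvd (by simp)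
  ⟨fun h' => h.symm.trans h', fun h' => h.trans h'⟩

theorem cycleRel_apply_left_iff {i j : ℤ} : CycleRel n f (f i) j ↔ CycleRel n f i j :=
  ⟨fun h' => (cycleRel_apply i).symm.trans h', fun h' => (cycleRel_apply i).trans h'⟩

theorem cycleRel_affineSwap_conj_iff (hn : 2 ≤ n) {f : Equiv.Perm ℤ} {p i j : ℤ} :
    CycleRel n (affineSwap hn p * f * affineSwap hn p : Equiv.Perm ℤ) i j ↔
      CycleRel n f (affineSwap hn p i) (affineSwap hn p j) := by
  have key : ∀ {f : Equiv.Perm ℤ} {i j : ℤ},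
      CycleRel n (affineSwap hn p * f * affineSwap hn p : Equiv.Perm ℤ) i j →
      CycleRel n f (affineSwap hn p i) (affineSwap hn p j) := by
    intro f i j h x hx
    refine h (x ∘ affineSwap hn p) ⟨fun j => ?_, fun j => ?_⟩
    · simp only [Function.comp_apply]
      rw [affineSwap_mem hn p j, hx.1]
    · simp only [Function.comp_apply, Equiv.Perm.mul_apply]
      rw [affineSwap_affineSwap, hx.2]
  refine ⟨key, fun h => ?_⟩
  have := key (f := affineSwap hn p * f * affineSwap hn p) (i := affineSwap hn p i)
    (j := affineSwap hn p j) (by rwa [affineSwap_conj_conj])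
  rwa [affineSwap_affineSwap, affineSwap_affineSwap] at this

/-- Only finitely many residues compete. -/
theorem exists_max_of_periodic [NeZero n] {φ : ℤ → ℤ} (hφ : ∀ j, φ (j + n) = φ j) {Q : ℤ → Prop}
    (hQ : ∀ j, Q (j + n) ↔ Q j) {b : ℤ} (hb : Q b) : ∃ j, Q j ∧ ∀ i, Q i → φ i ≤ φ j := by
  classical
  have hQ' : ∀ j, Q (j + n) = Q j := fun j => propext (hQ j)
  obtain ⟨m, b, rfl⟩ := exists_coord n b
  rw [periodic_add_mul hQ'] at hb
  obtain ⟨i, hi, hmax⟩ := Finset.exists_max_image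
    (Finset.univ.filter fun i : Fin n => Q ((i : ℤ) + 1)) (fun i => φ ((i : ℤ) + 1))
    ⟨b, Finset.mem_filter.2 ⟨Finset.mem_univ _, hb⟩⟩
  refine ⟨(i : ℤ) + 1, (Finset.mem_filter.1 hi).2, fun j hj => ?_⟩
  obtain ⟨m', j, rfl⟩ := exists_coord n j
  rw [periodic_add_mul hQ'] at hj
  rw [periodic_add_mul hφ]
  exact hmax j (Finset.mem_filter.2 ⟨Finset.mem_univ _, hj⟩)

theorem sum_apply_eq_sum [NeZero n] {f : Equiv.Perm ℤ} (hf : f ∈ affinePerms n) {α : Type*}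
    [AddCommMonoid α] {φ : ℤ → α} (hφ : ∀ j, φ (j + n) = φ j) :
    ∑ i : Fin n, φ (f ((i : ℤ) + 1)) = ∑ i : Fin n, φ ((i : ℤ) + 1) := by
  obtain ⟨u, m, hu⟩ := exists_perm_coord hf
  rw [← Equiv.sum_comp u (fun i => φ ((i : ℤ) + 1))]
  refine Finset.sum_congr rfl fun i _ => ?_
  have h := hu 0 i
  rw [mul_zero, add_zero] at h
  rw [h, periodic_add_mul hφ]

/-- A periodic set that is mapped into itself is invariant. -/
theorem closed_iff_of_imp [NeZero n] {f : Equiv.Perm ℤ} (hf : f ∈ affinePerms n) {Q : ℤ → Prop}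
    (h1 : ∀ j, Q (j + n) ↔ Q j) (h2 : ∀ j, Q j → Q (f j)) (j : ℤ) : Q (f j) ↔ Q j := by
  classical
  refine ⟨fun h => ?_, h2 j⟩
  set φ : ℤ → ℕ := fun j => if Q j then 1 else 0 with hφ
  have hper : ∀ j, φ (j + n) = φ j := fun j => by simp only [hφ, h1]
  have hsum := sum_apply_eq_sum hf hper
  have hle : ∀ i ∈ Finset.univ, φ (((i : Fin n) : ℤ) + 1) ≤ φ (f ((i : ℤ) + 1)) := by
    intro i _
    simp only [hφ]
    by_cases h3 : Q ((i : ℤ) + 1)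
    · rw [if_pos h3, if_pos (h2 _ h3)]
    · rw [if_neg h3]
      exact Nat.zero_le _
  have heq := (Finset.sum_eq_sum_iff_of_le hle).1 hsum.symm
  obtain ⟨m, i, rfl⟩ := exists_coord n j
  have h3 := heq i (Finset.mem_univ i)
  rw [affinePerms_add_mul hf, periodic_add_mul (x := Q) (fun j => propext (h1 j))] at h
  rw [periodic_add_mul (x := Q) (fun j => propext (h1 j))]
  by_contra h4
  simp only [hφ, if_pos h, if_neg h4] at h3
  omega

variable [NeZero n]

/-- Multiplication by a transposition merges different cycles. -/
theorem cycleRel_mul_affineSwap (hn : 2 ≤ n) {f : Equiv.Perm ℤ} (hf : f ∈ affinePerms n) {p : ℤ}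
    (h : ¬ CycleRel n f p (p + 1)) :
    CycleRel n (f * affineSwap hn p : Equiv.Perm ℤ) p (p + 1) := by
  classical
  intro y hy
  set φ : ℤ → ℚ := fun j => if CycleRel n f j p then y j else 0 with hφ
  have hper : ∀ j, φ (j + n) = φ j := fun j => by
    simp only [hφ, cycleRel_add_left_iff, hy.1]
  have hsum := sum_apply_eq_sum hf hper
  have hy2 : ∀ j, y (f j) = y (affineSwap hn p j) := by
    intro j
    have := hy.2 (affineSwap hn p j)
    rwa [Equiv.Perm.mul_apply, affineSwap_affineSwap] at this
  -- Restricted to the cycle of `p`, the function `y` changes along `f` only at `p`; as the changes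
  -- over one period sum to zero, this jump vanishes.
  have hdiff : ∀ j, φ (f j) - φ j = if (n : ℤ) ∣ j - p then y (p + 1) - y p else 0 := by
    intro j
    simp only [hφ, cycleRel_apply_left_iff, hy2]
    rcases affineSwap_cases hn p j with ⟨h1, h2⟩ | ⟨h1, h2⟩ | ⟨h1, -, h2⟩
    · rw [if_pos h1, if_pos (cycleRel_of_dvd h1), if_pos (cycleRel_of_dvd h1), h2,
        periodic_of_dvd hy.1 h1, periodic_of_dvd hy.1 (i := j + 1) (j := p + 1)
          (by rwa [add_sub_add_right_eq_sub])]
    · have h3 : ¬ CycleRel n f j p := fun h4 => h (h4.symm.trans (cycleRel_of_dvd h1))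
      have h4 : ¬ (n : ℤ) ∣ j - p := fun h4 => h3 (cycleRel_of_dvd h4)
      rw [if_neg h3, if_neg h3, if_neg h4, sub_self]
    · rw [if_neg h1, h2, sub_self]
  rw [← sub_eq_zero, ← Finset.sum_sub_distrib, Finset.sum_congr rfl fun i _ => hdiff _] at hsum
  obtain ⟨m, i₀, hi₀⟩ := exists_coord n p
  rw [Finset.sum_eq_single i₀, if_pos ⟨-m, by rw [hi₀]; ring⟩] at hsum
  · exact (sub_eq_zero.1 hsum).symm
  · intro i _ hne
    rw [if_neg]
    rintro ⟨t, ht⟩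
    apply hne
    refine (coord_inj (n := n) (m := 0) (m' := m + t) (i' := i₀) ?_).1
    rw [hi₀] at ht
    linarith
  · intro h5
    exact absurd (Finset.mem_univ _) h5

theorem cycleNumber_mul_affineSwap_le_of_not_rel (hn : 2 ≤ n) {f : Equiv.Perm ℤ}
    (hf : f ∈ affinePerms n) {p : ℤ} (h : ¬ CycleRel n f p (p + 1)) :
    cycleNumber n (f * affineSwap hn p : Equiv.Perm ℤ) ≤ cycleNumber n f := by
  refine Submodule.finrank_mono fun y hy => ⟨hy.1, fun j => ?_⟩
  have h1 := cycleRel_mul_affineSwap hn hf h y hy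
  have h2 := hy.2 (affineSwap hn p j)
  rwa [Equiv.Perm.mul_apply, affineSwap_affineSwap, periodic_affineSwap hn hy.1 h1] at h2

end CycleRel

-- Recursion for the lowest coefficient

section LowCoeff

variable {n k : ℕ} [NeZero n]

/-- The lowest coefficient of the count in powers of `q - 1`. -/
noncomputable def lowCoeff (n k : ℕ) (f : ℤ → ℤ) : ℤ :=
  (countPoly n k f).coeff (n - cycleNumber n f)

theorem cycleNumber_pos (f : ℤ → ℤ) : 0 < cycleNumber n f := by
  have hone : (fun _ => 1 : ℤ → ℚ) ∈ invariants n f := ⟨fun _ => rfl, fun _ => rfl⟩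
  have : Nontrivial (invariants n f) := ⟨⟨_, hone⟩, 0, fun h => by
    have := congrFun (Subtype.ext_iff.1 h) 0
    exact one_ne_zero this⟩
  exact Module.finrank_pos

/-- Joining different cycles does not increase the cycle number, so in the lowest degree the terms
with an extra factor `X` contribute nothing. -/
theorem lowCoeff_conj_of_lt_of_lt (hn : 2 ≤ n) {f : Equiv.Perm ℤ} (hf : f ∈ affinePerms n)
    (hd : displacement n f = k * n) {p : ℤ} (h1 : f p < f (p + 1)) (h2 : f⁻¹ p < f⁻¹ (p + 1))
    (h : ¬ CycleRel n f p (p + 1)) :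
    lowCoeff n k (affineSwap hn p * f * affineSwap hn p : Equiv.Perm ℤ) = lowCoeff n k f := by
  by_cases hne : (n : ℤ) ∣ f p - p ∧ f (p + 1) = f p + 1
  -- In this degenerate case `f` commutes with the transposition, so the conjugate is `f`.
  · congr 2
    obtain ⟨⟨m, hm⟩, h3⟩ := hne
    have hs := affineSwap_mem hn p
    ext j
    rw [Equiv.Perm.mul_apply, Equiv.Perm.mul_apply]
    have e1 : ∀ t : ℤ, f (p + n * t) = p + n * (t + m) := fun t => by
      rw [affinePerms_add_mul hf]
      linarith
    have e2 : ∀ t : ℤ, f (p + 1 + n * t) = p + 1 + n * (t + m) := fun t => by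
      rw [affinePerms_add_mul hf, h3]
      linarith
    rcases affineSwap_cases hn p j with ⟨⟨t, ht⟩, h5⟩ | ⟨⟨t, ht⟩, h5⟩ | ⟨h4, h4', h5⟩
    · rw [h5, show j = p + n * t by linarith, show p + n * t + 1 = p + 1 + n * t by ring, e1, e2,
        affinePerms_add_mul hs, affineSwap_succ]
    · rw [h5, show j = p + 1 + n * t by linarith, show p + 1 + n * t - 1 = p + n * t by ring, e1,
        e2, affinePerms_add_mul hs, affineSwap_self]
    · rw [h5]
      refine affineSwapFun_of_not ?_ ?_
      · rintro ⟨t, ht⟩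
        have h6 : f j = f (p + n * (t - m)) := by
          rw [e1]
          linarith
        exact h4 ⟨t - m, by rw [f.injective h6]; ring⟩
      · rintro ⟨t, ht⟩
        have h6 : f j = f (p + 1 + n * (t - m)) := by
          rw [e2]
          linarith
        exact h4' ⟨t - m, by rw [f.injective h6]; ring⟩
  · have hs := affineSwap_mem hn p
    have hle := cycleNumber_mul_affineSwap_le_of_not_rel hn hf h
    have hpos := cycleNumber_pos (n := n) f
    have z1 : ∀ e < n - cycleNumber n f,
        (countPoly n k (affineSwap hn p * f * affineSwap hn p : Equiv.Perm ℤ)).coeff e = 0 :=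
      fun e he => countPoly_coeff_eq_zero (Subgroup.mul_mem _ (Subgroup.mul_mem _ hs hf) hs)
        (by rw [displacement_affineSwap_conj hn hf, hd]) (by
          rw [cycleNumber_affineSwap_conj]; omega)
    have z2 : ∀ e < n - cycleNumber n f,
        (countPoly n k (f * affineSwap hn p : Equiv.Perm ℤ)).coeff e = 0 :=
      fun e he => countPoly_coeff_eq_zero (Subgroup.mul_mem _ hf hs)
        (by rw [displacement_mul_affineSwap hn hf, hd]) (by omega)
    unfold lowCoeff
    rw [countPoly_of_lt_of_lt hn hf hd h1 h2 hne, cycleNumber_affineSwap_conj, add_mul, one_mul,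
      coeff_add, coeff_add]
    generalize n - cycleNumber n f = e at z1 z2
    cases e with
    | zero => rw [coeff_X_mul_zero, coeff_X_mul_zero]; ring
    | succ e => rw [coeff_X_mul, coeff_X_mul, z1 e (by omega), z2 e (by omega)]; ring

/-- All four orders of the outgoing and incoming strands are covered; if both cross, the argument is
applied to the conjugate. -/
theorem lowCoeff_conj_of_not_rel (hn : 2 ≤ n) {f : Equiv.Perm ℤ} (hf : f ∈ affinePerms n)
    (hd : displacement n f = k * n) {p : ℤ} (h : ¬ CycleRel n f p (p + 1)) :
    lowCoeff n k (affineSwap hn p * f * affineSwap hn p : Equiv.Perm ℤ) = lowCoeff n k f := by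
  have hs := affineSwap_mem hn p
  have hne : f p ≠ f (p + 1) := fun h => by
    have := f.injective h
    omega
  have hne' : f⁻¹ p ≠ f⁻¹ (p + 1) := fun h => by
    have := f⁻¹.injective h
    omega
  have hinv : ∀ j, CycleRel n f (f⁻¹ j) j := fun j => by
    have := cycleRel_apply (n := n) (f := f) (f⁻¹ j)
    rw [show f (f⁻¹ j) = j from f.apply_symm_apply j] at this
    exact this.symm
  rcases lt_or_gt_of_ne hne with h1 | h1 <;> rcases lt_or_gt_of_ne hne' with h2 | h2
  · exact lowCoeff_conj_of_lt_of_lt hn hf hd h1 h2 h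
  · unfold lowCoeff
    rw [countPoly_conj_of_lt_of_gt hn hf hd h1 h2, cycleNumber_affineSwap_conj]
  · unfold lowCoeff
    rw [countPoly_conj_of_gt_of_lt hn hf hd h1 h2, cycleNumber_affineSwap_conj]
  · have key := lowCoeff_conj_of_lt_of_lt (k := k) hn (p := p)
      (f := affineSwap hn p * f * affineSwap hn p)
      (Subgroup.mul_mem _ (Subgroup.mul_mem _ hs hf) hs)
      (by rw [displacement_affineSwap_conj hn hf, hd]) ?_ ?_ ?_
    · rw [affineSwap_conj_conj] at key
      exact key.symm
    · simp only [Equiv.Perm.mul_apply, affineSwap_self, affineSwap_succ]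
      rw [affineSwap_lt_iff hn]
      · exact h1
      · rintro ⟨h3, h4⟩
        apply h
        refine (cycleRel_apply p).symm.trans (cycleRel_of_dvd ?_)
        rw [h4, add_sub_add_right_eq_sub]
        exact h3
      · rintro ⟨-, h4⟩
        omega
    · simp only [mul_inv_rev, affineSwap_inv, Equiv.Perm.mul_apply, affineSwap_self,
        affineSwap_succ]
      rw [affineSwap_lt_iff hn]
      · exact h2
      · rintro ⟨h3, h4⟩
        apply h
        refine (hinv p).symm.trans (cycleRel_of_dvd ?_)
        rw [h4, add_sub_add_right_eq_sub]
        exact h3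
      · rintro ⟨-, h4⟩
        omega
    · rw [cycleRel_affineSwap_conj_iff, affineSwap_self, affineSwap_succ]
      exact fun h3 => h h3.symm

/-- When the product gains a cycle, its lowest degree is one less, and the factor `X` lifts it
exactly to the lowest degree of `f`. -/
theorem lowCoeff_eq_add (hn : 2 ≤ n) {f : Equiv.Perm ℤ} (hf : f ∈ affinePerms n)
    (hd : displacement n f = k * n) {p : ℤ} (h1 : f p < f (p + 1)) (h2 : f⁻¹ p < f⁻¹ (p + 1))
    (hne : ¬ (n : ℤ) ∣ f p - p)
    (hc : cycleNumber n (f * affineSwap hn p : Equiv.Perm ℤ) = cycleNumber n f + 1) :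
    lowCoeff n k f = lowCoeff n k (affineSwap hn p * f * affineSwap hn p : Equiv.Perm ℤ) +
      lowCoeff n k (f * affineSwap hn p : Equiv.Perm ℤ) := by
  have hs := affineSwap_mem hn p
  have hle := cycleNumber_le (n := n) (f * affineSwap hn p : Equiv.Perm ℤ)
  unfold lowCoeff
  rw [countPoly_of_lt_of_lt hn hf hd h1 h2 fun h => hne h.1, cycleNumber_affineSwap_conj, add_mul,
    one_mul, coeff_add, coeff_add, hc,
    show n - cycleNumber n f = n - (cycleNumber n f + 1) + 1 by omega, coeff_X_mul, coeff_X_mul,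
    countPoly_coeff_eq_zero (f := affineSwap hn p * f * affineSwap hn p)
      (Subgroup.mul_mem _ (Subgroup.mul_mem _ hs hf) hs)
      (by rw [displacement_affineSwap_conj hn hf, hd]) (by rw [cycleNumber_affineSwap_conj]; omega),
    zero_add]

/-- If all residues are fixed, then the lowest coefficient is `1`. -/
theorem lowCoeff_of_forall_dvd {f : Equiv.Perm ℤ} (hf : f ∈ affinePerms n)
    (hb : ∀ j, j ≤ f j ∧ f j ≤ j + n) (hd : displacement n f = k * n)
    (h : ∀ j, (n : ℤ) ∣ f j - j) : lowCoeff n k f = 1 := by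
  classical
  have hpos := countPoly_coeff_zero_pos hf hb hd h
  unfold lowCoeff
  rw [cycleNumber_eq_of_forall_dvd h, Nat.sub_self]
  refine le_antisymm ?_ hpos
  obtain ⟨hkn, v, w, hw, rfl⟩ := exists_pairPerm hf hb hd
  obtain ⟨lam, hlam, hlw⟩ := hw.exists_youngDiagram hkn
  rw [(hasCount_pairPerm hkn hlam hlw v).countPoly_eq,
    deogramSum_coeff (fun d hd => absurd hd (Nat.not_lt_zero d))]
  norm_cast
  rw [← Finset.card_singleton (∅ : Finset (ℕ × ℕ))]
  refine Finset.card_le_card fun D hD => ?_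
  rw [Finset.mem_filter] at hD
  rw [Finset.mem_singleton, ← Finset.card_eq_zero]
  exact hD.2.2

end LowCoeff

end PositroidCatalan

namespace PositroidCatalan

-- Height functions and concave systems

section Heights

variable {n k : ℕ}

/-- Height functions over `f` that touch the diagonal exactly at the bases `B`. -/
def heights (n : ℕ) (f : ℤ → ℤ) (B : Set ℤ) : Set (ℤ → ℤ) :=
  {y | (∀ j, y (j + n) = y j + n) ∧ (∀ j, y (f j) = y j ∨ y (f j) = y j + n) ∧
    (∀ j, j ≤ y j) ∧ ∀ j, y j = j ↔ j ∈ B}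

/-- A bounded affine permutation with at most one base in each cycle, together with a monotone
function that is strictly concave along each cycle except at the bases. -/
structure IsConcaveSystem (n k : ℕ) (f : Equiv.Perm ℤ) (B : Set ℤ) (x : ℤ → ℤ) (M : ℤ) : Prop where
  mem : f ∈ affinePerms n
  bounded : ∀ j, j ≤ f j ∧ f j ≤ j + n
  displacement_eq : displacement n f = k * n
  base_add : ∀ j : ℤ, j + n ∈ B ↔ j ∈ B
  mono : Monotone x
  map_add : ∀ j, x (j + n) = x j + M
  concave : ∀ j, j ∉ B → x (f j) - x j < x j - x (f⁻¹ j)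
  base_unique : ∀ b ∈ B, ∀ b' ∈ B, CycleRel n f b b' → (n : ℤ) ∣ b - b'

theorem heights_add_mul {f : ℤ → ℤ} {B : Set ℤ} {y : ℤ → ℤ} (hy : y ∈ heights n f B) (j m : ℤ) :
    y (j + n * m) = y j + n * m := map_add_mul hy.1 j m

/-- Along a cycle `y` changes only by multiples of `n`, so its residue is that of the base. -/
theorem heights_dvd_of_rel {f : ℤ → ℤ} {B : Set ℤ} {y : ℤ → ℤ} (hy : y ∈ heights n f B) {b j : ℤ}
    (hb : b ∈ B) (h : CycleRel n f j b) : (n : ℤ) ∣ y j - b := by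
  refine (h.iff_of_closed (Q := fun i => (n : ℤ) ∣ y i - b) (fun i => ?_) (fun i => ?_)).2 ?_
  · rw [hy.1, show y i + n - b = y i - b + n by ring, dvd_add_self_right]
  · rcases hy.2.1 i with h | h
    · rw [h]
    · rw [h, show y i + n - b = y i - b + n by ring, dvd_add_self_right]
  · rw [(hy.2.2.2 b).2 hb, sub_self]
    exact dvd_zero _

namespace IsConcaveSystem

variable {f : Equiv.Perm ℤ} {B : Set ℤ} {x : ℤ → ℤ} {M : ℤ}

theorem base_of_dvd (h : IsConcaveSystem n k f B x M) {i j : ℤ} (hij : (n : ℤ) ∣ i - j) :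
    i ∈ B ↔ j ∈ B := by
  have := periodic_of_dvd (x := fun j => j ∈ B) (fun j => propext (h.base_add j)) hij
  exact iff_of_eq this

theorem rel_inv (f : Equiv.Perm ℤ) (j : ℤ) : CycleRel n f (f⁻¹ j) j := by
  have := cycleRel_apply (n := n) (f := f) (f⁻¹ j)
  rw [show f (f⁻¹ j) = j from f.apply_symm_apply j] at this
  exact this.symm

theorem inv_add (h : IsConcaveSystem n k f B x M) (j : ℤ) : f⁻¹ (j + n) = f⁻¹ j + n :=
  (affinePerms n).inv_mem h.mem j

/-- Lowering the witness at a base. -/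
theorem exists_flat (h : IsConcaveSystem n k f B x M) (hn : 2 ≤ n) {p : ℤ} (hp : p + 1 ∈ B) :
    ∃ x', IsConcaveSystem n k f B x' M ∧ x' p = x' (p + 1) := by
  set x' : ℤ → ℤ := fun j => if (n : ℤ) ∣ j - (p + 1) then x (j - 1) else x j with hx'
  have hle : ∀ j, x' j ≤ x j := by
    intro j
    simp only [hx']
    split_ifs
    · exact h.mono (by omega)
    · exact le_rfl
  have hge : ∀ j, x (j - 1) ≤ x' j := by
    intro j
    simp only [hx']
    split_ifs
    · exact le_rfl
    · exact h.mono (by omega)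
  have hB : ∀ j, j ∉ B → x' j = x j := fun j hj => if_neg fun hdvd => hj ((h.base_of_dvd hdvd).2 hp)
  -- Concavity is required only at non-bases, where a base may enter as a neighbor; lowering a
  -- neighbor strengthens the inequality.
  refine ⟨x', { h with mono := ?_, map_add := ?_, concave := ?_ }, ?_⟩
  · refine monotone_int_of_le_succ fun j => ?_
    have := hge (j + 1)
    rw [add_sub_cancel_right] at this
    exact (hle j).trans this
  · intro j
    simp only [hx', show j + n - (p + 1) = j - (p + 1) + n by ring, dvd_add_self_right]
    split_ifs
    · rw [show j + n - 1 = j - 1 + n by ring, h.map_add]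
    · exact h.map_add j
  · intro j hj
    have h1 := h.concave j hj
    have h2 := hB j hj
    have h3 := hle (f j)
    have h4 := hle (f⁻¹ j)
    omega
  · simp only [hx', sub_self, dvd_zero, if_true, add_sub_cancel_right]
    rw [if_neg]
    rw [sub_add_cancel_left, dvd_neg]
    exact two_le_not_dvd_one hn

theorem flat_affineSwap (h : IsConcaveSystem n k f B x M) (hn : 2 ≤ n) {p : ℤ}
    (hp : x p = x (p + 1)) (j : ℤ) : x (affineSwap hn p j) = x j := by
  have hm : ∀ j m : ℤ, x (j + n * m) = x j + M * m := by
    intro j m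
    have h1 : (fun j => n * x j - M * j) (j + n * m) = (fun j => n * x j - M * j) j :=
      periodic_add_mul (n := n) (x := fun j => (n : ℤ) * x j - M * j)
        (fun j => by simp only [h.map_add]; ring) j m
    have h2 : (n : ℤ) * (x (j + n * m)) = n * (x j + M * m) := by
      simp only at h1
      linarith
    exact mul_left_cancel₀ (by omega) h2
  rcases affineSwap_cases hn p j with ⟨⟨m, h1⟩, h2⟩ | ⟨⟨m, h1⟩, h2⟩ | ⟨-, -, h2⟩
  · rw [h2, show j = p + n * m by linarith, show p + n * m + 1 = p + 1 + n * m by ring, hm, hm, hp]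
  · rw [h2, show j = p + 1 + n * m by linarith, show p + 1 + n * m - 1 = p + n * m by ring, hm, hm,
      hp]
  · rw [h2]

variable [NeZero n]

/-- The slope is maximal exactly after a base. -/
theorem exists_base_max (h : IsConcaveSystem n k f B x M) (j : ℤ) : ∃ b ∈ B, CycleRel n f b j ∧
    ∀ i, CycleRel n f i j → x (f i) - x i ≤ x (f b) - x b := by
  obtain ⟨b, hb, hmax⟩ := exists_max_of_periodic (n := n) (φ := fun i => x (f i) - x i)
    (fun i => by rw [h.mem, h.map_add, h.map_add]; ring) (Q := fun i => CycleRel n f i j)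
    (fun i => cycleRel_add_left_iff) (CycleRel.refl j)
  refine ⟨b, ?_, hb, hmax⟩
  by_contra hbB
  -- At a non-base the incoming slope is strictly larger, contradicting maximality.
  have h1 := hmax (f⁻¹ b) ((rel_inv f b).trans hb)
  have h2 := h.concave b hbB
  rw [show f (f⁻¹ b) = b from f.apply_symm_apply b] at h1
  omega

/-- The slope is minimal exactly before a base. -/
theorem exists_base_min (h : IsConcaveSystem n k f B x M) (j : ℤ) : ∃ b ∈ B, CycleRel n f b j ∧
    ∀ i, CycleRel n f i j → x b - x (f⁻¹ b) ≤ x i - x (f⁻¹ i) := by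
  obtain ⟨b, hb, hmax⟩ := exists_max_of_periodic (n := n) (φ := fun i => x (f⁻¹ i) - x i)
    (fun i => by rw [h.inv_add, h.map_add, h.map_add]; ring) (Q := fun i => CycleRel n f i j)
    (fun i => cycleRel_add_left_iff) (CycleRel.refl j)
  have hmax' : ∀ i, CycleRel n f i j → x b - x (f⁻¹ b) ≤ x i - x (f⁻¹ i) := fun i hi => by
    have := hmax i hi
    omega
  refine ⟨b, ?_, hb, hmax'⟩
  by_contra hbB
  have h1 := hmax' (f b) ((cycleRel_apply b).trans hb)
  have h2 := h.concave b hbB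
  rw [show f⁻¹ (f b) = b from f.symm_apply_apply b] at h1
  omega

/-- The base has the largest outgoing slope of its cycle, and at a non-base the slope has strictly
dropped. When `x` is flat at `p`, `p + 1`, monotonicity turns this into the order of `f p` and `f (p
+ 1)`. -/
theorem slope_lt (h : IsConcaveSystem n k f B x M) {b j : ℤ} (hb : b ∈ B) (hj : j ∉ B)
    (hjb : CycleRel n f j b) : x (f j) - x j < x (f b) - x b := by
  obtain ⟨b', hb', hrel, hmax⟩ := h.exists_base_max b
  have h1 : x (f b') - x b' = x (f b) - x b := by
    obtain ⟨m, hm⟩ := h.base_unique b' hb' b hb hrel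
    refine periodic_of_dvd (n := n) (x := fun i => x (f i) - x i) (fun i => ?_) ⟨m, hm⟩
    simp only [h.mem i, h.map_add]
    ring
  have h2 := hmax (f⁻¹ j) ((rel_inv f j).trans hjb)
  have h3 := h.concave j hj
  rw [show f (f⁻¹ j) = j from f.apply_symm_apply j] at h2
  omega

theorem slope_inv_lt (h : IsConcaveSystem n k f B x M) {b j : ℤ} (hb : b ∈ B) (hj : j ∉ B)
    (hjb : CycleRel n f j b) : x b - x (f⁻¹ b) < x j - x (f⁻¹ j) := by
  obtain ⟨b', hb', hrel, hmin⟩ := h.exists_base_min b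
  have h1 : x b' - x (f⁻¹ b') = x b - x (f⁻¹ b) := by
    obtain ⟨m, hm⟩ := h.base_unique b' hb' b hb hrel
    refine periodic_of_dvd (n := n) (x := fun i => x i - x (f⁻¹ i)) (fun i => ?_) ⟨m, hm⟩
    simp only [h.inv_add i, h.map_add]
    ring
  have h2 := hmin (f j) ((cycleRel_apply j).trans hjb)
  have h3 := h.concave j hj
  rw [show f⁻¹ (f j) = j from f.symm_apply_apply j] at h2
  omega

/-- Conjugation by a transposition at which the witness is flat. -/
theorem conj (h : IsConcaveSystem n k f B x M) (hn : 2 ≤ n) {p : ℤ} (hp : x p = x (p + 1))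
    (h1 : f p ≠ p + 1) (h2 : f (p + 1) ≠ p + n) :
    IsConcaveSystem n k (affineSwap hn p * f * affineSwap hn p) (affineSwap hn p ⁻¹' B) x M where
  mem := Subgroup.mul_mem _ (Subgroup.mul_mem _ (affineSwap_mem hn p) h.mem) (affineSwap_mem hn p)
  bounded := bounded_affineSwap_conj hn h.mem h.bounded h1 h2
  displacement_eq := by rw [displacement_affineSwap_conj hn h.mem, h.displacement_eq]
  base_add := fun j => by
    rw [Set.mem_preimage, Set.mem_preimage, affineSwap_mem hn p, h.base_add]
  mono := h.mono
  map_add := h.map_add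
  concave := fun j hj => by
    have h3 := h.concave _ hj
    have e := h.flat_affineSwap hn hp
    simp only [mul_inv_rev, affineSwap_inv, Equiv.Perm.mul_apply, e]
    rwa [e] at h3
  base_unique := fun b hb b' hb' hrel => by
    obtain ⟨m, hm⟩ := h.base_unique _ hb _ hb' ((cycleRel_affineSwap_conj_iff hn).1 hrel)
    refine ⟨m, ?_⟩
    have h3 : affineSwap hn p b = affineSwap hn p (b' + n * m) := by
      rw [affinePerms_add_mul (affineSwap_mem hn p)]
      linarith
    rw [(affineSwap hn p).injective h3]
    ring

/-- Splitting a cycle at a base separates the base from its predecessor. -/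
theorem exists_separating (h : IsConcaveSystem n k f B x M) (hn : 2 ≤ n) {p : ℤ} (hB : p + 1 ∈ B)
    (hp : x p = x (p + 1)) (hrel : CycleRel n f p (p + 1)) :
    ¬ CycleRel n (f * affineSwap hn p : Equiv.Perm ℤ) p (p + 1) := by
  have hs := affineSwap_mem hn p
  have e := h.flat_affineSwap hn hp
  have hpB : p ∉ B := fun hpB => by
    have := h.base_unique _ hB _ hpB hrel.symm
    rw [add_sub_cancel_left] at this
    exact two_le_not_dvd_one hn this
  have hsrel : ∀ j, CycleRel n f (affineSwap hn p j) j := fun j y hy =>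
    periodic_affineSwap hn hy.1 (hrel y hy) j
  -- After the splitting, the cycle through the base continues as `p` did before. Its outgoing
  -- slopes start with that of `p` and only decrease, while `p` itself takes over the larger slope
  -- of the base.
  set Q : ℤ → Prop := fun j => CycleRel n f j p ∧
    x (f (affineSwap hn p j)) - x j ≤ x (f p) - x p with hQ
  have hQ1 : ∀ j, Q (j + n) ↔ Q j := fun j => by
    simp only [hQ, cycleRel_add_left_iff]
    rw [hs j, h.mem, h.map_add, h.map_add, add_sub_add_right_eq_sub]
  have hlt := h.slope_lt hB hpB hrel
  have hQ2 : ∀ j, Q j → Q ((f * affineSwap hn p) j) := by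
    rintro j ⟨h1, h2⟩
    rw [Equiv.Perm.mul_apply]
    set i := affineSwap hn p j with hi
    have hj : j = affineSwap hn p i := by rw [hi, affineSwap_affineSwap]
    refine ⟨(cycleRel_apply i).trans ((hsrel j).trans h1), ?_⟩
    rw [hj, e] at h2
    rcases affineSwap_cases hn p (f i) with ⟨⟨m, h3⟩, -⟩ | ⟨⟨m, h3⟩, h4⟩ | ⟨h3, h4, h5⟩
    · exfalso
      have hfi : f i = p + n * m := by linarith
      have h5 : i = f⁻¹ p + n * m := by
        rw [← affinePerms_add_mul ((affinePerms n).inv_mem h.mem), ← hfi]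
        exact (f.symm_apply_apply i).symm
      have h6 := h.concave p hpB
      have h7 : x (f i) - x i = x p - x (f⁻¹ p) := by
        have := periodic_of_dvd (n := n) (x := fun j => x (f j) - x j)
          (fun j => by simp only [h.mem j, h.map_add]; ring) (i := i) (j := f⁻¹ p)
          ⟨m, by rw [h5]; ring⟩
        rw [this, show f (f⁻¹ p) = p from f.apply_symm_apply p]
      omega
    · have hfi : f i = p + 1 + n * m := by linarith
      rw [h4, hfi, show p + 1 + n * m - 1 = p + n * m by ring]
      have := periodic_of_dvd (n := n) (x := fun j => x (f j) - x j)
          (fun j => by simp only [h.mem j, h.map_add]; ring) (i := p + n * m) (j := p)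
          ⟨m, by ring⟩
      have h7 : x (p + n * m) = x (p + 1 + n * m) := by
        rw [← e (p + n * m), affinePerms_add_mul hs, affineSwap_self]
      omega
    · rw [h5]
      have hfB : f i ∉ B := by
        intro hfB
        apply h4
        refine h.base_unique _ hfB _ hB ?_
        exact (cycleRel_apply i).trans ((hsrel j).trans (h1.trans hrel))
      have h6 := h.concave _ hfB
      rw [show f⁻¹ (f i) = i from f.symm_apply_apply i] at h6
      omega
  intro hcon
  have hclosed := closed_iff_of_imp (Subgroup.mul_mem _ h.mem hs) hQ1 hQ2
  have hiff := hcon.iff_of_closed hQ1 hclosed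
  have h1 : ¬ Q p := by
    rintro ⟨-, h2⟩
    rw [affineSwap_self] at h2
    omega
  have h2 : Q (p + 1) := by
    refine ⟨hrel.symm, ?_⟩
    rw [affineSwap_succ]
    omega
  exact h1 (hiff.2 h2)

end IsConcaveSystem

end Heights

end PositroidCatalan

namespace PositroidCatalan

-- The Catalan recursion for height functions

section CatalanRecursion

variable {n k : ℕ}

theorem dvd_of_rel_of_fixed {f : Equiv.Perm ℤ} (hf : f ∈ affinePerms n) {i j : ℤ}
    (h : CycleRel n f i j) (hi : (n : ℤ) ∣ f i - i) : (n : ℤ) ∣ j - i := by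
  have h1 := h _ (indicator_mem_invariants hf hi)
  simp only [sub_self, dvd_zero, if_true] at h1
  by_contra h2
  rw [if_neg h2] at h1
  exact one_ne_zero h1

/-- Conjugating a height function by the transposition preserves the bound `j ≤ y j` unless the
values at positions congruent to `p` are their successors, that is, `y p = p + 1`. -/
theorem heights_conj (hn : 2 ≤ n) {f : Equiv.Perm ℤ} {B : Set ℤ} {p : ℤ} (hB : p + 1 ∈ B) :
    heights n (affineSwap hn p * f * affineSwap hn p : Equiv.Perm ℤ) (affineSwap hn p ⁻¹' B) =
      (fun y => affineSwap hn p ∘ y ∘ affineSwap hn p) '' {y ∈ heights n f B | y p ≠ p + 1} := by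
  have hs := affineSwap_mem hn p
  have key : ∀ {f : Equiv.Perm ℤ} {B : Set ℤ} {y : ℤ → ℤ}, y ∈ heights n f B → y p ≠ p + 1 →
      (affineSwap hn p ∘ y ∘ affineSwap hn p) ∈ heights n
        (affineSwap hn p * f * affineSwap hn p : Equiv.Perm ℤ) (affineSwap hn p ⁻¹' B) := by
    rintro f B y hy hyp
    refine ⟨fun j => ?_, fun j => ?_, fun j => ?_, fun j => ?_⟩
    · simp only [Function.comp_apply]
      rw [hs j, hy.1, hs]
    · simp only [Function.comp_apply, Equiv.Perm.mul_apply, affineSwap_affineSwap]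
      rcases hy.2.1 (affineSwap hn p j) with h | h
      · left
        rw [h]
      · right
        rw [h, hs]
    · obtain ⟨i, rfl⟩ := (affineSwap hn p).surjective j
      simp only [Function.comp_apply, affineSwap_affineSwap]
      have h1 := hy.2.2.1 i
      rw [← not_lt, affineSwap_lt_iff hn]
      · omega
      · rintro ⟨-, h2⟩
        omega
      · rintro ⟨⟨m, hm⟩, h2⟩
        apply hyp
        have h3 : i = p + n * m := by linarith
        rw [h3, heights_add_mul hy] at h2
        linarith
    · obtain ⟨i, rfl⟩ := (affineSwap hn p).surjective j
      simp only [Function.comp_apply, affineSwap_affineSwap, Set.mem_preimage]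
      rw [(affineSwap hn p).injective.eq_iff, hy.2.2.2]
  ext y
  rw [Set.mem_image]
  constructor
  · intro hy
    have hyp : y p = p := (hy.2.2.2 p).2 (by rwa [Set.mem_preimage, affineSwap_self])
    have h1 := key hy (by rw [hyp]; omega)
    rw [affineSwap_conj_conj, ← Set.preimage_comp] at h1
    have h2 : (affineSwap hn p : ℤ → ℤ) ∘ affineSwap hn p = id :=
      funext (affineSwap_affineSwap hn p)
    rw [h2, Set.preimage_id] at h1
    refine ⟨_, ⟨h1, fun h3 => ?_⟩, ?_⟩
    · simp only [Function.comp_apply, affineSwap_self] at h3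
      have h4 := hy.2.2.1 (p + 1)
      have h5 : y (p + 1) = p := by
        rw [← affineSwap_affineSwap hn p (y (p + 1)), h3, affineSwap_succ]
      omega
    · funext j
      simp only [Function.comp_apply, affineSwap_affineSwap]
  · rintro ⟨y, ⟨hy, hyp⟩, rfl⟩
    exact key hy hyp

theorem affineSwap_conj_injective (hn : 2 ≤ n) (p : ℤ) :
    Function.Injective fun y : ℤ → ℤ => (affineSwap hn p) ∘ y ∘ (affineSwap hn p) := by
  intro y z h
  funext j
  have := congrFun h (affineSwap hn p j)
  simp only [Function.comp_apply, affineSwap_affineSwap] at this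
  exact (affineSwap hn p).injective this

namespace IsConcaveSystem

variable {f : Equiv.Perm ℤ} {B : Set ℤ} {x : ℤ → ℤ} {M : ℤ}

theorem pred_notMem (h : IsConcaveSystem n k f B x M) (hn : 2 ≤ n) {p : ℤ} (hB : p + 1 ∈ B)
    (hrel : CycleRel n f p (p + 1)) : p ∉ B := fun hpB => by
  have := h.base_unique _ hB _ hpB hrel.symm
  rw [add_sub_cancel_left] at this
  exact two_le_not_dvd_one hn this

theorem not_dvd_pred (h : IsConcaveSystem n k f B x M) (hn : 2 ≤ n) {p : ℤ}
    (hrel : CycleRel n f p (p + 1)) : ¬ (n : ℤ) ∣ f p - p := fun hd => by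
  have := dvd_of_rel_of_fixed h.mem hrel hd
  rw [add_sub_cancel_left] at this
  exact two_le_not_dvd_one hn this

variable [NeZero n]

/-- Splitting a cycle at a base. -/
theorem split (h : IsConcaveSystem n k f B x M) (hn : 2 ≤ n) {p : ℤ} (hB : p + 1 ∈ B)
    (hp : x p = x (p + 1)) (hrel : CycleRel n f p (p + 1)) (hlt : f (p + 1) < p + 1 + n) :
    IsConcaveSystem n k (f * affineSwap hn p) (B ∪ {j | (n : ℤ) ∣ j - p}) x M where
  mem := Subgroup.mul_mem _ h.mem (affineSwap_mem hn p)
  bounded := by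
    refine bounded_mul_affineSwap hn h.mem h.bounded ?_ (by omega)
    have h1 := (h.bounded p).1
    have h2 : f p ≠ p := fun h2 => h.not_dvd_pred hn hrel (by rw [h2, sub_self]; exact dvd_zero _)
    omega
  displacement_eq := by rw [displacement_mul_affineSwap hn h.mem, h.displacement_eq]
  base_add := fun j => by
    rw [Set.mem_union, Set.mem_union, h.base_add, Set.mem_ofPred_eq, Set.mem_ofPred_eq,
      show j + n - p = j - p + n by ring, dvd_add_self_right]
  mono := h.mono
  map_add := h.map_add
  concave := fun j hj => by
    rw [Set.mem_union, not_or] at hj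
    have e := h.flat_affineSwap hn hp
    have h1 : affineSwap hn p j = j := affineSwapFun_of_not hj.2
      fun h2 => hj.1 ((h.base_of_dvd h2).2 hB)
    rw [mul_inv_rev, affineSwap_inv, Equiv.Perm.mul_apply, Equiv.Perm.mul_apply, e, h1]
    exact h.concave j hj.1
  base_unique := by
    have hsep := h.exists_separating hn hB hp hrel
    have hle : ∀ i j, CycleRel n (f * affineSwap hn p : Equiv.Perm ℤ) i j → CycleRel n f i j := by
      intro i j hij y hy
      refine hij y ⟨hy.1, fun l => ?_⟩
      rw [Equiv.Perm.mul_apply, hy.2, periodic_affineSwap hn hy.1 (hrel y hy)]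
    have hmix : ∀ i ∈ B, ∀ j, (n : ℤ) ∣ j - p →
        ¬ CycleRel n (f * affineSwap hn p : Equiv.Perm ℤ) i j := by
      intro i hi j hj hij
      have h1 : CycleRel n f i (p + 1) :=
        (hle _ _ hij).trans ((cycleRel_of_dvd hj).trans hrel)
      have h2 := h.base_unique _ hi _ hB h1
      exact hsep ((cycleRel_of_dvd hj).symm.trans (hij.symm.trans (cycleRel_of_dvd h2)))
    rintro i (hi | hi) j (hj | hj) hij
    · exact h.base_unique _ hi _ hj (hle _ _ hij)
    · exact absurd hij (hmix i hi j hj)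
    · exact absurd hij.symm (hmix j hj i hi)
    · have := dvd_sub hi hj
      rwa [sub_sub_sub_cancel_right] at this

theorem exists_base (h : IsConcaveSystem n k f B x M) (j : ℤ) : ∃ b ∈ B, CycleRel n f b j := by
  obtain ⟨b, hb, hrel, -⟩ := h.exists_base_max j
  exact ⟨b, hb, hrel⟩

-- The complementary case of `heights_conj`: if `y p = p + 1`, then `y` agrees at `p` and `p + 1`,
-- so it also follows the product; lowering it by one on the split-off cycle of `p` makes it touch
-- the diagonal exactly at the new base.
open Classical in
theorem heights_split (h : IsConcaveSystem n k f B x M) (hn : 2 ≤ n) {p : ℤ} (hB : p + 1 ∈ B)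
    (hp : x p = x (p + 1)) (hrel : CycleRel n f p (p + 1)) :
    heights n (f * affineSwap hn p : Equiv.Perm ℤ) (B ∪ {j | (n : ℤ) ∣ j - p}) =
      (fun y j => y j - if CycleRel n (f * affineSwap hn p : Equiv.Perm ℤ) j p then 1 else 0) ''
        {y ∈ heights n f B | y p = p + 1} := by
  have hsep := h.exists_separating hn hB hp hrel
  have hs := affineSwap_mem hn p
  have hle : ∀ i j, CycleRel n (f * affineSwap hn p : Equiv.Perm ℤ) i j → CycleRel n f i j := by
    intro i j hij y hy
    refine hij y ⟨hy.1, fun l => ?_⟩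
    rw [Equiv.Perm.mul_apply, hy.2, periodic_affineSwap hn hy.1 (hrel y hy)]
  set A : ℤ → Prop := fun j => CycleRel n (f * affineSwap hn p : Equiv.Perm ℤ) j p with hA
  have hAn : ∀ j, A (j + n) ↔ A j := fun j => cycleRel_add_left_iff
  have hAf : ∀ i, A (f i) ↔ A (affineSwap hn p i) := fun i => by
    have : A ((f * affineSwap hn p) (affineSwap hn p i)) ↔ A (affineSwap hn p i) :=
      cycleRel_apply_left_iff
    rwa [Equiv.Perm.mul_apply, affineSwap_affineSwap] at this
  have hAp : A p := CycleRel.refl p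
  have hAp' : ¬ A (p + 1) := fun h' => hsep h'.symm
  have hAd : ∀ {i j : ℤ}, (n : ℤ) ∣ i - j → (A i ↔ A j) := fun hij =>
    iff_of_eq (periodic_of_dvd (x := A) (fun j => propext (hAn j)) hij)
  have hAle : ∀ j, A j → CycleRel n f j p := fun j hj => hle _ _ hj
  have hAB : ∀ j, A j → j ∉ B := by
    intro j hj hjB
    have h1 := h.base_unique _ hjB _ hB ((hAle j hj).trans hrel)
    exact hAp' ((hAd h1).1 hj)
  have hswap : ∀ {y : ℤ → ℤ}, (∀ j, y (j + n) = y j + n) → y p = p + 1 → y (p + 1) = p + 1 →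
      ∀ i, y (affineSwap hn p i) = y i := by
    intro y hy h1 h2 i
    have hm : ∀ j m : ℤ, y (j + n * m) = y j + n * m := fun j m => map_add_mul hy j m
    rcases affineSwap_cases hn p i with ⟨⟨m, h3⟩, h4⟩ | ⟨⟨m, h3⟩, h4⟩ | ⟨-, -, h4⟩
    · rw [h4, show i = p + n * m by linarith, show p + n * m + 1 = p + 1 + n * m by ring, hm, hm,
        h1, h2]
    · rw [h4, show i = p + 1 + n * m by linarith, show p + 1 + n * m - 1 = p + n * m by ring, hm,
        hm, h1, h2]
    · rw [h4]
  ext y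
  rw [Set.mem_image]
  constructor
  · intro hy
    have y1 : y p = p := (hy.2.2.2 p).2 (Or.inr (by
      rw [Set.mem_ofPred_eq, sub_self]; exact dvd_zero _))
    have y2 : y (p + 1) = p + 1 := (hy.2.2.2 (p + 1)).2 (Or.inl hB)
    -- Raising the cycle of `p` by one equalizes the values at `p` and `p + 1`, so that the two
    -- cycles can be joined.
    set z : ℤ → ℤ := fun j => y j + if A j then 1 else 0 with hz
    have z1 : z p = p + 1 := by simp only [hz, hAp, if_true, y1]
    have z2 : z (p + 1) = p + 1 := by simp only [hz, hAp', if_false, y2, add_zero]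
    have zn : ∀ j, z (j + n) = z j + n := fun j => by
      simp only [hz, hAn, hy.1]
      ring
    refine ⟨z, ⟨⟨zn, fun i => ?_, fun j => ?_, fun j => ?_⟩, z1⟩, ?_⟩
    · rw [← hswap zn z1 z2 i]
      simp only [hz, hAf]
      have h1 := hy.2.1 (affineSwap hn p i)
      rw [Equiv.Perm.mul_apply, affineSwap_affineSwap] at h1
      rcases h1 with h1 | h1
      · left
        rw [h1]
      · right
        rw [h1]
        ring
    · have h1 := hy.2.2.1 j
      simp only [hz]
      split_ifs <;> omega
    · by_cases hj : A j
      · simp only [hz, hj, if_true]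
        have h1 := hy.2.2.1 j
        exact iff_of_false (by omega) (hAB j hj)
      · simp only [hz, hj, if_false, add_zero, hy.2.2.2]
        refine or_iff_left fun h1 => ?_
        exact hj ((hAd h1).2 hAp)
    · funext j
      simp only [hz]
      ring
  · rintro ⟨z, ⟨hz, z1⟩, hzy⟩
    have hY : ∀ j, y j = z j - if A j then 1 else 0 := fun j => (congrFun hzy j).symm
    clear_value A
    have z2 : z (p + 1) = p + 1 := (hz.2.2.2 (p + 1)).2 hB
    refine ⟨fun j => ?_, fun j => ?_, fun j => ?_, fun j => ?_⟩
    · simp only [hY, hAn, hz.1]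
      ring
    · obtain ⟨i, rfl⟩ := (affineSwap hn p).surjective j
      rw [Equiv.Perm.mul_apply, affineSwap_affineSwap, hY, hY, hswap hz.1 z1 z2]
      simp only [hAf]
      rcases hz.2.1 i with h1 | h1
      · left
        rw [h1]
      · right
        rw [h1]
        ring
    · have h1 := hz.2.2.1 j
      rw [hY]
      by_cases hj : A j
      · rw [if_pos hj]
        have h2 := mt (hz.2.2.2 j).1 (hAB j hj)
        omega
      · rw [if_neg hj]
        omega
    · rw [hY]
      by_cases hj : A j
      · rw [if_pos hj, Set.mem_union, or_iff_right (hAB j hj), Set.mem_ofPred_eq]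
        constructor
        · intro h1
          have h2 := heights_dvd_of_rel hz hB ((hAle j hj).trans hrel)
          rw [show z j = j + 1 by linarith, add_sub_add_right_eq_sub] at h2
          exact h2
        · rintro ⟨m, hm⟩
          rw [show j = p + n * m by linarith, heights_add_mul hz, z1]
          ring
      · rw [if_neg hj, sub_zero, hz.2.2.2, Set.mem_union]
        refine (or_iff_left fun h1 => ?_).symm
        exact hj ((hAd h1).2 hAp)

/-- One step of the recursion on both sides. Within one cycle, the height functions split according
to whether `y p = p + 1`, matching product and conjugate; between different cycles only the
conjugate occurs. -/
theorem lowCoeff_eq_of_conj (h : IsConcaveSystem n k f B x M) (hn : 2 ≤ n) {p : ℤ} (hB : p + 1 ∈ B)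
    (hp : x p = x (p + 1)) (hlt : f (p + 1) < p + 1 + n)
    (IH : ∀ (g : Equiv.Perm ℤ) (B' : Set ℤ), IsConcaveSystem n k g B' x M →
      n - cycleNumber n g < n - cycleNumber n f →
      ∃ m : ℕ, lowCoeff n k g = m ∧ (heights n g B').encard = m)
    (hconj : f p ≠ p + 1 → f (p + 1) ≠ p + n → ∃ m : ℕ,
      lowCoeff n k (affineSwap hn p * f * affineSwap hn p : Equiv.Perm ℤ) = m ∧
      (heights n (affineSwap hn p * f * affineSwap hn p : Equiv.Perm ℤ)
        (affineSwap hn p ⁻¹' B)).encard = m) :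
    ∃ m : ℕ, lowCoeff n k f = m ∧ (heights n f B).encard = m := by
  have hinj := affineSwap_conj_injective hn p
  by_cases hrel : CycleRel n f p (p + 1)
  · have hpB := h.pred_notMem hn hB hrel
    have hnd := h.not_dvd_pred hn hrel
    have s1 := h.slope_lt hB hpB hrel
    have s2 := h.slope_inv_lt hB hpB hrel
    have l1 : f p < f (p + 1) := by
      by_contra h1
      have := h.mono (not_lt.1 h1)
      omega
    have l2 : f⁻¹ p < f⁻¹ (p + 1) := by
      by_contra h1
      have := h.mono (not_lt.1 h1)
      omega
    have hle := cycleNumber_le (n := n) (f * affineSwap hn p : Equiv.Perm ℤ)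
    have hc : cycleNumber n (f * affineSwap hn p : Equiv.Perm ℤ) = cycleNumber n f + 1 := by
      have hsep := h.exists_separating hn hB hp hrel
      unfold CycleRel at hsep
      push Not at hsep
      obtain ⟨y, hy, hyp⟩ := hsep
      exact cycleNumber_mul_affineSwap_of_separating hn (fun x hx => hrel x hx) hy hyp
    obtain ⟨m₂, hm₂, he₂⟩ := IH _ _ (h.split hn hB hp hrel hlt) (by omega)
    rw [h.heights_split hn hB hp hrel, Function.Injective.encard_image] at he₂
    swap
    · intro y z hyz
      funext j
      have := congrFun hyz j
      simp only at this
      omega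
    have hunion : heights n f B =
        {y ∈ heights n f B | y p ≠ p + 1} ∪ {y ∈ heights n f B | y p = p + 1} := by
      ext y
      rw [Set.mem_union, Set.mem_ofPred_eq, Set.mem_ofPred_eq]
      tauto
    have hdisj : Disjoint {y ∈ heights n f B | y p ≠ p + 1} {y ∈ heights n f B | y p = p + 1} :=
      Set.disjoint_left.2 fun y hy hy' => hy.2 hy'.2
    have hfirst : ∃ m₁ : ℕ,
        lowCoeff n k (affineSwap hn p * f * affineSwap hn p : Equiv.Perm ℤ) = m₁ ∧
        {y ∈ heights n f B | y p ≠ p + 1}.encard = m₁ := by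
      -- Then the conjugate is unbounded and has no matrices; correspondingly the jump condition
      -- together with the base value at `p + 1` forces `y p = p + 1`.
      by_cases hb : f p = p + 1 ∨ f (p + 1) = p + n
      · refine ⟨0, ?_, ?_⟩
        · unfold lowCoeff
          rw [countPoly_of_not_bounded (by omega) (not_bounded_affineSwap_conj hn hb)]
          simp
        · rw [Nat.cast_zero, Set.encard_eq_zero, Set.eq_empty_iff_forall_notMem]
          rintro y ⟨hy, hyp⟩
          apply hyp
          have h1 : y (p + 1) = p + 1 := (hy.2.2.2 (p + 1)).2 hB
          have h2 := hy.2.2.1 p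
          rcases hb with hb | hb
          · have h3 := hy.2.1 p
            rw [hb, h1] at h3
            omega
          · have h3 := hy.2.1 (p + 1)
            rw [hb, h1, hy.1] at h3
            omega
      · push Not at hb
        obtain ⟨m₁, hm₁, he₁⟩ := hconj hb.1 hb.2
        refine ⟨m₁, hm₁, ?_⟩
        rwa [heights_conj hn hB, hinj.encard_image] at he₁
    obtain ⟨m₁, hm₁, he₁⟩ := hfirst
    refine ⟨m₁ + m₂, ?_, ?_⟩
    · rw [lowCoeff_eq_add hn h.mem h.displacement_eq l1 l2 hnd hc, hm₁, hm₂]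
      push_cast
      rfl
    · rw [hunion, Set.encard_union_eq hdisj, he₁, he₂]
      push_cast
      rfl
  · have hfp : f p ≠ p + 1 := fun h1 => hrel (by
      rw [← h1]
      exact (cycleRel_apply p).symm)
    have hfp1 : f (p + 1) ≠ p + n := fun h1 => hrel (by
      have h2 := cycleRel_apply (n := n) (f := f) (p + 1)
      rw [h1] at h2
      exact cycleRel_add_left_iff.1 h2)
    obtain ⟨m, hm, he⟩ := hconj hfp hfp1
    refine ⟨m, ?_, ?_⟩
    · rw [← lowCoeff_conj_of_not_rel hn h.mem h.displacement_eq hrel, hm]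
    · rw [heights_conj hn hB, hinj.encard_image] at he
      rw [← he]
      congr 1
      ext y
      rw [Set.mem_ofPred_eq]
      -- The residue of `y p` is that of the base in the cycle of `p`, so `y p = p + 1` would put `p
      -- + 1` into this cycle.
      refine ⟨fun hy => ⟨hy, fun hyp => hrel ?_⟩, fun hy => hy.1⟩
      obtain ⟨b, hb, hbp⟩ := h.exists_base p
      have h1 := heights_dvd_of_rel hy hb hbp.symm
      rw [hyp] at h1
      exact hbp.symm.trans (cycleRel_of_dvd h1).symm

end IsConcaveSystem

end CatalanRecursion

end PositroidCatalan

namespace PositroidCatalan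

-- Termination of the recursion

section CatalanRecursion

variable {n k : ℕ} [NeZero n]

namespace IsConcaveSystem

variable {f : Equiv.Perm ℤ} {B : Set ℤ} {x : ℤ → ℤ} {M : ℤ}

/-- If all residues are fixed, each cycle is its own base, and the identity is the only height
function. -/
theorem encard_heights_of_forall_dvd (h : IsConcaveSystem n k f B x M)
    (hfix : ∀ j, (n : ℤ) ∣ f j - j) : (heights n f B).encard = 1 := by
  have hn : 0 < n := Nat.pos_of_ne_zero (NeZero.ne n)
  have hB : ∀ j, j ∈ B := fun j => by
    obtain ⟨b, hb, hrel⟩ := h.exists_base j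
    exact (h.base_of_dvd (dvd_of_rel_of_fixed h.mem hrel (hfix b))).2 hb
  rw [Set.encard_eq_one]
  refine ⟨id, Set.eq_singleton_iff_unique_mem.2 ⟨⟨fun j => rfl, fun j => ?_, fun j => le_rfl,
    fun j => iff_of_true rfl (hB j)⟩, fun y hy => funext fun j => (hy.2.2.2 j).2 (hB j)⟩⟩
  obtain ⟨m, hm⟩ := hfix j
  have h1 := h.bounded j
  have hn' : (0 : ℤ) < n := by exact_mod_cast hn
  have hm0 : 0 ≤ m := by
    by_contra hcon
    have : (n : ℤ) * m ≤ n * (-1) := mul_le_mul_of_nonneg_left (by omega) hn'.le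
    omega
  have hm1 : m ≤ 1 := by
    by_contra hcon
    have : (n : ℤ) * 2 ≤ n * m := mul_le_mul_of_nonneg_left (by omega) hn'.le
    omega
  simp only [id_eq]
  interval_cases m
  · left
    linarith
  · right
    linarith

/-- Moving the base `p + 1` down to its image modulo `n`. -/
theorem encard_heights_of_lt (d N : ℕ) (h : IsConcaveSystem n k f B x M) (hn : 2 ≤ n) {p : ℤ}
    (hB : p + 1 ∈ B) (hlt : p + 1 < f (p + 1)) (hd : f (p + 1) + d = p + n)
    (hN : n - cycleNumber n f = N)
    (IH : ∀ (g : Equiv.Perm ℤ) (B' : Set ℤ) (x' : ℤ → ℤ), IsConcaveSystem n k g B' x' M →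
      n - cycleNumber n g < N →
      ∃ m : ℕ, lowCoeff n k g = m ∧ (heights n g B').encard = m) :
    ∃ m : ℕ, lowCoeff n k f = m ∧ (heights n f B).encard = m := by
  induction d generalizing f B x p with
  | zero =>
    obtain ⟨x', h', hx'⟩ := h.exists_flat hn hB
    refine h'.lowCoeff_eq_of_conj hn hB hx' (by omega)
      (fun g B' hg hlt => IH g B' x' hg (hN ▸ hlt)) fun _ h2 => ?_
    exact absurd (by push_cast at hd; omega) h2
  | succ d ih =>
    push_cast at hd
    obtain ⟨x', h', hx'⟩ := h.exists_flat hn hB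
    refine h'.lowCoeff_eq_of_conj hn hB hx' (by omega)
      (fun g B' hg hlt => IH g B' x' hg (hN ▸ hlt)) fun h1 h2 => ?_
    -- The base moves from `p + 1` to `p` while its image stays in place, so the distance to the end
    -- point, where the conjugate becomes unbounded, shrinks by one.
    have hval : (affineSwap hn p * f * affineSwap hn p : Equiv.Perm ℤ) p = f (p + 1) := by
      rw [Equiv.Perm.mul_apply, Equiv.Perm.mul_apply, affineSwap_self]
      refine affineSwapFun_of_not (fun h3 => ?_) fun h3 => ?_
      · have := Int.le_of_dvd (by omega) h3
        omega
      · have := Int.le_of_dvd (by omega) h3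
        omega
    refine ih (p := p - 1) (h'.conj hn hx' h1 h2) ?_ ?_ ?_ ?_
    · rwa [Set.mem_preimage, sub_add_cancel, affineSwap_self]
    · rw [sub_add_cancel, hval]
      omega
    · rw [sub_add_cancel, hval]
      omega
    · rw [cycleNumber_affineSwap_conj, hN]

/-- The lowest coefficient of the point count is the number of height functions. -/
theorem encard_heights (h : IsConcaveSystem n k f B x M) :
    ∃ m : ℕ, lowCoeff n k f = m ∧ (heights n f B).encard = m := by
  induction hN : n - cycleNumber n f using Nat.strong_induction_on generalizing f B x with
  | _ N IH =>
    by_cases hfix : ∀ j, (n : ℤ) ∣ f j - j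
    · refine ⟨1, ?_, ?_⟩
      · rw [lowCoeff_of_forall_dvd h.mem h.bounded h.displacement_eq hfix]
        rfl
      · rw [h.encard_heights_of_forall_dvd hfix]
        rfl
    · push Not at hfix
      obtain ⟨j, hj⟩ := hfix
      obtain ⟨b, hb, hrel⟩ := h.exists_base j
      have hbf : ¬ (n : ℤ) ∣ f b - b := fun hd => by
        apply hj
        have h1 : (n : ℤ) ∣ f j - b := dvd_of_rel_of_fixed h.mem
          (hrel.trans (cycleRel_apply j).symm) hd
        have := dvd_sub h1 (dvd_of_rel_of_fixed h.mem hrel hd)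
        rwa [sub_sub_sub_cancel_right] at this
      have h1 := h.bounded b
      have h2 : f b ≠ b := fun h2 => hbf (by rw [h2, sub_self]; exact dvd_zero _)
      have h3 : f b ≠ b + n := fun h3 => hbf (by rw [h3, add_sub_cancel_left])
      -- The number of steps is the distance from `f b` to the copy of `b - 1` in the next period.
      refine h.encard_heights_of_lt (b - 1 + n - f b).toNat N (p := b - 1) (by omega) ?_ ?_ ?_ hN
        fun g B' x' hg hlt => IH _ hlt hg rfl
      · rwa [sub_add_cancel]
      · rw [sub_add_cancel]
        omega
      · rw [sub_add_cancel, Int.toNat_of_nonneg (by omega)]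
        ring

end IsConcaveSystem

end CatalanRecursion

end PositroidCatalan

namespace PositroidCatalan

-- The rotation by `k` and Dyck paths

section Rotation

variable {n k : ℕ}

/-- The number `t < n` with `k * t` congruent to `j`. -/
def phase (k n : ℕ) (j : ℤ) : ℕ := ((j : ZMod n) * (k : ZMod n)⁻¹).val

theorem phase_lt [NeZero n] (j : ℤ) : phase k n j < n := ZMod.val_lt _

theorem phase_add_period (j : ℤ) : phase k n (j + n) = phase k n j := by
  unfold phase
  push_cast
  rw [ZMod.natCast_self, add_zero]

theorem phase_mul (h : k.Coprime n) {m : ℕ} (hm : m < n) : phase k n (k * m) = m := by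
  unfold phase
  push_cast
  rw [mul_right_comm, ZMod.coe_mul_inv_eq_one k h, one_mul, ZMod.val_natCast_of_lt hm]

theorem dvd_sub_mul_phase [NeZero n] (h : k.Coprime n) (j : ℤ) : (n : ℤ) ∣ j - k * phase k n j := by
  rw [← ZMod.intCast_eq_intCast_iff_dvd_sub]
  unfold phase
  push_cast
  rw [ZMod.natCast_zmod_val, mul_left_comm, ZMod.coe_mul_inv_eq_one k h, mul_one]

theorem phase_eq_zero_iff [NeZero n] (h : k.Coprime n) {j : ℤ} : phase k n j = 0 ↔ (n : ℤ) ∣ j := by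
  constructor
  · intro h0
    have := dvd_sub_mul_phase h j
    rwa [h0, Nat.cast_zero, mul_zero, sub_zero] at this
  · intro hj
    unfold phase
    rw [(ZMod.intCast_zmod_eq_zero_iff_dvd j n).2 hj, zero_mul, ZMod.val_zero]

theorem phase_add [NeZero n] (h : k.Coprime n) (j : ℤ) : phase k n (j + k) = phase k n j + 1 ∨
    phase k n j + 1 = n ∧ phase k n (j + k) = 0 := by
  have h1 : (((j + k : ℤ) : ZMod n)) * (k : ZMod n)⁻¹ = (j : ZMod n) * (k : ZMod n)⁻¹ + (1 : ℕ) := by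
    push_cast
    rw [add_mul, ZMod.coe_mul_inv_eq_one k h]
  have h2 : phase k n (j + k) = (phase k n j + 1) % n := by
    unfold phase
    rw [h1, ZMod.val_add, ZMod.val_natCast, Nat.add_mod_mod]
  have h3 := phase_lt (k := k) (n := n) j
  rcases Nat.lt_or_ge (phase k n j + 1) n with h4 | h4
  · left
    rw [h2, Nat.mod_eq_of_lt h4]
  · right
    have h5 : phase k n j + 1 = n := by omega
    exact ⟨h5, by rw [h2, h5, Nat.mod_self]⟩

/-- The indicator of the multiples of `gcd(k, n)` is invariant; if it is constant, the gcd divides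
`1`. -/
theorem coprime_of_cycleNumber_eq_one {f : Equiv.Perm ℤ} (hf : ∀ j, f j = j + k)
    (hc : cycleNumber n f = 1) : k.Coprime n := by
  have hone : (fun _ => 1 : ℤ → ℚ) ∈ invariants n f := ⟨fun _ => rfl, fun _ => rfl⟩
  have hx : (fun j : ℤ => if ((k.gcd n : ℕ) : ℤ) ∣ j then (1 : ℚ) else 0) ∈ invariants n f := by
    refine ⟨fun j => ?_, fun j => ?_⟩
    · simp only [dvd_add_left (Int.natCast_dvd_natCast.2 (Nat.gcd_dvd_right k n))]
    · simp only [hf, dvd_add_left (Int.natCast_dvd_natCast.2 (Nat.gcd_dvd_left k n))]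
  unfold cycleNumber at hc
  have hne : (⟨_, hone⟩ : invariants n f) ≠ 0 := fun h =>
    one_ne_zero (congrFun (Subtype.ext_iff.1 h) 0)
  obtain ⟨c, hcx⟩ := (finrank_eq_one_iff_of_nonzero' _ hne).1 hc ⟨_, hx⟩
  have h0 := congrFun (Subtype.ext_iff.1 hcx) 0
  have h1 := congrFun (Subtype.ext_iff.1 hcx) 1
  change c * 1 = _ at h0
  change c * 1 = _ at h1
  rw [h0] at h1
  simp only [dvd_zero, if_true] at h1
  by_contra hcop
  rw [if_neg] at h1
  · exact one_ne_zero h1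
  · intro hd
    exact hcop (Nat.dvd_one.1 (by exact_mod_cast hd))

/-- With `t` the phase, `t (n - t)` is strictly concave along the cycle away from `t = 0`, and the
linear term `n² j` does not affect this, as the rotation has constant step. The linear term is steep
enough for monotonicity. -/
theorem isConcaveSystem_rotation [NeZero n] {f : Equiv.Perm ℤ} (hkn : k ≤ n) (hf : ∀ j, f j = j + k)
    (h : k.Coprime n) : IsConcaveSystem n k f {j | (n : ℤ) ∣ j}
      (fun j => n ^ 2 * j + phase k n j * (n - phase k n j)) (n ^ 3) where
  mem := fun j => by
    rw [hf, hf]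
    ring
  bounded := fun j => by
    rw [hf]
    omega
  displacement_eq := by
    unfold displacement
    simp only [hf, add_sub_cancel_left, Finset.sum_const, Finset.card_univ, Fintype.card_fin,
      nsmul_eq_mul]
    ring
  base_add := fun j => by
    rw [Set.mem_ofPred_eq, Set.mem_ofPred_eq, dvd_add_self_right]
  mono := monotone_int_of_le_succ fun j => by
    have h1 := phase_lt (k := k) (n := n) j
    have h2 := phase_lt (k := k) (n := n) (j + 1)
    have h3 : (phase k n j : ℤ) * (n - phase k n j) ≤ n * n :=
      mul_le_mul (by omega) (by omega) (by omega) (by omega)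
    have h4 : (0 : ℤ) ≤ phase k n (j + 1) * (n - phase k n (j + 1)) :=
      mul_nonneg (by omega) (by omega)
    linarith
  map_add := fun j => by
    simp only [phase_add_period]
    ring
  concave := fun j hj => by
    have hinv : f⁻¹ j = j - k := by
      rw [Equiv.Perm.inv_eq_iff_eq, hf]
      ring
    have hT : phase k n j ≠ 0 := fun h0 => hj ((phase_eq_zero_iff h).1 h0)
    -- The quadratic expression vanishes at both `t = 0` and `t = n`, so the wrap-around of the
    -- phase is harmless.
    have h1 : (phase k n (j + k) : ℤ) * (n - phase k n (j + k)) =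
        (phase k n j + 1) * (n - (phase k n j + 1)) := by
      rcases phase_add h j with h2 | ⟨h2, h3⟩
      · rw [h2]
        push_cast
        rfl
      · have h4 : (n : ℤ) = phase k n j + 1 := by exact_mod_cast h2.symm
        rw [h3, ← h4]
        simp
    have h5 : (phase k n (j - k) : ℤ) = phase k n j - 1 := by
      have h6 := phase_add h (j - k)
      rw [sub_add_cancel] at h6
      omega
    simp only [hinv, hf, h1, h5]
    linarith
  base_unique := fun b hb b' hb' _ => dvd_sub hb hb'

theorem count_take_succ (l : List Bool) {m : ℕ} (hm : m < l.length) :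
    (l.take (m + 1)).count true = (l.take m).count true + if l[m] = true then 1 else 0 := by
  rw [← List.take_append_getElem hm, List.count_append, List.count_singleton]
  simp only [beq_iff_eq]

/-- The word recording at which times a height function jumps along the rotation by `k`. -/
def jumpWord (k n : ℕ) (y : ℤ → ℤ) : List Bool :=
  List.ofFn fun m : Fin n => decide (y (k * (m + 1 : ℕ)) ≠ y (k * (m : ℕ)))

theorem length_jumpWord (y : ℤ → ℤ) : (jumpWord k n y).length = n := List.length_ofFn

/-- Starting from `y 0 = 0`, each letter `true` records one jump by `n`. -/
theorem eq_count_jumpWord [NeZero n] {f : Equiv.Perm ℤ} (hf : ∀ j, f j = j + k) {y : ℤ → ℤ}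
    (hy : y ∈ heights n f {j | (n : ℤ) ∣ j}) {m : ℕ} (hm : m ≤ n) :
    y (k * m) = n * ((jumpWord k n y).take m).count true := by
  have hn : (n : ℤ) ≠ 0 := by exact_mod_cast NeZero.ne n
  induction m with
  | zero =>
    have := (hy.2.2.2 0).2 (dvd_zero _)
    simpa using this
  | succ m ih =>
    have ih := ih (by omega)
    have hmn : m < (jumpWord k n y).length := by
      rw [length_jumpWord]
      omega
    rw [count_take_succ _ hmn]
    have hget : (jumpWord k n y)[m] = decide (y (k * (m + 1 : ℕ)) ≠ y (k * (m : ℕ))) := by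
      simp only [jumpWord, List.getElem_ofFn]
    rw [hget]
    have h1 := hy.2.1 (k * m)
    rw [hf, show (k : ℤ) * m + k = k * (m + 1 : ℕ) by push_cast; ring] at h1
    rcases h1 with h1 | h1
    · rw [h1]
      simp [ih]
    · rw [h1]
      simp only [ne_eq, add_eq_left, hn, not_false_eq_true, decide_true, if_true, ih]
      push_cast
      ring

theorem jumpWord_injOn [NeZero n] {f : Equiv.Perm ℤ} (h : k.Coprime n) (hf : ∀ j, f j = j + k) :
    Set.InjOn (jumpWord k n) (heights n f {j | (n : ℤ) ∣ j}) := by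
  intro y hy z hz hyz
  funext j
  obtain ⟨m, hm⟩ := dvd_sub_mul_phase h j
  have h1 := phase_lt (k := k) (n := n) j
  rw [show j = k * phase k n j + n * m by linarith, heights_add_mul hy, heights_add_mul hz,
    eq_count_jumpWord hf hy h1.le, eq_count_jumpWord hf hz h1.le, hyz]

/-- After `a` up steps and `b` right steps the condition `j ≤ y j` at `j = k (a + b)` reads `k (a +
b) ≤ n a`, which is the diagonal inequality; the base condition at `k n` counts the up steps. -/
theorem jumpWord_mem_dyckPaths [NeZero n] {f : Equiv.Perm ℤ} (hkn : k ≤ n) (hf : ∀ j, f j = j + k)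
    {y : ℤ → ℤ} (hy : y ∈ heights n f {j | (n : ℤ) ∣ j}) : jumpWord k n y ∈ dyckPaths k (n - k) := by
  have hn : (0 : ℤ) < n := by exact_mod_cast Nat.pos_of_ne_zero (NeZero.ne n)
  have hlen := length_jumpWord (k := k) (n := n) y
  have hsum := List.count_true_add_count_false (jumpWord k n y)
  have htrue : (jumpWord k n y).count true = k := by
    have h1 := eq_count_jumpWord hf hy le_rfl
    rw [List.take_of_length_le hlen.le, (hy.2.2.2 _).2 (dvd_mul_left _ _), mul_comm] at h1
    exact_mod_cast (mul_left_cancel₀ hn.ne' h1).symm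
  refine ⟨htrue, by omega, fun p hp => ?_⟩
  have hpl : p.length ≤ n := hlen ▸ hp.length_le
  have h1 := eq_count_jumpWord hf hy hpl
  rw [← List.prefix_iff_eq_take.1 hp] at h1
  have h2 := hy.2.2.1 (k * p.length)
  rw [h1, ← List.count_true_add_count_false p] at h2
  zify [hkn]
  push_cast at h2
  linarith

theorem exists_jumpWord_eq [NeZero n] {f : Equiv.Perm ℤ} (hkn : k ≤ n) (hf : ∀ j, f j = j + k)
    (h : k.Coprime n) {l : List Bool} (hl : l ∈ dyckPaths k (n - k)) :
    ∃ y ∈ heights n f {j | (n : ℤ) ∣ j}, jumpWord k n y = l := by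
  have hn : (0 : ℤ) < n := by exact_mod_cast Nat.pos_of_ne_zero (NeZero.ne n)
  obtain ⟨ht, hfalse, hdom⟩ := hl
  have hlen : l.length = n := by
    rw [← List.count_true_add_count_false, ht, hfalse]
    omega
  have hfull : (l.take n).count true = k := by rw [List.take_of_length_le hlen.le, ht]
  have hle : ∀ m ≤ n, (k : ℤ) * m ≤ n * (l.take m).count true := by
    intro m hm
    have h1 := hdom _ (List.take_prefix m l)
    have h2 := List.count_true_add_count_false (l.take m)
    rw [List.length_take, hlen, min_eq_left hm] at h2
    zify [hkn] at h1
    have h3 : (m : ℤ) = (l.take m).count true + (l.take m).count false := by exact_mod_cast h2.symm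
    rw [h3]
    linarith
  -- The word prescribes `y` at the multiples `k t` with `t < n`; the second summand is the multiple
  -- of `n` that carries this to all integers.
  set y : ℤ → ℤ := fun j => n * (l.take (phase k n j)).count true + (j - k * phase k n j) with hy
  have hsucc : ∀ j, y (j + k) =
      n * (l.take (phase k n j + 1)).count true + (j + k - k * (phase k n j + 1)) := by
    intro j
    rcases phase_add h j with h1 | ⟨h1, h2⟩
    · simp only [hy, h1]
      push_cast
      rfl
    · simp only [hy, h2, h1, hfull]
      have : (phase k n j : ℤ) + 1 = n := by exact_mod_cast h1
      rw [this]
      simp only [List.take_zero, List.count_nil]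
      push_cast
      ring
  have hcount : ∀ m ≤ n, y (k * m) = n * (l.take m).count true := by
    intro m hm
    rcases hm.lt_or_eq with hm | rfl
    · simp only [hy, phase_mul h hm]
      ring
    · have h0 : phase k m (k * m) = 0 := (phase_eq_zero_iff h).2 (dvd_mul_left _ _)
      simp only [hy, h0, hfull]
      simp [mul_comm]
  refine ⟨y, ⟨fun j => ?_, fun j => ?_, fun j => ?_, fun j => ?_⟩, ?_⟩
  · simp only [hy, phase_add_period]
    ring
  · rw [hf, hsucc, count_take_succ _ (by rw [hlen]; exact phase_lt j)]
    split_ifs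
    · right
      simp only [hy]
      push_cast
      ring
    · left
      simp only [hy]
      push_cast
      ring
  · have := hle _ (phase_lt (k := k) (n := n) j).le
    simp only [hy]
    linarith
  · rw [Set.mem_ofPred_eq, ← phase_eq_zero_iff h]
    constructor
    · intro h1
      have h2 : (k : ℤ) * phase k n j = n * (l.take (phase k n j)).count true := by
        simp only [hy] at h1
        linarith
      have h3 : n ∣ k * phase k n j := ⟨_, by exact_mod_cast h2⟩
      -- A contact with the diagonal at time `t` means that `n` divides `k t`; by coprimality this
      -- happens only at `t = 0`, so touching exactly at the bases is automatic.
      exact Nat.eq_zero_of_dvd_of_lt (h.symm.dvd_of_dvd_mul_left h3) (phase_lt j)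
    · intro h1
      simp [hy, h1]
  · refine List.ext_getElem (by rw [length_jumpWord, hlen]) fun m hm hm' => ?_
    have hmn : m < n := by rwa [hlen] at hm'
    simp only [jumpWord, List.getElem_ofFn]
    rw [hcount _ hmn, hcount _ hmn.le, count_take_succ _ hm']
    cases hlm : l[m]
    · simp
    · have : n ≠ 0 := NeZero.ne n
      simp [mul_add, this]

theorem countPoly_coeff_rotation [NeZero n] {f : Equiv.Perm ℤ} (hkn : k ≤ n) (hf : ∀ j, f j = j + k)
    (hc : cycleNumber n f = 1) :
    (countPoly n k f).coeff (n - 1) = (dyckPaths k (n - k)).ncard := by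
  have h := coprime_of_cycleNumber_eq_one hf hc
  obtain ⟨m, hm, he⟩ := (isConcaveSystem_rotation hkn hf h).encard_heights
  have himage : jumpWord k n '' heights n f {j | (n : ℤ) ∣ j} = dyckPaths k (n - k) := by
    refine Set.Subset.antisymm ?_ fun l hl => exists_jumpWord_eq hkn hf h hl
    rintro _ ⟨y, hy, rfl⟩
    exact jumpWord_mem_dyckPaths hkn hf hy
  rw [← (jumpWord_injOn h hf).encard_image, himage] at he
  unfold lowCoeff at hm
  rw [hc] at hm
  rw [hm, Set.ncard, he]
  rfl

end Rotation

end PositroidCatalan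

namespace PositroidCatalan

open Polynomial

-- The point count polynomial of the configuration space

section PointCount

variable {n k : ℕ}

/-- For `n = 0` the bounds force the identity of `ℤ`, which is not a single cycle. -/
theorem BoundedAffinePerm.IsSingleCycle.ne_zero {f : BoundedAffinePerm k n}
    (hf : f.IsSingleCycle) : n ≠ 0 := by
  rintro rfl
  have h := const_of_isSingleCycle hf (t := id) (fun i => by
    have h1 := f.le_map i
    have h2 := f.map_le i
    rw [show f.toPerm i = i by push_cast at h2; omega]) 0 1
  exact absurd (show (0 : ℤ) = 1 from h) (by norm_num)

theorem BoundedAffinePerm.IsSingleCycle.cycleNumber_eq_one [NeZero n] {f : BoundedAffinePerm k n}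
    (hf : f.IsSingleCycle) : cycleNumber n f.toPerm = 1 := by
  have hconst : ∀ x ∈ invariants n f.toPerm, ∀ i j, x i = x j := by
    intro x hx i j
    have hcast : ∀ j : ℤ, x ((j : ZMod n).cast : ℤ) = x j := fun j => by
      refine periodic_of_dvd hx.1 ?_
      rw [← ZMod.intCast_eq_intCast_iff_dvd_sub]
      simp
    have h := const_of_isSingleCycle hf (t := fun y => x (y.cast : ℤ))
      (fun i => by simp only [hcast, hx.2]) (i : ZMod n) (j : ZMod n)
    simpa only [hcast] using h
  have hone : (fun _ => 1 : ℤ → ℚ) ∈ invariants n f.toPerm := ⟨fun _ => rfl, fun _ => rfl⟩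
  unfold cycleNumber
  rw [finrank_eq_one_iff_of_nonzero' (⟨_, hone⟩ : invariants n f.toPerm)]
  · rintro ⟨x, hx⟩
    refine ⟨x 0, Subtype.ext (funext fun j => ?_)⟩
    change x 0 * 1 = x j
    rw [mul_one, hconst x hx 0 j]
  · intro h
    have := congrFun (Subtype.ext_iff.1 h) 0
    exact one_ne_zero this

theorem BoundedAffinePerm.displacement_eq (f : BoundedAffinePerm k n) :
    displacement n f.toPerm = k * n := by
  rw [displacement_eq_sum_Icc, f.sum_sub]

theorem BoundedAffinePerm.bounded (f : BoundedAffinePerm k n) (j : ℤ) :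
    j ≤ f.toPerm j ∧ f.toPerm j ≤ j + n := ⟨f.le_map j, f.map_le j⟩

theorem existsUnique_isPointCount [NeZero n] {f : BoundedAffinePerm k n} (hf : f.IsSingleCycle) :
    ∃ P : ℤ[X], IsPointCount f P ∧ (∀ Q : ℤ[X], IsPointCount f Q → Q = P) ∧
      P.eval 1 = (countPoly n k f.toPerm).coeff (n - 1) := by
  have hn : 0 < n := Nat.pos_of_ne_zero (NeZero.ne n)
  have hcyc := hf.cycleNumber_eq_one
  obtain ⟨P, hP⟩ := X_pow_dvd_countPoly f.map_add_period f.displacement_eq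
  rw [hcyc] at hP
  have hcount : ∀ (F : Type) [Field F] [Finite F],
      (Nat.card (ConfigurationSpace f F) : ℤ) = P.eval ((Nat.card F : ℤ) - 1) := by
    intro F _ _
    have h1 := hasCount_countPoly (k := k) f.map_add_period f.displacement_eq F
    have h2 := natCard_matSet_mul (F := F) hf
    have hq : 2 ≤ Nat.card F := Finite.one_lt_card
    have h3 : (Nat.card (matSet n k F f.toPerm) : ℤ) * ((Nat.card F : ℤ) - 1) =
        Nat.card (ConfigurationSpace f F) * (Nat.card (GL (Fin k) F) * ((Nat.card F : ℤ) - 1) ^ n) := by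
      have := congrArg (Nat.cast : ℕ → ℤ) h2
      push_cast [show 1 ≤ Nat.card F by omega] at this
      exact this
    rw [h1, hP, eval_mul, eval_pow, eval_X] at h3
    have h4 : (Nat.card (GL (Fin k) F) : ℤ) * ((Nat.card F : ℤ) - 1) ^ n ≠ 0 := by
      refine mul_ne_zero (by exact_mod_cast Nat.card_pos.ne') (pow_ne_zero _ ?_)
      omega
    apply mul_right_cancel₀ h4
    rw [← h3]
    conv_rhs => rw [← Nat.sub_add_cancel (show 1 ≤ n from hn), pow_succ]
    ring
  -- `P` is the quotient of the count by `X^(n - 1)` in the variable `q - 1`, so evaluating at `q =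
  -- 1` gives its constant term.
  refine ⟨P.comp (X - 1), fun F _ _ => ?_, fun Q hQ => ?_, ?_⟩
  · rw [hcount, eval_comp]
    simp
  · have h1 : Q.comp (X + 1) = P := by
      refine eq_of_eval_card_sub_one fun F _ _ => ?_
      rw [← hcount, hQ F, eval_comp]
      simp
    rw [← h1, comp_assoc]
    simp
  · rw [hP, eval_comp, coeff_X_pow_mul', if_pos le_rfl, Nat.sub_self, coeff_zero_eq_eval_zero]
    simp

end PointCount

-- Maximal Deograms and the lowest coefficient

section MaximalDeograms

variable {n k : ℕ} [NeZero n]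

theorem IsPairOf.toPerm_eq {f : BoundedAffinePerm k n} {v w : Equiv.Perm (Fin n)}
    (h : IsPairOf f v w) : f.toPerm = pairPerm k v w := by
  ext j
  obtain ⟨m, i, rfl⟩ := exists_coord n j
  rw [affinePerms_add_mul f.map_add_period, h.2.2 i, pairPerm_apply]
  by_cases hi : (w i : ℕ) < k
  · rw [if_pos hi, if_pos hi]
    ring
  · rw [if_neg hi, if_neg hi]
    ring

theorem pairPerm_apply_coord_lt_iff (v w : Equiv.Perm (Fin n)) (i : Fin n) :
    (w i : ℕ) < k ↔ (n : ℤ) < pairPerm k v w ((i : ℤ) + 1 + n * 0) := by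
  rw [pairPerm_apply]
  have := (v.symm (w i)).2
  by_cases hi : (w i : ℕ) < k
  · rw [if_pos hi]
    exact iff_of_true hi (by omega)
  · rw [if_neg hi]
    exact iff_of_false hi (by omega)

/-- Whether a value of `f` exceeds one period shows which values of `w` are small; this determines
`w`, and then `v`. Hence all `f`-Deograms have the same shape and the same exits. -/
theorem pairPerm_injective {v w v' w' : Equiv.Perm (Fin n)} (hw : IsGrassmannian k w)
    (hw' : IsGrassmannian k w') (h : pairPerm k v w = pairPerm k v' w') : v = v' ∧ w = w' := by
  have hww : w = w' := hw.eq_of_iff hw' fun i => by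
    rw [pairPerm_apply_coord_lt_iff v w, pairPerm_apply_coord_lt_iff v' w', h]
  subst hww
  refine ⟨?_, rfl⟩
  have h1 : v.symm = v'.symm := by
    ext x
    have h2 := congrArg (fun g : Equiv.Perm ℤ => g ((w.symm x : Fin n) + 1 + n * 0)) h
    simp only [pairPerm_apply, Equiv.apply_symm_apply] at h2
    exact congrArg Fin.val (coord_inj h2).1
  exact Equiv.symm_bijective.1 h1

-- For a fixed shape, most crossings means fewest elbows. Vanishing below degree `n - 1` bounds the
-- elbows from below, and positivity in this degree shows that the bound is attained.
open Classical in
theorem ncard_maximalDeograms {f : BoundedAffinePerm k n} (hc : cycleNumber n f.toPerm = 1) :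
    ((maximalDeograms f).ncard : ℤ) = (countPoly n k f.toPerm).coeff (n - 1) := by
  have hb := f.bounded
  have hd := f.displacement_eq
  have hfm : f.toPerm ∈ affinePerms n := f.map_add_period
  have hpos := countPoly_coeff_pos hfm hb hd
  rw [hc] at hpos
  have hzero : ∀ d < n - 1, (countPoly n k f.toPerm).coeff d = 0 := fun d hd' =>
    countPoly_coeff_eq_zero hfm hd (by omega)
  obtain ⟨hkn, v, w, hw, hfvw⟩ := exists_pairPerm hfm hb hd
  obtain ⟨lam, hlam, hlw⟩ := hw.exists_youngDiagram hkn
  have hR := (hasCount_pairPerm hkn hlam hlw v).countPoly_eq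
  rw [← hfvw] at hR
  rw [hR] at hpos hzero ⊢
  have hcoeff := deogramSum_coeff hzero
  have hle : ∀ D ⊆ lam.cells, IsRelabeledDeogram k lam 1 (permExt v⁻¹) D → n - 1 ≤ D.card := by
    intro D hD h
    by_contra hlt
    have := deogramSum_coeff_pos hD h
    rw [hzero _ (not_le.1 hlt)] at this
    exact lt_irrefl _ this
  have hpair : IsPairOf f v w := by
    rw [hfvw, pairPerm_bounded_iff] at hb
    refine ⟨bruhatLE_of_isGrassmannian hw hb.1 hb.2, hw, fun i => ?_⟩
    have h1 := pairPerm_apply (k := k) v w 0 i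
    rw [mul_zero, add_zero, zero_add] at h1
    rw [hfvw, h1]
    split_ifs <;> simp
  have hiff : ∀ D, IsDeogram k lam D ∧ HasPathPerm k lam D v ↔
      D ⊆ lam.cells ∧ IsRelabeledDeogram k lam 1 (permExt v⁻¹) D := by
    intro D
    rw [hasPathPerm_iff hkn hlam]
    constructor
    · rintro ⟨⟨h1, h2⟩, h3⟩
      exact ⟨h1, fun x hx => h2 x.1 x.2 hx, h3⟩
    · rintro ⟨h1, h2, h3⟩
      exact ⟨⟨h1, fun r c hx => h2 (r, c) hx⟩, h3⟩
  have hdeo : ∀ x, x ∈ deograms f ↔ x.1 = lam ∧ x.2 ⊆ lam.cells ∧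
      IsRelabeledDeogram k lam 1 (permExt v⁻¹) x.2 := by
    rintro ⟨lam', D⟩
    constructor
    · rintro ⟨v', w', h1, h2, h3, h4, h5⟩
      obtain ⟨rfl, rfl⟩ := pairPerm_injective hw h1.2.1 (hfvw.symm.trans h1.toPerm_eq)
      have h6 : lam' = lam := youngDiagram_unique hkn h2 hlam h3 hlw
      subst h6
      exact ⟨rfl, (hiff D).1 ⟨h4, h5⟩⟩
    · rintro ⟨h1, h2⟩
      subst h1
      have h3 := (hiff D).2 h2
      exact ⟨v, w, hpair, hlam, hlw, h3.1, h3.2⟩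
  set S := lam.cells.powerset.filter fun D =>
    IsRelabeledDeogram k lam 1 (permExt v⁻¹) D ∧ D.card = n - 1 with hS
  have hSmem : ∀ D, D ∈ S ↔ (D ⊆ lam.cells ∧ IsRelabeledDeogram k lam 1 (permExt v⁻¹) D) ∧
      D.card = n - 1 := fun D => by
    rw [hS, Finset.mem_filter, Finset.mem_powerset, and_assoc]
  obtain ⟨D₀, hD₀⟩ : S.Nonempty := by
    rw [← Finset.card_pos]
    rw [hcoeff] at hpos
    exact_mod_cast hpos
  rw [hSmem] at hD₀
  have hcross : ∀ D ⊆ lam.cells, crossings (lam, D) = lam.cells.card - D.card := fun D hD =>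
    Finset.card_sdiff_of_subset hD
  have heq : maximalDeograms f = (fun D => (lam, D)) '' (S : Set (Finset (ℕ × ℕ))) := by
    ext ⟨lam', D⟩
    simp only [Set.mem_image, Finset.mem_coe, Prod.mk.injEq, exists_eq_right_right]
    constructor
    · rintro ⟨h1, h2⟩
      obtain ⟨h3, h4, h5⟩ := (hdeo _).1 h1
      simp only at h3 h4 h5
      subst h3
      refine ⟨(hSmem D).2 ⟨⟨h4, h5⟩, le_antisymm ?_ (hle D h4 h5)⟩, rfl⟩
      have h6 := h2 (lam', D₀) ((hdeo _).2 ⟨rfl, hD₀.1⟩)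
      rw [hcross _ h4, hcross _ hD₀.1.1] at h6
      have := Finset.card_le_card h4
      have := Finset.card_le_card hD₀.1.1
      omega
    · rintro ⟨h1, rfl⟩
      rw [hSmem] at h1
      refine ⟨(hdeo _).2 ⟨rfl, h1.1⟩, fun y hy => ?_⟩
      obtain ⟨lam', D''⟩ := y
      obtain ⟨h3, h4, h5⟩ := (hdeo _).1 hy
      simp only at h3 h4 h5
      subst h3
      rw [hcross _ h4, hcross _ h1.1.1]
      have := hle _ h4 h5
      omega
  rw [heq, Set.ncard_image_of_injective _ (fun D D' h => (Prod.mk.inj h).2), Set.ncard_coe_finset,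
    hcoeff]

end MaximalDeograms

end PositroidCatalan

theorem proposition8p4 {k n : ℕ} (f : PositroidCatalan.BoundedAffinePerm k n)
    (hf : f.IsSingleCycle) :
    (∃ P : Polynomial ℤ, PositroidCatalan.IsPointCount f P ∧
      (∀ Q : Polynomial ℤ, PositroidCatalan.IsPointCount f Q → Q = P) ∧
      P.eval 1 = (PositroidCatalan.maximalDeograms f).ncard) ∧
    ((∀ j : ℤ, f.toPerm j = j + k) →
      (PositroidCatalan.maximalDeograms f).ncard =
        (PositroidCatalan.dyckPaths k (n - k)).ncard) := by
  have : NeZero n := ⟨hf.ne_zero⟩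
  have hc := hf.cycleNumber_eq_one
  have hmax := PositroidCatalan.ncard_maximalDeograms hc
  refine ⟨?_, fun h => ?_⟩
  · obtain ⟨P, h1, h2, h3⟩ := PositroidCatalan.existsUnique_isPointCount hf
    exact ⟨P, h1, h2, h3.trans hmax.symm⟩
  · have hkn : k ≤ n := by
      have := f.map_le 0
      rw [h] at this
      omega
    rw [PositroidCatalan.countPoly_coeff_rotation hkn h hc] at hmax
    exact_mod_cast hmax
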